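/- Let $\mathbb T^2=[0,2\pi]^2$ with periodic boundary conditions, let $\mathbb Z^2_*=\mathbb Z^2\setminus\{0\}$, and write $\widehat f(k)=(2\pi)^{-2}\int_{\mathbb T^2}f(x)e^{-ik\cdot x}\,dx$. Fix $r>3$. For $s\ge 1$ and $\tau>0$ let $G^s_\tau$ be the space of real-valued, mean-free functions $f\in C^\infty(\mathbb T^2)$ with $$\|f\|_{G^s_\tau}=\Big(\sum_{k\in\mathbb Z^2_*}|k|^{2r}e^{2\tau|k|^{1/s}}|\widehat f(k)|^2\Big)^{1/2}<\infty,$$ and let $G^s=\bigcup_{\tau>0}G^s_\tau$. For $\alpha\ge 0$ consider the (singular) incompressible porous media equation $$\partial_t\theta+u\cdot\nabla\theta=0,\qquad u=(-\Delta)^{\alpha/2}\mathbf I\theta,\qquad \theta(\cdot,0)=\theta_0\qquad\text{on }\mathbb T^2, \tag{$*$}$$ where $(-\Delta)^{\alpha/2}\mathbf I$ is the Fourier multiplier operator with symbol $|k|^{\alpha}\,\widehat{\mathbf I}(k)$, $\widehat{\mathbf I}(k)=\Big(\frac{-k_1k_2}{k_1^2+k_2^2},\frac{k_1^2}{k_1^2+k_2^2}\Big)$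 for $k\in\mathbb Z^2_*$, and $\widehat{\mathbf I}(0)=0$. A solution of $(*)$ in $G^s$ on $[0,T)$ is a real-valued function $\theta$ on $\mathbb T^2\times[0,T)$ that satisfies $(*)$ pointwise (with a one-sided time derivative at $t=0$) and is such that for every $T'<T$ there is $\tau>0$ with $\theta(\cdot,t)\in G^s_\tau$ for all $t\in[0,T']$ and $\sup_{0\le t\le T'}\|\theta(\cdot,t)\|_{G^s_\tau}<\infty$. **Theorem.** Let either $\alpha\in(0,1]$ and $s\in[1,\frac1\alpha]$, or $\alpha=0$ and $s\ge 1$. Then for all $K_0>0$ and $\tau_0>0$ there is a time $T_*=T_*(\tau_0,K_0)>0$ (which may also depend on $r$, $\alpha$ and $s$) such that for every $\theta_0\in G^s_{\tau_0}$ with $$\|(-\Delta)^{r/2}e^{\tau_0(-\Delta)^{1/(2s)}}\theta_0\|_{L^2}=\|\theta_0\|_{G^s_{\tau_0}}\le K_0$$ there exists a unique solution of $(*)$ in $G^s$ on $[0,T_*)$. -/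

import Mathlib

open scoped ENNReal ContDiff

noncomputable section

namespace SIPM

/-- Points of the plane; functions on the torus `[0,2π]²` are functions on the plane that are
`2π`-periodic in each variable. -/
abbrev Plane : Type := Fin 2 → ℝ

/-- Frequencies, i.e. elements of `ℤ²`. -/
abbrev Freq : Type := Fin 2 → ℤ

/-- The Euclidean length `|k|` of a frequency. -/
def freqNorm (k : Freq) : ℝ := Real.sqrt ((k 0 : ℝ) ^ 2 + (k 1 : ℝ) ^ 2)

/-- The character `x ↦ exp (i k·x)`. -/
def character (k : Freq) (x : Plane) : ℂ :=
  Complex.exp (Complex.I * (((k 0 : ℝ) * x 0 + (k 1 : ℝ) * x 1 : ℝ) : ℂ))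

/-- `f` is `2π`-periodic in each of the two variables. -/
def IsPeriodic (f : Plane → ℝ) : Prop :=
  ∀ (j : Fin 2) (x : Plane), f (x + Pi.single j (2 * Real.pi)) = f x

/-- The Fourier coefficient `(2π)⁻² ∫_{[0,2π]²} f(x) exp (-i k·x) dx`. -/
def fourierCoef (f : Plane → ℝ) (k : Freq) : ℂ :=
  ((((2 * Real.pi) ^ 2)⁻¹ : ℝ) : ℂ) *
    ∫ x in Set.Icc (0 : Plane) (fun _ => 2 * Real.pi), (f x : ℂ) * character (-k) x

/-- The Fourier multiplier operator with symbol `m`. -/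
def fourierMultiplier (m : Freq → ℝ) (f : Plane → ℝ) (x : Plane) : ℂ :=
  ∑' k : Freq, (m k : ℂ) * fourierCoef f k * character k x

/-- The symbol of the operator `I = (I₁, I₂)` of the incompressible porous media equation:
`I₁(k) = -k₁k₂/|k|²` and `I₂(k) = k₁²/|k|²` for `k ≠ 0`, and `I(0) = 0`. -/
def ipmSymbol (j : Fin 2) (k : Freq) : ℝ :=
  if k = 0 then 0
  else ![-((k 0 : ℝ) * (k 1 : ℝ)), (k 0 : ℝ) ^ 2] j / ((k 0 : ℝ) ^ 2 + (k 1 : ℝ) ^ 2)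

/-- The `j`-th component of the velocity `u = (-Δ)^{α/2} I θ`, where `(-Δ)^{α/2}` has the symbol
`|k|^α`. -/
def velocity (α : ℝ) (θ : Plane → ℝ) (j : Fin 2) (x : Plane) : ℂ :=
  fourierMultiplier (fun k => freqNorm k ^ α * ipmSymbol j k) θ x

/-- The partial derivative of `f` in the `j`-th variable. -/
def partialDeriv (j : Fin 2) (f : Plane → ℝ) (x : Plane) : ℝ :=
  fderiv ℝ f x (Pi.single j 1)

/-- The norm `‖(-Δ)^{r/2} e^{τ(-Δ)^{1/(2s)}} f‖`, with values in `[0,∞]`, that is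
`(∑_{k ≠ 0} |k|^{2r} e^{2τ|k|^{1/s}} |f̂(k)|²)^{1/2}`. -/
def gevreyNorm (r s τ : ℝ) (f : Plane → ℝ) : ℝ≥0∞ :=
  (∑' k : {k : Freq // k ≠ 0},
    ENNReal.ofReal (freqNorm k.1 ^ (2 * r) * Real.exp (2 * τ * freqNorm k.1 ^ (1 / s)) *
      ‖fourierCoef f k.1‖ ^ 2)) ^ (1 / 2 : ℝ)

/-- The space `G^s_τ` of smooth mean-free functions on the torus with finite norm. The Gevrey
class `G^s` is the union of the spaces `G^s_τ` over `τ > 0`. -/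
structure MemGevrey (r s τ : ℝ) (f : Plane → ℝ) : Prop where
  smooth : ContDiff ℝ ∞ f
  periodic : IsPeriodic f
  mean_zero : ∫ x in Set.Icc (0 : Plane) (fun _ => 2 * Real.pi), f x = 0
  norm_lt_top : gevreyNorm r s τ f < ⊤

/-- `θ` is a solution in `G^s` on `[0, T)` of
`∂ₜθ + u·∇θ = 0`, `u = (-Δ)^{α/2} I θ`, `θ(·,0) = θ₀`.
Taking values in `G^s` means that on each compact subinterval of `[0, T)` the functions `θ(·,t)`
form a bounded subset of one of the spaces `G^s_τ` with `τ > 0`. The equation holds pointwise, with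
a one-sided time derivative at `t = 0`; it is written in `ℂ` because Fourier series are. -/
structure IsGevreySolution (r s α T : ℝ) (θ₀ : Plane → ℝ) (θ : ℝ → Plane → ℝ) : Prop where
  gevrey : ∀ T' : ℝ, T' < T → ∃ τ : ℝ, 0 < τ ∧ ∃ M : ℝ, ∀ t ∈ Set.Icc (0 : ℝ) T',
    MemGevrey r s τ (θ t) ∧ gevreyNorm r s τ (θ t) ≤ ENNReal.ofReal M
  equation : ∀ t ∈ Set.Ico (0 : ℝ) T, ∀ x : Plane,
    HasDerivWithinAt (fun t' : ℝ => (θ t' x : ℂ))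
      (-∑ j : Fin 2, velocity α (θ t) j x * (partialDeriv j (θ t) x : ℂ)) (Set.Ico (0 : ℝ) T) t
  initial : θ 0 = θ₀

end SIPM

end

/-!
On the Fourier side the equation becomes an infinite quadratic system for the coefficients, in which
the transport term loses one derivative from the gradient and `α` from the velocity. In a weighted
`ℓ²` energy the velocity being divergence free and real makes the leading part skew-adjoint, so that
only the commutator with the weight `|k|^r exp (τ |k|^σ)`, `σ = 1/s`, contributes. Sharing the
derivatives among the three factors, one is left with a loss of `σ/2` derivatives on each of the two
high-frequency factors, where `α ≤ σ` is used. Letting the radius `τ` decrease linearly in time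
produces a negative term with exactly `σ` derivatives, which absorbs this loss as long as the norm
stays below twice its initial size.

Existence follows by applying the estimate to Galerkin truncations. Exponential decay bounds the
second time derivatives of the coefficients by a rapidly decreasing sequence, and the resulting
second-order Taylor bound passes to the limit along an ultrafilter, which gives the equation for the
limit without any equicontinuity argument. Uniqueness is the same commutator estimate for the
difference of two solutions, with the weight `exp (τ |k|^σ)`. The radius is used up in finite time,
so the estimate is applied on successive short intervals, all of the same length because the two
solutions have a common radius of analyticity.
-/

noncomputable section

namespace SIPM

open ComplexConjugate Filter Topology MeasureTheory

/-! ### Power and exponential weights on the half-line -/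

lemma mul_rpow_sub_rpow_le_of_le_one {σ m M : ℝ} (hσ1 : σ ≤ 1) (hm : 0 < m) (hM : m ≤ M) :
    m * (M ^ σ - m ^ σ) ≤ (M - m) * m ^ σ := by
  have hquot : 1 ≤ M / m := (one_le_div hm).2 hM
  have hpow : (M / m) ^ σ ≤ M / m := by
    simpa using Real.rpow_le_rpow_of_exponent_le hquot hσ1
  rw [Real.div_rpow (hm.le.trans hM) hm.le, div_le_div_iff₀ (Real.rpow_pos_of_pos hm σ) hm] at hpow
  linarith

lemma mul_rpow_sub_rpow_le_of_one_le {r m M : ℝ} (hr : 1 ≤ r) (hm : 0 < m) (hM : m ≤ M) :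
    M * (M ^ r - m ^ r) ≤ r * (M - m) * M ^ r := by
  have hM0 : 0 < M := hm.trans_le hM
  have hp : 0 < M ^ r := Real.rpow_pos_of_pos hM0 r
  have hbernoulli : 1 + r * ((m - M) / M) ≤ (m / M) ^ r := by
    have h := one_add_mul_self_le_rpow_one_add (s := (m - M) / M)
      (by rw [le_div_iff₀ hM0]; linarith) hr
    rwa [show 1 + (m - M) / M = m / M by field_simp; ring] at h
  rw [Real.div_rpow hm.le hM0.le, le_div_iff₀ hp] at hbernoulli
  have hscaled := mul_le_mul_of_nonneg_left hbernoulli hM0.le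
  have hexpand : M * ((1 + r * ((m - M) / M)) * M ^ r) = M * M ^ r - r * (M - m) * M ^ r := by
    field_simp
    ring
  linarith

/-- The analytic part `exp (τ x ^ σ)` of the Gevrey weight of radius `τ`, where `σ = 1 / s`. -/
def expWeight (τ σ x : ℝ) : ℝ := Real.exp (τ * x ^ σ)

/-- The Gevrey weight `x ^ r * exp (τ x ^ σ)`, where `σ = 1 / s`. -/
def gevreyWeight (r τ σ x : ℝ) : ℝ := x ^ r * expWeight τ σ x

section weights

variable {r τ τ' σ x y z m M : ℝ}

lemma expWeight_pos (τ σ x : ℝ) : 0 < expWeight τ σ x := Real.exp_pos _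

lemma one_le_expWeight (hτ : 0 ≤ τ) (hx : 0 ≤ x) : 1 ≤ expWeight τ σ x :=
  Real.one_le_exp (mul_nonneg hτ (Real.rpow_nonneg hx σ))

lemma expWeight_mono (hτ : 0 ≤ τ) (hσ : 0 ≤ σ) (hx : 0 ≤ x) (h : x ≤ y) :
    expWeight τ σ x ≤ expWeight τ σ y :=
  Real.exp_le_exp.2 (mul_le_mul_of_nonneg_left (Real.rpow_le_rpow hx h hσ) hτ)

lemma expWeight_mono_radius (h : τ ≤ τ') (hx : 0 ≤ x) : expWeight τ σ x ≤ expWeight τ' σ x :=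
  Real.exp_le_exp.2 (mul_le_mul_of_nonneg_right h (Real.rpow_nonneg hx σ))

lemma expWeight_le_mul (hτ : 0 ≤ τ) (hσ0 : 0 ≤ σ) (hσ1 : σ ≤ 1) (hx : 0 ≤ x) (hy : 0 ≤ y)
    (hz : 0 ≤ z) (h : z ≤ x + y) : expWeight τ σ z ≤ expWeight τ σ x * expWeight τ σ y := by
  rw [expWeight, expWeight, expWeight, ← Real.exp_add, ← mul_add]
  exact Real.exp_le_exp.2 (mul_le_mul_of_nonneg_left ((Real.rpow_le_rpow hz h hσ0).trans
    (Real.rpow_add_le_add_rpow hx hy hσ0 hσ1)) hτ)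

lemma expWeight_sub_le (τ σ x y : ℝ) :
    expWeight τ σ y - expWeight τ σ x ≤ τ * (y ^ σ - x ^ σ) * expWeight τ σ y := by
  have hexp := Real.add_one_le_exp (τ * x ^ σ - τ * y ^ σ)
  have hfactor : expWeight τ σ x = Real.exp (τ * x ^ σ - τ * y ^ σ) * expWeight τ σ y := by
    rw [expWeight, expWeight, ← Real.exp_add, sub_add_cancel]
  rw [hfactor]
  nlinarith [expWeight_pos τ σ y]

lemma mul_expWeight_sub_le (hτ : 0 ≤ τ) (hσ1 : σ ≤ 1) (hm : 0 < m) (hM : m ≤ M) :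
    m * (expWeight τ σ M - expWeight τ σ m) ≤ τ * (M - m) * m ^ σ * expWeight τ σ M := by
  have hpow := mul_rpow_sub_rpow_le_of_le_one hσ1 hm hM
  have hexp := expWeight_pos τ σ M
  calc m * (expWeight τ σ M - expWeight τ σ m)
      ≤ m * (τ * (M ^ σ - m ^ σ) * expWeight τ σ M) := by gcongr; exact expWeight_sub_le τ σ m M
    _ = τ * (m * (M ^ σ - m ^ σ)) * expWeight τ σ M := by ring
    _ ≤ τ * ((M - m) * m ^ σ) * expWeight τ σ M := by gcongr
    _ = τ * (M - m) * m ^ σ * expWeight τ σ M := by ring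

lemma hasDerivAt_expWeight_sq (τ ν σ x t : ℝ) :
    HasDerivAt (fun t => expWeight (τ - ν * t) σ x ^ 2)
      (-(2 * ν) * x ^ σ * expWeight (τ - ν * t) σ x ^ 2) t := by
  have hexponent : HasDerivAt (fun t => (τ - ν * t) * x ^ σ) (-ν * x ^ σ) t := by
    simpa using (((hasDerivAt_id t).const_mul ν).const_sub τ).mul_const (x ^ σ)
  refine (hexponent.exp.pow 2).congr_deriv ?_
  simp only [expWeight, Nat.cast_ofNat, Nat.add_one_sub_one, pow_one]
  ring

lemma gevreyWeight_nonneg (r τ σ : ℝ) (hx : 0 ≤ x) : 0 ≤ gevreyWeight r τ σ x :=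
  mul_nonneg (Real.rpow_nonneg hx r) (expWeight_pos _ _ _).le

lemma expWeight_le_gevreyWeight (hr : 0 ≤ r) (hx : 1 ≤ x) :
    expWeight τ σ x ≤ gevreyWeight r τ σ x :=
  le_mul_of_one_le_left (expWeight_pos _ _ _).le (Real.one_le_rpow hx hr)

lemma gevreyWeight_mono (hr : 0 ≤ r) (hτ : 0 ≤ τ) (hσ : 0 ≤ σ) (hx : 0 ≤ x) (h : x ≤ y) :
    gevreyWeight r τ σ x ≤ gevreyWeight r τ σ y :=
  mul_le_mul (Real.rpow_le_rpow hx h hr) (expWeight_mono hτ hσ hx h) (expWeight_pos _ _ _).le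
    (Real.rpow_nonneg (hx.trans h) r)

lemma gevreyWeight_mono_radius (h : τ ≤ τ') (hx : 0 ≤ x) :
    gevreyWeight r τ σ x ≤ gevreyWeight r τ' σ x :=
  mul_le_mul_of_nonneg_left (expWeight_mono_radius h hx) (Real.rpow_nonneg hx r)

lemma mul_gevreyWeight_sub_le (hr : 1 ≤ r) (hτ : 0 ≤ τ) (hσ0 : 0 ≤ σ) (hσ1 : σ ≤ 1)
    (hm : 1 ≤ m) (hM : m ≤ M) :
    m * (gevreyWeight r τ σ M - gevreyWeight r τ σ m) ≤
      (τ + r) * (M - m) * m ^ σ * gevreyWeight r τ σ M := by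
  have hm0 : 0 < m := by linarith
  have hM0 : 0 < M := by linarith
  have : 0 ≤ M - m := sub_nonneg.2 hM
  have hpow_diff : 0 ≤ M ^ r - m ^ r :=
    sub_nonneg.2 (Real.rpow_le_rpow hm0.le hM (by linarith))
  have hexp := expWeight_pos τ σ M
  have hfirst := mul_expWeight_sub_le hτ hσ1 hm0 hM
  have hsecond : m * (M ^ r - m ^ r) ≤ r * (M - m) * M ^ r :=
    (mul_le_mul_of_nonneg_right hM hpow_diff).trans (mul_rpow_sub_rpow_le_of_one_le hr hm0 hM)
  calc m * (gevreyWeight r τ σ M - gevreyWeight r τ σ m)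
      = M ^ r * (m * (expWeight τ σ M - expWeight τ σ m)) +
          m * (M ^ r - m ^ r) * expWeight τ σ m := by
        simp only [gevreyWeight]; ring
    _ ≤ M ^ r * (τ * (M - m) * m ^ σ * expWeight τ σ M) +
          r * (M - m) * M ^ r * expWeight τ σ M := by
        refine add_le_add (by gcongr) ?_
        exact mul_le_mul hsecond (expWeight_mono hτ hσ0 hm0.le hM) (expWeight_pos _ _ _).le
          (by positivity)
    _ ≤ M ^ r * (τ * (M - m) * m ^ σ * expWeight τ σ M) +
          r * (M - m) * M ^ r * expWeight τ σ M * m ^ σ :=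
        add_le_add le_rfl (le_mul_of_one_le_right (by positivity) (Real.one_le_rpow hm hσ0))
    _ = (τ + r) * (M - m) * m ^ σ * gevreyWeight r τ σ M := by simp only [gevreyWeight]; ring

lemma hasDerivAt_gevreyWeight_sq (r τ ν σ x t : ℝ) :
    HasDerivAt (fun t => gevreyWeight r (τ - ν * t) σ x ^ 2)
      (-(2 * ν) * x ^ σ * gevreyWeight r (τ - ν * t) σ x ^ 2) t := by
  simp only [gevreyWeight, mul_pow]
  refine ((hasDerivAt_expWeight_sq τ ν σ x t).const_mul ((x ^ r) ^ 2)).congr_deriv ?_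
  ring

end weights

lemma min_mul_abs_sub_le {w : ℝ → ℝ} {σ C x y d : ℝ} (hC : 0 ≤ C) (hσ : 0 ≤ σ)
    (hw0 : ∀ x, 0 ≤ x → 0 ≤ w x) (hw : ∀ x y, 0 ≤ x → x ≤ y → w x ≤ w y)
    (h : ∀ m M, 1 ≤ m → m ≤ M → m * (w M - w m) ≤ C * (M - m) * m ^ σ * w M)
    (hx : 1 ≤ x) (hy : 1 ≤ y) (hxy : x ≤ y + d) (hyx : y ≤ x + d) :
    min x y * |w x - w y| ≤ C * d * (x ^ (σ / 2) * y ^ (σ / 2)) * w (max x y) := by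
  have ordered : ∀ m M, 1 ≤ m → m ≤ M → M ≤ m + d →
      m * |w M - w m| ≤ C * d * (m ^ (σ / 2) * M ^ (σ / 2)) * w M := by
    intro m M hm hM hd
    have hm0 : 0 < m := by linarith
    have hMm : 0 ≤ M - m := sub_nonneg.2 hM
    have hd0 : M - m ≤ d := by linarith
    have hwM := hw0 M (by linarith)
    rw [abs_of_nonneg (sub_nonneg.2 (hw m M hm0.le hM))]
    have hsplit : m ^ σ ≤ m ^ (σ / 2) * M ^ (σ / 2) := by
      calc m ^ σ = m ^ (σ / 2) * m ^ (σ / 2) := by rw [← Real.rpow_add hm0, add_halves]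
        _ ≤ m ^ (σ / 2) * M ^ (σ / 2) := by gcongr
    calc m * (w M - w m) ≤ C * (M - m) * m ^ σ * w M := h m M hm hM
      _ ≤ C * d * (m ^ (σ / 2) * M ^ (σ / 2)) * w M := by
        have := hMm.trans hd0
        gcongr
  rcases le_total x y with hle | hle
  · rw [min_eq_left hle, max_eq_right hle, abs_sub_comm]
    exact ordered x y hx hle hyx
  · rw [min_eq_right hle, max_eq_left hle, mul_comm (x ^ _)]
    exact ordered y x hy hle hxy

/-! ### Sums and convolutions -/

lemma tsum_mul_le_sqrt_mul_sqrt {ι : Type*} {f g : ι → ℝ} (hf0 : ∀ i, 0 ≤ f i)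
    (hg0 : ∀ i, 0 ≤ g i) (hf : Summable fun i => f i ^ 2) (hg : Summable fun i => g i ^ 2) :
    (Summable fun i => f i * g i) ∧
      ∑' i, f i * g i ≤ √(∑' i, f i ^ 2) * √(∑' i, g i ^ 2) := by
  have hpartial : ∀ s : Finset ι,
      ∑ i ∈ s, f i * g i ≤ √(∑' i, f i ^ 2) * √(∑' i, g i ^ 2) := fun s =>
    (Real.sum_mul_le_sqrt_mul_sqrt s f g).trans <| by
      gcongr
      · exact hf.sum_le_tsum s fun i _ => sq_nonneg _
      · exact hg.sum_le_tsum s fun i _ => sq_nonneg _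
  have hnonneg : ∀ i, 0 ≤ f i * g i := fun i => mul_nonneg (hf0 i) (hg0 i)
  exact ⟨summable_of_sum_le hnonneg hpartial, Real.tsum_le_of_sum_le hnonneg hpartial⟩

section shear

variable {G : Type*} [AddCommGroup G]

/-- The change of variables `(k, l) ↦ (k - l, l)`, which turns a convolution into a product. -/
def shear : G × G ≃ G × G where
  toFun p := (p.1 - p.2, p.2)
  invFun p := (p.1 + p.2, p.2)
  left_inv p := by simp
  right_inv p := by simp

/-- The change of variables `(k, l) ↦ (k, k - l)`, which swaps the factors of a convolution. -/
def reflect : G × G ≃ G × G where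
  toFun p := (p.1, p.1 - p.2)
  invFun p := (p.1, p.1 - p.2)
  left_inv p := by simp
  right_inv p := by simp

variable {f g X Y : G → ℝ}

lemma summable_shear (hf : Summable f) (hg : Summable g) (hf0 : ∀ k, 0 ≤ f k)
    (hg0 : ∀ k, 0 ≤ g k) : Summable fun p : G × G => f (p.1 - p.2) * g p.2 :=
  shear.summable_iff.2 (hf.mul_of_nonneg hg hf0 hg0)

lemma tsum_shear (hf : Summable f) (hg : Summable g) (hf0 : ∀ k, 0 ≤ f k) (hg0 : ∀ k, 0 ≤ g k) :
    ∑' p : G × G, f (p.1 - p.2) * g p.2 = (∑' k, f k) * ∑' k, g k := by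
  rw [hf.tsum_mul_tsum hg (hf.mul_of_nonneg hg hf0 hg0)]
  exact shear.tsum_eq fun p : G × G => f p.1 * g p.2

lemma summable_and_tsum_reflect (hf : Summable f) (hg : Summable g) (hf0 : ∀ k, 0 ≤ f k)
    (hg0 : ∀ k, 0 ≤ g k) :
    (Summable fun p : G × G => f (p.1 - p.2) * g p.1) ∧
      ∑' p : G × G, f (p.1 - p.2) * g p.1 = (∑' k, f k) * ∑' k, g k := by
  have hprod := hg.mul_of_nonneg hf hg0 hf0
  have hcomp : (fun p : G × G => f (p.1 - p.2) * g p.1) =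
      (fun p : G × G => g p.1 * f p.2) ∘ reflect := funext fun p => mul_comm _ _
  rw [hcomp]
  refine ⟨reflect.summable_iff.2 hprod, ?_⟩
  rw [mul_comm, hg.tsum_mul_tsum hf hprod]
  exact reflect.tsum_eq fun p : G × G => g p.1 * f p.2

-- Schur's test: `Y(l) Y(k) ≤ (Y(l)² + Y(k)²) / 2` reduces the sum to two products.
lemma summable_and_tsum_convolution_le (hX : Summable X) (hY : Summable fun k => Y k ^ 2)
    (hX0 : ∀ k, 0 ≤ X k) (hY0 : ∀ k, 0 ≤ Y k) :
    (Summable fun p : G × G => X (p.1 - p.2) * (Y p.2 * Y p.1)) ∧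
      ∑' p : G × G, X (p.1 - p.2) * (Y p.2 * Y p.1) ≤ (∑' k, X k) * ∑' k, Y k ^ 2 := by
  have hsq0 : ∀ k, 0 ≤ Y k ^ 2 := fun k => sq_nonneg (Y k)
  have hsum := summable_shear hX hY hX0 hsq0
  obtain ⟨hsum', htsum'⟩ := summable_and_tsum_reflect hX hY hX0 hsq0
  have hyoung : ∀ p : G × G, X (p.1 - p.2) * (Y p.2 * Y p.1) ≤
      (1 / 2) * (X (p.1 - p.2) * Y p.2 ^ 2 + X (p.1 - p.2) * Y p.1 ^ 2) := fun p => by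
    nlinarith [mul_nonneg (hX0 (p.1 - p.2)) (sq_nonneg (Y p.2 - Y p.1))]
  have hmajor := (hsum.add hsum').mul_left (1 / 2)
  have hsummable := hmajor.of_nonneg_of_le
    (fun p => mul_nonneg (hX0 _) (mul_nonneg (hY0 _) (hY0 _))) hyoung
  refine ⟨hsummable, (hsummable.tsum_le_tsum hyoung hmajor).trans_eq ?_⟩
  rw [tsum_mul_left, hsum.tsum_add hsum', tsum_shear hX hY hX0 hsq0, htsum']
  ring

lemma summable_and_tsum_convolution_swap_le (hX : Summable X) (hY : Summable fun k => Y k ^ 2)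
    (hX0 : ∀ k, 0 ≤ X k) (hY0 : ∀ k, 0 ≤ Y k) :
    (Summable fun p : G × G => X p.2 * (Y (p.1 - p.2) * Y p.1)) ∧
      ∑' p : G × G, X p.2 * (Y (p.1 - p.2) * Y p.1) ≤ (∑' k, X k) * ∑' k, Y k ^ 2 := by
  obtain ⟨hsum, htsum⟩ := summable_and_tsum_convolution_le hX hY hX0 hY0
  have hcomp : (fun p : G × G => X p.2 * (Y (p.1 - p.2) * Y p.1)) =
      (fun p : G × G => X (p.1 - p.2) * (Y p.2 * Y p.1)) ∘ reflect := by
    ext p; simp [reflect]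
  rw [hcomp]
  refine ⟨reflect.summable_iff.2 hsum, ?_⟩
  rwa [← reflect.tsum_eq] at htsum

end shear

/-! ### Frequencies -/

section frequencies

variable {α σ : ℝ} {j k l : Freq}

lemma freqNorm_eq_norm (k : Freq) : freqNorm k = ‖((k 0 : ℝ) : ℂ) + ((k 1 : ℝ) : ℂ) * Complex.I‖ :=
  (Complex.norm_add_mul_I _ _).symm

lemma freqNorm_nonneg (k : Freq) : 0 ≤ freqNorm k := Real.sqrt_nonneg _

@[simp] lemma freqNorm_zero : freqNorm 0 = 0 := by simp [freqNorm]

@[simp] lemma freqNorm_neg (k : Freq) : freqNorm (-k) = freqNorm k := by simp [freqNorm]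

lemma freqNorm_sq (k : Freq) : freqNorm k ^ 2 = (k 0 : ℝ) ^ 2 + (k 1 : ℝ) ^ 2 :=
  Real.sq_sqrt (by positivity)

lemma freqNorm_add_le (k l : Freq) : freqNorm (k + l) ≤ freqNorm k + freqNorm l := by
  simp only [freqNorm_eq_norm]
  refine (norm_add_le _ _).trans_eq' ?_
  congr 1
  simp only [Pi.add_apply]
  push_cast
  ring

lemma freqNorm_sub_le (k l : Freq) : freqNorm (k - l) ≤ freqNorm k + freqNorm l := by
  simpa [sub_eq_add_neg] using freqNorm_add_le k (-l)

lemma abs_coord_le_freqNorm (k : Freq) (i : Fin 2) : |(k i : ℝ)| ≤ freqNorm k := by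
  apply Real.abs_le_sqrt
  fin_cases i
  · simpa using sq_nonneg (k 1 : ℝ)
  · simpa using sq_nonneg (k 0 : ℝ)

lemma norm_le_freqNorm (k : Freq) : ‖k‖ ≤ freqNorm k :=
  (pi_norm_le_iff_of_nonneg (freqNorm_nonneg k)).2 fun i => by
    rw [Int.norm_eq_abs]; exact abs_coord_le_freqNorm k i

lemma one_le_freqNorm (hk : k ≠ 0) : 1 ≤ freqNorm k := by
  obtain ⟨i, hi⟩ := Function.ne_iff.1 hk
  refine le_trans ?_ (abs_coord_le_freqNorm k i)
  exact_mod_cast Int.one_le_abs hi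

lemma freqNorm_rpow_le {β : ℝ} (h : α ≤ β) (hj : j ≠ 0) : freqNorm j ^ α ≤ freqNorm j ^ β :=
  Real.rpow_le_rpow_of_exponent_le (one_le_freqNorm hj) h

lemma freqNorm_rpow_le_self (h : α ≤ 1) (hj : j ≠ 0) : freqNorm j ^ α ≤ freqNorm j := by
  simpa using freqNorm_rpow_le h hj

lemma tendsto_freqNorm_cofinite : Tendsto freqNorm cofinite atTop := by
  rw [← Filter.cocompact_eq_cofinite]
  exact tendsto_atTop_mono norm_le_freqNorm (tendsto_norm_cocompact_atTop (E := Freq))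

lemma summable_freqNorm_rpow {p : ℝ} (hp : p < -2) : Summable fun k : Freq => freqNorm k ^ p := by
  have hsup := EisensteinSeries.summable_one_div_norm_rpow (k := -p) (by linarith)
  refine hsup.of_nonneg_of_le (fun k => Real.rpow_nonneg (freqNorm_nonneg k) _) fun k => ?_
  rw [neg_neg]
  obtain rfl | hk := eq_or_ne k 0
  · simp
  · exact Real.rpow_le_rpow_of_nonpos (by simpa using hk) (norm_le_freqNorm k) (by linarith)

lemma freqNorm_rpow_le_split (hασ : α ≤ σ) (hσ0 : 0 ≤ σ) (hσ1 : σ ≤ 1) (hjk : k = j + l)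
    (hj : j ≠ 0) (hk : k ≠ 0) (hl : l ≠ 0) :
    freqNorm j ^ α ≤ 2 * freqNorm l * (freqNorm j ^ (σ / 2) * freqNorm k ^ (σ / 2)) := by
  have hj1 := one_le_freqNorm hj
  have hk1 := one_le_freqNorm hk
  have hl1 := one_le_freqNorm hl
  have hproduct : freqNorm j ≤ (2 * freqNorm l) * freqNorm k := by
    have htriangle := freqNorm_sub_le k l
    rw [hjk, add_sub_cancel_right, ← hjk] at htriangle
    nlinarith
  have hhalf : freqNorm j ^ (σ / 2) ≤ 2 * freqNorm l * freqNorm k ^ (σ / 2) := by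
    calc freqNorm j ^ (σ / 2) ≤ ((2 * freqNorm l) * freqNorm k) ^ (σ / 2) := by gcongr
      _ = (2 * freqNorm l) ^ (σ / 2) * freqNorm k ^ (σ / 2) :=
          Real.mul_rpow (by linarith) (by linarith)
      _ ≤ (2 * freqNorm l) ^ (1 : ℝ) * freqNorm k ^ (σ / 2) := by gcongr <;> linarith
      _ = 2 * freqNorm l * freqNorm k ^ (σ / 2) := by rw [Real.rpow_one]
  calc freqNorm j ^ α ≤ freqNorm j ^ σ := freqNorm_rpow_le hασ hj
    _ = freqNorm j ^ (σ / 2) * freqNorm j ^ (σ / 2) := by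
        rw [← Real.rpow_add (by linarith), add_halves]
    _ ≤ freqNorm j ^ (σ / 2) * (2 * freqNorm l * freqNorm k ^ (σ / 2)) := by gcongr
    _ = 2 * freqNorm l * (freqNorm j ^ (σ / 2) * freqNorm k ^ (σ / 2)) := by ring

lemma freqNorm_triangle (hjk : k = j + l) :
    freqNorm k ≤ freqNorm l + freqNorm j ∧ freqNorm l ≤ freqNorm k + freqNorm j := by
  constructor
  · rw [hjk, add_comm j l]; exact freqNorm_add_le l j
  · have := freqNorm_sub_le k j
    rwa [hjk, add_sub_cancel_left, ← hjk] at this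

end frequencies

/-! ### Rapidly decreasing majorants -/

/-- Nonnegative sequences all of whose polynomial moments are summable. They serve as majorants for
Fourier coefficients, hence the sign condition. -/
structure RapidDecay (f : Freq → ℝ) : Prop where
  nonneg : ∀ k, 0 ≤ f k
  summable_moment : ∀ m : ℕ, Summable fun k => (1 + freqNorm k) ^ m * f k

namespace RapidDecay

variable {f g : Freq → ℝ}

lemma summable (hf : RapidDecay f) : Summable f := by simpa using hf.summable_moment 0

lemma of_le (hg : RapidDecay g) (h0 : ∀ k, 0 ≤ f k) (h : ∀ k, f k ≤ g k) : RapidDecay f where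
  nonneg := h0
  summable_moment m := by
    have hpow : ∀ k, 0 ≤ (1 + freqNorm k) ^ m := fun k =>
      pow_nonneg (by linarith [freqNorm_nonneg k]) m
    exact (hg.summable_moment m).of_nonneg_of_le (fun k => mul_nonneg (hpow k) (h0 k))
      fun k => mul_le_mul_of_nonneg_left (h k) (hpow k)

lemma const_mul (hf : RapidDecay f) {c : ℝ} (hc : 0 ≤ c) : RapidDecay fun k => c * f k where
  nonneg k := mul_nonneg hc (hf.nonneg k)
  summable_moment m := ((hf.summable_moment m).mul_left c).congr fun k => by ring

lemma add (hf : RapidDecay f) (hg : RapidDecay g) : RapidDecay fun k => f k + g k where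
  nonneg k := add_nonneg (hf.nonneg k) (hg.nonneg k)
  summable_moment m := ((hf.summable_moment m).add (hg.summable_moment m)).congr fun k => by ring

lemma pow_mul (hf : RapidDecay f) (n : ℕ) : RapidDecay fun k => freqNorm k ^ n * f k := by
  have hmoment : RapidDecay fun k => (1 + freqNorm k) ^ n * f k :=
    { nonneg k := mul_nonneg (pow_nonneg (by linarith [freqNorm_nonneg k]) n) (hf.nonneg k)
      summable_moment m := (hf.summable_moment (m + n)).congr fun k => by ring }
  refine hmoment.of_le (fun k => mul_nonneg (pow_nonneg (freqNorm_nonneg k) n) (hf.nonneg k))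
    fun k => ?_
  have := freqNorm_nonneg k
  have := hf.nonneg k
  gcongr
  linarith

lemma freqNorm_mul (hf : RapidDecay f) : RapidDecay fun k => freqNorm k * f k := by
  simpa using hf.pow_mul 1

lemma of_finite_support (hf0 : ∀ k, 0 ≤ f k) (hf : (Function.support f).Finite) :
    RapidDecay f where
  nonneg := hf0
  summable_moment _ := summable_of_hasFiniteSupport
    (hf.subset (Function.support_mul_subset_right _ _))

lemma convolution (hf : RapidDecay f) (hg : RapidDecay g) :
    RapidDecay fun k => ∑' l, f (k - l) * g l where
  nonneg k := tsum_nonneg fun l => mul_nonneg (hf.nonneg _) (hg.nonneg _)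
  summable_moment m := by
    have hF0 : ∀ {h : Freq → ℝ}, RapidDecay h → ∀ k, 0 ≤ (1 + freqNorm k) ^ m * h k := fun hh k =>
      mul_nonneg (pow_nonneg (by linarith [freqNorm_nonneg k]) m) (hh.nonneg k)
    have hweighted := summable_shear (hf.summable_moment m) (hg.summable_moment m) (hF0 hf) (hF0 hg)
    have hplain := summable_shear hf.summable hg.summable hf.nonneg hg.nonneg
    refine hweighted.prod.of_nonneg_of_le (fun k => ?_) fun k => ?_
    · exact mul_nonneg (pow_nonneg (by linarith [freqNorm_nonneg k]) m)
        (tsum_nonneg fun l => mul_nonneg (hf.nonneg _) (hg.nonneg _))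
    rw [← tsum_mul_left]
    refine ((hplain.prod_factor k).mul_left _).tsum_le_tsum (fun l => ?_) (hweighted.prod_factor k)
    have hk := freqNorm_nonneg k
    have hbase : 1 + freqNorm k ≤ (1 + freqNorm (k - l)) * (1 + freqNorm l) := by
      have htriangle := freqNorm_add_le (k - l) l
      rw [sub_add_cancel] at htriangle
      nlinarith [freqNorm_nonneg (k - l), freqNorm_nonneg l]
    calc (1 + freqNorm k) ^ m * (f (k - l) * g l)
        ≤ ((1 + freqNorm (k - l)) * (1 + freqNorm l)) ^ m * (f (k - l) * g l) := by
          have := mul_nonneg (hf.nonneg (k - l)) (hg.nonneg l)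
          gcongr
      _ = (1 + freqNorm (k - l)) ^ m * f (k - l) * ((1 + freqNorm l) ^ m * g l) := by
          rw [mul_pow]; ring

end RapidDecay

lemma rapidDecay_exp_neg {τ σ : ℝ} (hτ : 0 < τ) (hσ : 0 < σ) :
    RapidDecay fun k => Real.exp (-τ * freqNorm k ^ σ) where
  nonneg _ := (Real.exp_pos _).le
  summable_moment m := by
    have hexp : (fun x : ℝ => Real.exp (-τ * x ^ σ)) =O[atTop] fun x => x ^ (-(m + 3) : ℝ) := by
      refine ((isLittleO_exp_neg_mul_rpow_atTop hτ (-(m + 3) / σ)).comp_tendsto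
        (tendsto_rpow_atTop hσ)).isBigO.congr' EventuallyEq.rfl ?_
      filter_upwards [eventually_ge_atTop 0] with x hx
      rw [Function.comp_apply, ← Real.rpow_mul hx, mul_div_cancel₀ _ hσ.ne']
    have hpow : (fun x : ℝ => (1 + x) ^ m) =O[atTop] fun x => x ^ m :=
      (Asymptotics.IsBigO.of_bound 2 <| by
        filter_upwards [eventually_ge_atTop 1] with x hx
        rw [Real.norm_of_nonneg (by linarith), Real.norm_of_nonneg (by linarith)]
        linarith : (fun x : ℝ => 1 + x) =O[atTop] fun x => x).pow m
    have hproduct : (fun x : ℝ => (1 + x) ^ m * Real.exp (-τ * x ^ σ)) =O[atTop]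
        fun x => x ^ (-3 : ℝ) := by
      refine (hpow.mul hexp).congr' EventuallyEq.rfl ?_
      filter_upwards [eventually_gt_atTop 0] with x hx
      rw [← Real.rpow_natCast, ← Real.rpow_add hx]
      congr 1
      ring
    exact summable_of_isBigO (summable_freqNorm_rpow (by norm_num))
      (hproduct.comp_tendsto tendsto_freqNorm_cofinite)

/-! ### The symbol of the nonlinearity -/

/-- The symbol `|j|^α I(j) · l` of the bilinear operator `(a, b) ↦ (-Δ)^{α/2} I a · ∇ b`, up to the
factor `i` that comes from the gradient. -/
def transportSymbol (α : ℝ) (j l : Freq) : ℝ :=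
  freqNorm j ^ α * (ipmSymbol 0 j * (l 0 : ℝ) + ipmSymbol 1 j * (l 1 : ℝ))

section symbol

variable {α σ r τ : ℝ} {j k l : Freq}

@[simp] lemma transportSymbol_zero_left (α : ℝ) (l : Freq) : transportSymbol α 0 l = 0 := by
  simp [transportSymbol, ipmSymbol]

@[simp] lemma transportSymbol_neg_left (α : ℝ) (j l : Freq) :
    transportSymbol α (-j) l = transportSymbol α j l := by
  simp [transportSymbol, ipmSymbol]

-- The velocity is divergence free: `I(j) · j = 0`.
lemma transportSymbol_add_right (α : ℝ) (j l : Freq) :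
    transportSymbol α j (j + l) = transportSymbol α j l := by
  simp only [transportSymbol, ipmSymbol]
  split_ifs
  · simp
  · simp only [Pi.add_apply, Matrix.cons_val_zero, Matrix.cons_val_one]
    push_cast
    ring

lemma transportSymbol_sub_swap (α : ℝ) (k l : Freq) :
    transportSymbol α (l - k) k = transportSymbol α (k - l) l := by
  rw [← neg_sub k l, transportSymbol_neg_left]
  conv_rhs => rw [← transportSymbol_add_right, sub_add_cancel]

lemma abs_det_le_freqNorm_mul (j l : Freq) :
    |(j 0 : ℝ) * (l 1 : ℝ) - (j 1 : ℝ) * (l 0 : ℝ)| ≤ freqNorm j * freqNorm l := by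
  apply abs_le_of_sq_le_sq _ (mul_nonneg (freqNorm_nonneg j) (freqNorm_nonneg l))
  rw [mul_pow, freqNorm_sq, freqNorm_sq]
  nlinarith [sq_nonneg ((j 0 : ℝ) * (l 0 : ℝ) + (j 1 : ℝ) * (l 1 : ℝ))]

lemma abs_transportSymbol_le (α : ℝ) (j l : Freq) :
    |transportSymbol α j l| ≤ freqNorm j ^ α * freqNorm l := by
  have hpow := Real.rpow_nonneg (freqNorm_nonneg j) α
  obtain rfl | hj := eq_or_ne j 0
  · simpa using mul_nonneg hpow (freqNorm_nonneg l)
  have hj0 : 0 < freqNorm j := by linarith [one_le_freqNorm hj]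
  have hsymbol : transportSymbol α j l = freqNorm j ^ α *
      ((j 0 : ℝ) * ((j 0 : ℝ) * (l 1 : ℝ) - (j 1 : ℝ) * (l 0 : ℝ)) / freqNorm j ^ 2) := by
    simp only [transportSymbol, ipmSymbol, if_neg hj, freqNorm_sq, Matrix.cons_val_zero,
      Matrix.cons_val_one]
    ring
  rw [hsymbol, abs_mul, abs_of_nonneg hpow, abs_div, abs_mul, abs_of_pos (pow_pos hj0 2)]
  refine mul_le_mul_of_nonneg_left ((div_le_iff₀ (pow_pos hj0 2)).2 ?_) hpow
  calc |(j 0 : ℝ)| * |(j 0 : ℝ) * (l 1 : ℝ) - (j 1 : ℝ) * (l 0 : ℝ)|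
      ≤ freqNorm j * (freqNorm j * freqNorm l) :=
        mul_le_mul (abs_coord_le_freqNorm j 0) (abs_det_le_freqNorm_mul j l) (abs_nonneg _) hj0.le
    _ = freqNorm l * freqNorm j ^ 2 := by ring

lemma abs_transportSymbol_le_mul (hα : α ≤ 1) (j l : Freq) :
    |transportSymbol α j l| ≤ freqNorm j * freqNorm l := by
  obtain rfl | hj := eq_or_ne j 0
  · simp
  · exact (abs_transportSymbol_le α j l).trans
      (mul_le_mul_of_nonneg_right (freqNorm_rpow_le_self hα hj) (freqNorm_nonneg l))

lemma abs_transportSymbol_le_min (hjk : k = j + l) :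
    |transportSymbol α j l| ≤ freqNorm j ^ α * min (freqNorm k) (freqNorm l) := by
  rcases min_choice (freqNorm k) (freqNorm l) with h | h <;> rw [h]
  · rw [← transportSymbol_add_right, hjk]
    exact abs_transportSymbol_le α j _
  · exact abs_transportSymbol_le α j l

lemma abs_transportSymbol_le_split (hασ : α ≤ σ) (hσ0 : 0 ≤ σ) (hσ1 : σ ≤ 1) (hjk : k = j + l)
    (hj : j ≠ 0) (hk : k ≠ 0) (hl : l ≠ 0) :
    |transportSymbol α j l| ≤
      2 * freqNorm l ^ 2 * (freqNorm j ^ (σ / 2) * freqNorm k ^ (σ / 2)) :=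
  calc |transportSymbol α j l| ≤ freqNorm j ^ α * freqNorm l := abs_transportSymbol_le α j l
    _ ≤ 2 * freqNorm l * (freqNorm j ^ (σ / 2) * freqNorm k ^ (σ / 2)) * freqNorm l :=
        mul_le_mul_of_nonneg_right (freqNorm_rpow_le_split hασ hσ0 hσ1 hjk hj hk hl)
          (freqNorm_nonneg l)
    _ = _ := by ring

-- The commutator `w(|k|) - w(|l|)` gains a factor `|j|` at the cost of `σ` derivatives, which are
-- shared equally by `k` and `l`.
lemma abs_transportSymbol_mul_sub_le {w : ℝ → ℝ} {C : ℝ} (hα1 : α ≤ 1) (hσ0 : 0 ≤ σ) (hC : 0 ≤ C)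
    (hw0 : ∀ x, 0 ≤ x → 0 ≤ w x) (hw : ∀ x y, 0 ≤ x → x ≤ y → w x ≤ w y)
    (h : ∀ m M, 1 ≤ m → m ≤ M → m * (w M - w m) ≤ C * (M - m) * m ^ σ * w M)
    (hjk : k = j + l) (hj : j ≠ 0) (hk : k ≠ 0) (hl : l ≠ 0) :
    |transportSymbol α j l| * |w (freqNorm k) - w (freqNorm l)| ≤
      C * freqNorm j ^ 2 * (freqNorm k ^ (σ / 2) * freqNorm l ^ (σ / 2)) *
        w (max (freqNorm k) (freqNorm l)) := by
  have hk1 := one_le_freqNorm hk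
  have hl1 := one_le_freqNorm hl
  obtain ⟨hkle, hlle⟩ := freqNorm_triangle hjk
  have hcomm := min_mul_abs_sub_le hC hσ0 hw0 hw h hk1 hl1 hkle hlle
  have hmin : 0 ≤ min (freqNorm k) (freqNorm l) := le_min (by linarith) (by linarith)
  calc |transportSymbol α j l| * |w (freqNorm k) - w (freqNorm l)|
      ≤ freqNorm j ^ α * min (freqNorm k) (freqNorm l) * |w (freqNorm k) - w (freqNorm l)| :=
        mul_le_mul_of_nonneg_right (abs_transportSymbol_le_min hjk) (abs_nonneg _)
    _ = freqNorm j ^ α * (min (freqNorm k) (freqNorm l) * |w (freqNorm k) - w (freqNorm l)|) := by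
        ring
    _ ≤ freqNorm j * (C * freqNorm j * (freqNorm k ^ (σ / 2) * freqNorm l ^ (σ / 2)) *
          w (max (freqNorm k) (freqNorm l))) :=
        mul_le_mul (freqNorm_rpow_le_self hα1 hj) hcomm (mul_nonneg hmin (abs_nonneg _))
          (freqNorm_nonneg j)
    _ = _ := by ring

lemma expWeight_max_le (hσ0 : 0 ≤ σ) (hσ1 : σ ≤ 1) (hτ : 0 ≤ τ) (hjk : k = j + l) :
    expWeight τ σ (max (freqNorm k) (freqNorm l)) ≤
      expWeight τ σ (freqNorm j) * expWeight τ σ (freqNorm l) :=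
  expWeight_le_mul hτ hσ0 hσ1 (freqNorm_nonneg j) (freqNorm_nonneg l)
    ((freqNorm_nonneg k).trans (le_max_left _ _))
    (max_le (by linarith [(freqNorm_triangle hjk).1]) (by linarith [freqNorm_nonneg j]))

lemma abs_transportSymbol_mul_expWeight_sub_le (hα1 : α ≤ 1) (hσ0 : 0 ≤ σ) (hσ1 : σ ≤ 1)
    (hτ : 0 ≤ τ) (hjk : k = j + l) (hj : j ≠ 0) (hk : k ≠ 0) (hl : l ≠ 0) :
    |transportSymbol α j l| * |expWeight τ σ (freqNorm k) - expWeight τ σ (freqNorm l)| ≤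
      τ * (freqNorm j ^ 2 * expWeight τ σ (freqNorm j)) * expWeight τ σ (freqNorm l) *
        (freqNorm k ^ (σ / 2) * freqNorm l ^ (σ / 2)) := by
  have hcoef : 0 ≤ τ * freqNorm j ^ 2 * (freqNorm k ^ (σ / 2) * freqNorm l ^ (σ / 2)) :=
    mul_nonneg (by positivity) (mul_nonneg (Real.rpow_nonneg (freqNorm_nonneg k) _)
      (Real.rpow_nonneg (freqNorm_nonneg l) _))
  refine (abs_transportSymbol_mul_sub_le hα1 hσ0 hτ (fun x _ => (expWeight_pos τ σ x).le)
    (fun x y hx h => expWeight_mono hτ hσ0 hx h)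
    (fun m M hm hM => mul_expWeight_sub_le hτ hσ1 (by linarith) hM) hjk hj hk hl).trans ?_
  refine (mul_le_mul_of_nonneg_left (expWeight_max_le hσ0 hσ1 hτ hjk) hcoef).trans_eq ?_
  ring

lemma abs_transportSymbol_mul_expWeight_le (hασ : α ≤ σ) (hσ0 : 0 ≤ σ) (hσ1 : σ ≤ 1) (hτ : 0 ≤ τ)
    (hjk : k = j + l) (hj : j ≠ 0) (hk : k ≠ 0) (hl : l ≠ 0) :
    |transportSymbol α j l| * expWeight τ σ (freqNorm k) ≤
      2 * (freqNorm l ^ 2 * expWeight τ σ (freqNorm l)) * expWeight τ σ (freqNorm j) *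
        (freqNorm j ^ (σ / 2) * freqNorm k ^ (σ / 2)) := by
  have hsymbol := abs_transportSymbol_le_split hασ hσ0 hσ1 hjk hj hk hl
  have hweight := (expWeight_mono hτ hσ0 (freqNorm_nonneg k) (le_max_left _ (freqNorm l))).trans
    (expWeight_max_le hσ0 hσ1 hτ hjk)
  refine (mul_le_mul hsymbol hweight (expWeight_pos _ _ _).le
    ((abs_nonneg _).trans hsymbol)).trans_eq ?_
  ring

lemma gevreyWeight_max_le {i : Freq} (hr : 0 ≤ r) (hσ0 : 0 ≤ σ) (hσ1 : σ ≤ 1) (hτ : 0 ≤ τ)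
    (hjk : k = j + l) (hji : freqNorm j ≤ freqNorm i) (hli : freqNorm l ≤ freqNorm i) :
    gevreyWeight r τ σ (max (freqNorm k) (freqNorm l)) ≤
      2 ^ r * freqNorm i ^ r * (expWeight τ σ (freqNorm j) * expWeight τ σ (freqNorm l)) := by
  have hmax : max (freqNorm k) (freqNorm l) ≤ 2 * freqNorm i :=
    max_le (by linarith [(freqNorm_triangle hjk).1]) (by linarith [freqNorm_nonneg l])
  have hmax0 : 0 ≤ max (freqNorm k) (freqNorm l) := (freqNorm_nonneg k).trans (le_max_left _ _)
  rw [← Real.mul_rpow zero_le_two (freqNorm_nonneg i)]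
  exact mul_le_mul (Real.rpow_le_rpow hmax0 hmax hr) (expWeight_max_le hσ0 hσ1 hτ hjk)
    (expWeight_pos _ _ _).le (Real.rpow_nonneg (hmax0.trans hmax) r)

lemma abs_transportSymbol_mul_gevreyWeight_sub_le_of_le (hr : 1 ≤ r) (hα1 : α ≤ 1) (hσ0 : 0 ≤ σ)
    (hσ1 : σ ≤ 1) (hτ : 0 ≤ τ) (hjk : k = j + l) (hj : j ≠ 0) (hk : k ≠ 0) (hl : l ≠ 0)
    (hjl : freqNorm j ≤ freqNorm l) :
    |transportSymbol α j l| * |gevreyWeight r τ σ (freqNorm k) - gevreyWeight r τ σ (freqNorm l)| ≤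
      2 ^ r * (τ + r) * ((freqNorm j ^ 2 * expWeight τ σ (freqNorm j)) *
        gevreyWeight r τ σ (freqNorm l) * (freqNorm k ^ (σ / 2) * freqNorm l ^ (σ / 2))) := by
  have hτr : 0 ≤ τ + r := by linarith
  have hcoef : 0 ≤ (τ + r) * freqNorm j ^ 2 * (freqNorm k ^ (σ / 2) * freqNorm l ^ (σ / 2)) :=
    mul_nonneg (by positivity) (mul_nonneg (Real.rpow_nonneg (freqNorm_nonneg k) _)
      (Real.rpow_nonneg (freqNorm_nonneg l) _))
  refine (abs_transportSymbol_mul_sub_le hα1 hσ0 hτr (fun x hx => gevreyWeight_nonneg r τ σ hx)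
    (fun x y hx h => gevreyWeight_mono (by linarith) hτ hσ0 hx h)
    (fun m M hm hM => mul_gevreyWeight_sub_le hr hτ hσ0 hσ1 hm hM) hjk hj hk hl).trans ?_
  refine (mul_le_mul_of_nonneg_left
    (gevreyWeight_max_le (by linarith) hσ0 hσ1 hτ hjk hjl le_rfl) hcoef).trans_eq ?_
  rw [gevreyWeight]
  ring

lemma abs_transportSymbol_mul_gevreyWeight_sub_le_of_ge (hr : 0 ≤ r) (hασ : α ≤ σ)
    (hσ0 : 0 ≤ σ) (hσ1 : σ ≤ 1) (hτ : 0 ≤ τ) (hjk : k = j + l) (hj : j ≠ 0) (hk : k ≠ 0)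
    (hl : l ≠ 0) (hlj : freqNorm l ≤ freqNorm j) :
    |transportSymbol α j l| * |gevreyWeight r τ σ (freqNorm k) - gevreyWeight r τ σ (freqNorm l)| ≤
      2 ^ r * 2 * ((freqNorm l ^ 2 * expWeight τ σ (freqNorm l)) *
        gevreyWeight r τ σ (freqNorm j) * (freqNorm j ^ (σ / 2) * freqNorm k ^ (σ / 2))) := by
  have hmono : ∀ {x y : ℝ}, 0 ≤ x → x ≤ y → gevreyWeight r τ σ x ≤ gevreyWeight r τ σ y :=
    gevreyWeight_mono hr hτ hσ0
  have hdiff : |gevreyWeight r τ σ (freqNorm k) - gevreyWeight r τ σ (freqNorm l)| ≤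
      gevreyWeight r τ σ (max (freqNorm k) (freqNorm l)) :=
    abs_sub_le_of_nonneg_of_le
      (gevreyWeight_nonneg _ _ _ (freqNorm_nonneg k)) (hmono (freqNorm_nonneg k) (le_max_left _ _))
      (gevreyWeight_nonneg _ _ _ (freqNorm_nonneg l)) (hmono (freqNorm_nonneg l) (le_max_right _ _))
  have hsymbol := abs_transportSymbol_le_split hασ hσ0 hσ1 hjk hj hk hl
  refine (mul_le_mul hsymbol (hdiff.trans (gevreyWeight_max_le hr hσ0 hσ1 hτ hjk le_rfl hlj))
    (abs_nonneg _) ((abs_nonneg _).trans hsymbol)).trans_eq ?_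
  rw [gevreyWeight]
  ring

lemma abs_transportSymbol_mul_gevreyWeight_sub_le (hr : 1 ≤ r) (hασ : α ≤ σ)
    (hσ0 : 0 ≤ σ) (hσ1 : σ ≤ 1) (hτ : 0 ≤ τ) (hjk : k = j + l) (hj : j ≠ 0) (hk : k ≠ 0)
    (hl : l ≠ 0) :
    |transportSymbol α j l| * |gevreyWeight r τ σ (freqNorm k) - gevreyWeight r τ σ (freqNorm l)| ≤
      2 ^ r * (τ + r + 2) *
        ((freqNorm j ^ 2 * expWeight τ σ (freqNorm j)) * gevreyWeight r τ σ (freqNorm l) *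
          (freqNorm k ^ (σ / 2) * freqNorm l ^ (σ / 2)) +
        (freqNorm l ^ 2 * expWeight τ σ (freqNorm l)) * gevreyWeight r τ σ (freqNorm j) *
          (freqNorm j ^ (σ / 2) * freqNorm k ^ (σ / 2))) := by
  have hterm : ∀ i i' m m' : Freq, 0 ≤ (freqNorm i ^ 2 * expWeight τ σ (freqNorm i)) *
      gevreyWeight r τ σ (freqNorm i') * (freqNorm m ^ (σ / 2) * freqNorm m' ^ (σ / 2)) :=
    fun i i' m m' => mul_nonneg (mul_nonneg (mul_nonneg (sq_nonneg _) (expWeight_pos _ _ _).le)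
      (gevreyWeight_nonneg _ _ _ (freqNorm_nonneg i')))
      (mul_nonneg (Real.rpow_nonneg (freqNorm_nonneg m) _)
        (Real.rpow_nonneg (freqNorm_nonneg m') _))
  have hpow : (0 : ℝ) < 2 ^ r := by positivity
  rcases le_total (freqNorm j) (freqNorm l) with hjl | hlj
  · refine (abs_transportSymbol_mul_gevreyWeight_sub_le_of_le hr (hασ.trans hσ1) hσ0 hσ1 hτ hjk hj
      hk hl hjl).trans ?_
    exact mul_le_mul (mul_le_mul_of_nonneg_left (by linarith) hpow.le)
      (le_add_of_nonneg_right (hterm _ _ _ _)) (hterm _ _ _ _) (by positivity)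
  · refine (abs_transportSymbol_mul_gevreyWeight_sub_le_of_ge (by linarith) hασ hσ0 hσ1 hτ hjk hj
      hk hl hlj).trans ?_
    exact mul_le_mul (mul_le_mul_of_nonneg_left (by linarith) hpow.le)
      (le_add_of_nonneg_left (hterm _ _ _ _)) (hterm _ _ _ _) (by positivity)

end symbol

/-! ### The transport term and its energy estimates -/

/-- The `l`-th term of the `k`-th Fourier coefficient of `-(-Δ)^{α/2} I a · ∇ b`. -/
def transportTerm (α : ℝ) (a b : Freq → ℂ) (k l : Freq) : ℂ :=
  -Complex.I * (transportSymbol α (k - l) l : ℂ) * a (k - l) * b l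

/-- The Fourier coefficients of `-(-Δ)^{α/2} I a · ∇ b` in terms of those of `a` and `b`. -/
def transport (α : ℝ) (a b : Freq → ℂ) (k : Freq) : ℂ := ∑' l, transportTerm α a b k l

/-- The symmetry of the Fourier coefficients of a real function. -/
def ConjSymm (a : Freq → ℂ) : Prop := ∀ k, a (-k) = conj (a k)

section energy

variable {α σ τ r : ℝ} {a b d : Freq → ℂ} {w : Freq → ℝ}

lemma norm_transportTerm (α : ℝ) (a b : Freq → ℂ) (k l : Freq) :
    ‖transportTerm α a b k l‖ = |transportSymbol α (k - l) l| * ‖a (k - l)‖ * ‖b l‖ := by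
  simp [transportTerm]

lemma norm_transportTerm_le (hα : α ≤ 1) (k l : Freq) :
    ‖transportTerm α a b k l‖ ≤ (freqNorm (k - l) * ‖a (k - l)‖) * (freqNorm l * ‖b l‖) := by
  rw [norm_transportTerm]
  calc |transportSymbol α (k - l) l| * ‖a (k - l)‖ * ‖b l‖
      ≤ (freqNorm (k - l) * freqNorm l) * ‖a (k - l)‖ * ‖b l‖ := by
        gcongr
        exact abs_transportSymbol_le_mul hα _ _
    _ = _ := by ring

-- `u · ∇` is skew-adjoint for real divergence-free `u`: exchanging `k` and `l` conjugates the
-- summand and changes its sign.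
lemma re_tsum_transportTerm_mul_conj_eq_zero (ha : ConjSymm a) (b : Freq → ℂ) :
    (∑' p : Freq × Freq, transportTerm α a b p.1 p.2 * conj (b p.1)).re = 0 := by
  set F : Freq × Freq → ℂ := fun p => transportTerm α a b p.1 p.2 * conj (b p.1) with hF
  have hswap : ∀ p : Freq × Freq, F p.swap = -conj (F p) := by
    rintro ⟨k, l⟩
    have hconj : a (l - k) = conj (a (k - l)) := by rw [← ha, neg_sub]
    simp only [hF, transportTerm, Prod.swap_prod_mk, hconj, transportSymbol_sub_swap, map_mul,
      map_neg, Complex.conj_I, Complex.conj_ofReal, Complex.conj_conj]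
    ring
  have hskew : ∑' p, F p = -conj (∑' p, F p) := by
    rw [Complex.conj_tsum, ← tsum_neg, ← (Equiv.prodComm Freq Freq).tsum_eq F]
    exact tsum_congr hswap
  have hre := congrArg Complex.re hskew
  simp only [Complex.neg_re, Complex.conj_re] at hre
  linarith

lemma summable_transportTerm_mul_conj (hα : α ≤ 1) (ha : RapidDecay fun k => ‖a k‖)
    (hb : RapidDecay fun k => ‖b k‖) (hd : RapidDecay fun k => ‖d k‖) :
    Summable fun p : Freq × Freq => transportTerm α a b p.1 p.2 * conj (d p.1) := by
  refine .of_norm_bounded ((summable_shear ha.freqNorm_mul.summable hb.freqNorm_mul.summable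
    ha.freqNorm_mul.nonneg hb.freqNorm_mul.nonneg).mul_right (∑' k, ‖d k‖)) fun p => ?_
  rw [norm_mul, RCLike.norm_conj]
  exact mul_le_mul (norm_transportTerm_le hα _ _)
    (hd.summable.le_tsum p.1 fun k _ => norm_nonneg (d k)) (norm_nonneg _)
    (mul_nonneg (ha.freqNorm_mul.nonneg _) (hb.freqNorm_mul.nonneg _))

lemma tsum_sq_mul_re_conj_mul_transport (hα : α ≤ 1) (ha : RapidDecay fun k => ‖a k‖)
    (hb : RapidDecay fun k => ‖b k‖) (hd : RapidDecay fun k => ‖((w k ^ 2 : ℝ) : ℂ) * d k‖) :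
    ∑' k, w k ^ 2 * (conj (d k) * transport α a b k).re =
      (∑' p : Freq × Freq, transportTerm α a b p.1 p.2 *
        conj (((w p.1 ^ 2 : ℝ) : ℂ) * d p.1)).re := by
  have hsum := summable_transportTerm_mul_conj hα ha hb hd
  rw [hsum.tsum_prod, Complex.re_tsum hsum.prod]
  refine tsum_congr fun k => ?_
  rw [← Complex.re_ofReal_mul, transport, ← tsum_mul_left, ← tsum_mul_left]
  refine congrArg Complex.re (tsum_congr fun l => ?_)
  rw [map_mul, Complex.conj_ofReal]
  ring

lemma tsum_sq_mul_re_conj_mul_transport_le (hα : α ≤ 1) (ha : RapidDecay fun k => ‖a k‖)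
    (hb : RapidDecay fun k => ‖b k‖) (hd : RapidDecay fun k => w k ^ 2 * ‖d k‖)
    {P : Freq × Freq → ℝ} (hP : Summable P)
    (hle : ∀ k l, |transportSymbol α (k - l) l| * w k * (w k * ‖a (k - l)‖ * ‖b l‖ * ‖d k‖) ≤
      P (k, l)) :
    ∑' k, w k ^ 2 * (conj (d k) * transport α a b k).re ≤ ∑' p, P p := by
  rw [tsum_sq_mul_re_conj_mul_transport hα ha hb (by simpa using hd)]
  refine (Complex.re_le_norm _).trans (tsum_of_norm_bounded hP.hasSum fun p => ?_)
  refine (hle p.1 p.2).trans_eq' ?_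
  rw [norm_mul, RCLike.norm_conj, norm_transportTerm, norm_mul, Complex.norm_real,
    Real.norm_of_nonneg (sq_nonneg _)]
  ring

-- By skew-adjointness `⟨B(a, wd), wd⟩` has no real part, so that subtracting it from
-- `⟨B(a, d), w²d⟩` leaves only the commutator of the weight with the symbol.
lemma tsum_sq_mul_re_conj_mul_transport_self_le (hα : α ≤ 1) (hsymm : ConjSymm a)
    (hw0 : ∀ k, 0 ≤ w k) (ha : RapidDecay fun k => ‖a k‖) (hd : RapidDecay fun k => ‖d k‖)
    (hwd : RapidDecay fun k => w k ^ 2 * ‖d k‖) {P : Freq × Freq → ℝ} (hP : Summable P)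
    (hle : ∀ k l, |transportSymbol α (k - l) l| * |w k - w l| *
      (w k * ‖a (k - l)‖ * ‖d l‖ * ‖d k‖) ≤ P (k, l)) :
    ∑' k, w k ^ 2 * (conj (d k) * transport α a d k).re ≤ ∑' p, P p := by
  have hsq : RapidDecay fun k => ‖((w k ^ 2 : ℝ) : ℂ) * d k‖ := by simpa using hwd
  have hone : RapidDecay fun k => ‖(w k : ℂ) * d k‖ :=
    (hd.add hwd).of_le (fun k => norm_nonneg _) fun k => by
      rw [norm_mul, Complex.norm_real, Real.norm_of_nonneg (hw0 k), ← one_add_mul]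
      exact mul_le_mul_of_nonneg_right (by nlinarith [sq_nonneg (w k - 1)]) (norm_nonneg _)
  have hcommutator : ∑' k, w k ^ 2 * (conj (d k) * transport α a d k).re =
      (∑' p : Freq × Freq, (transportTerm α a d p.1 p.2 * conj (((w p.1 ^ 2 : ℝ) : ℂ) * d p.1) -
        transportTerm α a (fun k => w k * d k) p.1 p.2 * conj (w p.1 * d p.1))).re := by
    rw [(summable_transportTerm_mul_conj hα ha hd hsq).tsum_sub
      (summable_transportTerm_mul_conj hα ha hone hone), Complex.sub_re,
      re_tsum_transportTerm_mul_conj_eq_zero hsymm, sub_zero,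
      tsum_sq_mul_re_conj_mul_transport hα ha hd hsq]
  rw [hcommutator]
  refine (Complex.re_le_norm _).trans (tsum_of_norm_bounded hP.hasSum fun p => ?_)
  have hfactor : transportTerm α a d p.1 p.2 * conj (((w p.1 ^ 2 : ℝ) : ℂ) * d p.1) -
      transportTerm α a (fun k => w k * d k) p.1 p.2 * conj (w p.1 * d p.1) =
      ((w p.1 * (w p.1 - w p.2) : ℝ) : ℂ) * (transportTerm α a d p.1 p.2 * conj (d p.1)) := by
    simp only [transportTerm, map_mul, Complex.conj_ofReal]
    push_cast
    ring
  refine (hle p.1 p.2).trans_eq' ?_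
  rw [hfactor, norm_mul, norm_mul, RCLike.norm_conj, norm_transportTerm, Complex.norm_real,
    Real.norm_eq_abs, abs_mul, abs_of_nonneg (hw0 _)]
  ring

lemma RapidDecay.mul {f g : Freq → ℝ} (hf : RapidDecay f) (hg : RapidDecay g) :
    RapidDecay fun k => f k * g k :=
  (hg.const_mul (tsum_nonneg hf.nonneg)).of_le (fun k => mul_nonneg (hf.nonneg k) (hg.nonneg k))
    fun k => mul_le_mul_of_nonneg_right (hf.summable.le_tsum k fun l _ => hf.nonneg l) (hg.nonneg k)

lemma RapidDecay.summable_sq_rpow_mul {f : Freq → ℝ} (hf : RapidDecay f) (hf0 : f 0 = 0)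
    (hσ1 : σ ≤ 1) : Summable fun k => (freqNorm k ^ (σ / 2) * f k) ^ 2 := by
  refine (hf.mul hf).freqNorm_mul.summable.of_nonneg_of_le (fun k => sq_nonneg _) fun k => ?_
  obtain rfl | hk := eq_or_ne k 0
  · simp [hf0]
  have hpow : (freqNorm k ^ (σ / 2)) ^ 2 ≤ freqNorm k := by
    rw [← Real.rpow_natCast, ← Real.rpow_mul (freqNorm_nonneg k)]
    exact freqNorm_rpow_le_self (by push_cast; linarith) hk
  rw [mul_pow, sq (f k)]
  exact mul_le_mul_of_nonneg_right hpow (mul_self_nonneg _)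

lemma RapidDecay.of_weight_sq {f : Freq → ℝ} (h : RapidDecay fun k => w k ^ 2 * f k)
    (hf : ∀ k, 0 ≤ f k) (hw : ∀ k, f k ≠ 0 → 1 ≤ w k) :
    RapidDecay f ∧ RapidDecay fun k => w k * f k := by
  have hle : ∀ k, f k ≤ w k * f k ∧ w k * f k ≤ w k ^ 2 * f k := fun k => by
    obtain hk | hk := eq_or_ne (f k) 0
    · simp [hk]
    · have hwk := hw k hk
      exact ⟨le_mul_of_one_le_left (hf k) hwk,
        mul_le_mul_of_nonneg_right (by nlinarith) (hf k)⟩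
  exact ⟨h.of_le hf fun k => (hle k).1.trans (hle k).2,
    h.of_le (fun k => (hf k).trans (hle k).1) fun k => (hle k).2⟩

/-- The constant in the trilinear estimate in Gevrey spaces. -/
def energyConst (r τ : ℝ) : ℝ :=
  2 * (2 ^ r * (τ + r + 2)) * Real.sqrt (∑' k : Freq, (freqNorm k ^ (2 - r)) ^ 2)

lemma energyConst_mono {τ' : ℝ} (h : τ ≤ τ') : energyConst r τ ≤ energyConst r τ' := by
  unfold energyConst
  gcongr

lemma summable_sq_freqNorm_rpow (hr : 3 < r) :
    Summable fun k : Freq => (freqNorm k ^ (2 - r)) ^ 2 := by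
  refine (summable_freqNorm_rpow (p := 2 * (2 - r)) (by linarith)).congr fun k => ?_
  rw [← Real.rpow_mul_natCast (freqNorm_nonneg k)]
  congr 1
  push_cast
  ring

lemma tsum_sq_mul_expWeight_le (hr : 3 < r) (ha0 : a 0 = 0)
    (ha : Summable fun k => (gevreyWeight r τ σ (freqNorm k) * ‖a k‖) ^ 2) :
    (Summable fun k => freqNorm k ^ 2 * (expWeight τ σ (freqNorm k) * ‖a k‖)) ∧
    ∑' k, freqNorm k ^ 2 * (expWeight τ σ (freqNorm k) * ‖a k‖) ≤
      Real.sqrt (∑' k : Freq, (freqNorm k ^ (2 - r)) ^ 2) *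
        Real.sqrt (∑' k, (gevreyWeight r τ σ (freqNorm k) * ‖a k‖) ^ 2) := by
  have hfactor : ∀ k, freqNorm k ^ 2 * (expWeight τ σ (freqNorm k) * ‖a k‖) =
      freqNorm k ^ (2 - r) * (gevreyWeight r τ σ (freqNorm k) * ‖a k‖) := fun k => by
    obtain rfl | hk := eq_or_ne k 0
    · simp [ha0]
    · have hpow : freqNorm k ^ 2 = freqNorm k ^ (2 - r) * freqNorm k ^ r := by
        rw [← Real.rpow_add (by linarith [one_le_freqNorm hk]), sub_add_cancel, Real.rpow_two]
      rw [gevreyWeight, hpow]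
      ring
  simp only [hfactor]
  exact tsum_mul_le_sqrt_mul_sqrt (fun k => Real.rpow_nonneg (freqNorm_nonneg k) _)
    (fun k => mul_nonneg (gevreyWeight_nonneg _ _ _ (freqNorm_nonneg k)) (norm_nonneg _))
    (summable_sq_freqNorm_rpow hr) ha

lemma gevrey_commutator_le (hr : 1 ≤ r) (hασ : α ≤ σ) (hσ0 : 0 ≤ σ) (hσ1 : σ ≤ 1) (hτ : 0 ≤ τ)
    (ha0 : a 0 = 0) {X Y : Freq → ℝ}
    (hX : ∀ k, X k = freqNorm k ^ 2 * (expWeight τ σ (freqNorm k) * ‖a k‖))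
    (hY : ∀ k, Y k = freqNorm k ^ (σ / 2) * (gevreyWeight r τ σ (freqNorm k) * ‖a k‖))
    (k l : Freq) :
    |transportSymbol α (k - l) l| *
        |gevreyWeight r τ σ (freqNorm k) - gevreyWeight r τ σ (freqNorm l)| *
        (gevreyWeight r τ σ (freqNorm k) * ‖a (k - l)‖ * ‖a l‖ * ‖a k‖) ≤
      2 ^ r * (τ + r + 2) * (X (k - l) * (Y l * Y k) + X l * (Y (k - l) * Y k)) := by
  have hzero : a k = 0 ∨ a l = 0 ∨ a (k - l) = 0 ∨ (k ≠ 0 ∧ l ≠ 0 ∧ k - l ≠ 0) := by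
    by_contra! h
    exact h.2.2.1 (h.2.2.2 (fun hk => h.1 (hk ▸ ha0)) (fun hl => h.2.1 (hl ▸ ha0)) ▸ ha0)
  rcases hzero with h | h | h | ⟨hk, hl, hj⟩
  · simp [hX, hY, h]
  · simp [hX, hY, h]
  · simp [hX, hY, h]
  have hweight : 0 ≤ gevreyWeight r τ σ (freqNorm k) * ‖a (k - l)‖ * ‖a l‖ * ‖a k‖ := by
    have := gevreyWeight_nonneg r τ σ (freqNorm_nonneg k)
    positivity
  refine (mul_le_mul_of_nonneg_right (abs_transportSymbol_mul_gevreyWeight_sub_le hr hασ hσ0 hσ1 hτ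
    (sub_add_cancel k l).symm hj hk hl) hweight).trans_eq ?_
  rw [hX, hX, hY, hY, hY]
  ring

lemma gevrey_energy_le (hr : 3 < r) (hασ : α ≤ σ) (hσ0 : 0 ≤ σ) (hσ1 : σ ≤ 1) (hτ : 0 ≤ τ)
    (hsymm : ConjSymm a) (ha0 : a 0 = 0)
    (ha : RapidDecay fun k => gevreyWeight r τ σ (freqNorm k) ^ 2 * ‖a k‖) :
    ∑' k, gevreyWeight r τ σ (freqNorm k) ^ 2 * (conj (a k) * transport α a a k).re ≤
      energyConst r τ * Real.sqrt (∑' k, (gevreyWeight r τ σ (freqNorm k) * ‖a k‖) ^ 2) *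
        ∑' k, (freqNorm k ^ (σ / 2) * (gevreyWeight r τ σ (freqNorm k) * ‖a k‖)) ^ 2 := by
  obtain ⟨hdecay, hwdecay⟩ := ha.of_weight_sq (fun k => norm_nonneg _) fun k hk =>
    have hk1 : 1 ≤ freqNorm k := one_le_freqNorm fun h => hk (by simp [h, ha0])
    (one_le_expWeight hτ (freqNorm_nonneg k)).trans (expWeight_le_gevreyWeight (by linarith) hk1)
  set X : Freq → ℝ := fun k => freqNorm k ^ 2 * (expWeight τ σ (freqNorm k) * ‖a k‖)
  set Y : Freq → ℝ := fun k =>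
    freqNorm k ^ (σ / 2) * (gevreyWeight r τ σ (freqNorm k) * ‖a k‖)
  have hX0 : ∀ k, 0 ≤ X k := fun k =>
    mul_nonneg (sq_nonneg _) (mul_nonneg (expWeight_pos _ _ _).le (norm_nonneg _))
  have hY0 : ∀ k, 0 ≤ Y k := fun k =>
    mul_nonneg (Real.rpow_nonneg (freqNorm_nonneg k) _) (hwdecay.nonneg k)
  obtain ⟨hXsum, hXle⟩ := tsum_sq_mul_expWeight_le hr ha0
    ((hwdecay.mul hwdecay).summable.congr fun k => (sq _).symm)
  have hYsum : Summable fun k => Y k ^ 2 := hwdecay.summable_sq_rpow_mul (by simp [ha0]) hσ1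
  obtain ⟨hconv, hconvle⟩ := summable_and_tsum_convolution_le hXsum hYsum hX0 hY0
  obtain ⟨hconv', hconvle'⟩ := summable_and_tsum_convolution_swap_le hXsum hYsum hX0 hY0
  have hc0 : 0 ≤ 2 ^ r * (τ + r + 2) := by positivity
  refine (tsum_sq_mul_re_conj_mul_transport_self_le (hασ.trans hσ1) hsymm
    (fun k => gevreyWeight_nonneg _ _ _ (freqNorm_nonneg k)) hdecay hdecay ha
    ((hconv.add hconv').mul_left _) (gevrey_commutator_le (by linarith) hασ hσ0 hσ1 hτ ha0
    (fun _ => rfl) fun _ => rfl)).trans ?_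
  rw [tsum_mul_left, hconv.tsum_add hconv', energyConst]
  calc _ ≤ 2 ^ r * (τ + r + 2) * ((∑' k, X k) * ∑' k, Y k ^ 2 + (∑' k, X k) * ∑' k, Y k ^ 2) :=
        mul_le_mul_of_nonneg_left (add_le_add hconvle hconvle') hc0
    _ = 2 * (2 ^ r * (τ + r + 2)) * (∑' k, Y k ^ 2) * ∑' k, X k := by ring
    _ ≤ 2 * (2 ^ r * (τ + r + 2)) * (∑' k, Y k ^ 2) * _ :=
        mul_le_mul_of_nonneg_left hXle
          (mul_nonneg (by positivity) (tsum_nonneg fun k => sq_nonneg _))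
    _ = _ := by ring

lemma transported_energy_le {δ : ℝ} (hα1 : α ≤ 1) (hσ0 : 0 ≤ σ) (hσ1 : σ ≤ 1) (hδ : 0 ≤ δ)
    (hsymm : ConjSymm a) (hd0 : d 0 = 0)
    (ha : RapidDecay fun k => expWeight δ σ (freqNorm k) * ‖a k‖)
    (hd : RapidDecay fun k => expWeight δ σ (freqNorm k) ^ 2 * ‖d k‖) :
    ∑' k, expWeight δ σ (freqNorm k) ^ 2 * (conj (d k) * transport α a d k).re ≤
      δ * (∑' k, freqNorm k ^ 2 * (expWeight δ σ (freqNorm k) * ‖a k‖)) *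
        ∑' k, (freqNorm k ^ (σ / 2) * (expWeight δ σ (freqNorm k) * ‖d k‖)) ^ 2 := by
  have hw1 : ∀ k, 1 ≤ expWeight δ σ (freqNorm k) := fun k => one_le_expWeight hδ (freqNorm_nonneg k)
  obtain ⟨hdecay, hwdecay⟩ := hd.of_weight_sq (fun k => norm_nonneg _) fun k _ => hw1 k
  have hX := ha.pow_mul 2
  set Y : Freq → ℝ := fun k => freqNorm k ^ (σ / 2) * (expWeight δ σ (freqNorm k) * ‖d k‖)
  have hY0 : ∀ k, 0 ≤ Y k := fun k =>
    mul_nonneg (Real.rpow_nonneg (freqNorm_nonneg k) _) (hwdecay.nonneg k)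
  obtain ⟨hconv, hconvle⟩ := summable_and_tsum_convolution_le hX.summable
    (hwdecay.summable_sq_rpow_mul (by simp [hd0]) hσ1) hX.nonneg hY0
  refine (tsum_sq_mul_re_conj_mul_transport_self_le hα1 hsymm (fun k => (expWeight_pos _ _ _).le)
    (ha.of_le (fun k => norm_nonneg _) fun k => le_mul_of_one_le_left (norm_nonneg _) (hw1 k))
    hdecay hd (hconv.mul_left δ) fun k l => ?_).trans ?_
  · have hzero : d k = 0 ∨ d l = 0 ∨ k - l = 0 ∨ (k ≠ 0 ∧ l ≠ 0 ∧ k - l ≠ 0) := by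
      by_contra! h
      exact h.2.2.1 (h.2.2.2 (fun hk => h.1 (hk ▸ hd0)) fun hl => h.2.1 (hl ▸ hd0))
    rcases hzero with h | h | h | ⟨hk, hl, hj⟩
    · simp [h]
    · simp [h]
    · simp [h]
    have hweight : 0 ≤ expWeight δ σ (freqNorm k) * ‖a (k - l)‖ * ‖d l‖ * ‖d k‖ := by
      have := expWeight_pos δ σ (freqNorm k)
      positivity
    refine (mul_le_mul_of_nonneg_right (abs_transportSymbol_mul_expWeight_sub_le hα1 hσ0 hσ1 hδ
      (sub_add_cancel k l).symm hj hk hl) hweight).trans_eq ?_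
    ring
  · rw [tsum_mul_left, mul_assoc]
    exact mul_le_mul_of_nonneg_left hconvle hδ

lemma transporting_energy_le {δ : ℝ} (hασ : α ≤ σ) (hσ0 : 0 ≤ σ) (hσ1 : σ ≤ 1) (hδ : 0 ≤ δ)
    (hd0 : d 0 = 0) (hb : RapidDecay fun k => expWeight δ σ (freqNorm k) * ‖b k‖)
    (hd : RapidDecay fun k => expWeight δ σ (freqNorm k) ^ 2 * ‖d k‖) :
    ∑' k, expWeight δ σ (freqNorm k) ^ 2 * (conj (d k) * transport α d b k).re ≤
      2 * (∑' k, freqNorm k ^ 2 * (expWeight δ σ (freqNorm k) * ‖b k‖)) *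
        ∑' k, (freqNorm k ^ (σ / 2) * (expWeight δ σ (freqNorm k) * ‖d k‖)) ^ 2 := by
  have hw1 : ∀ k, 1 ≤ expWeight δ σ (freqNorm k) := fun k => one_le_expWeight hδ (freqNorm_nonneg k)
  obtain ⟨hdecay, hwdecay⟩ := hd.of_weight_sq (fun k => norm_nonneg _) fun k _ => hw1 k
  have hX := hb.pow_mul 2
  set Y : Freq → ℝ := fun k => freqNorm k ^ (σ / 2) * (expWeight δ σ (freqNorm k) * ‖d k‖)
  have hY0 : ∀ k, 0 ≤ Y k := fun k =>
    mul_nonneg (Real.rpow_nonneg (freqNorm_nonneg k) _) (hwdecay.nonneg k)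
  obtain ⟨hconv, hconvle⟩ := summable_and_tsum_convolution_swap_le hX.summable
    (hwdecay.summable_sq_rpow_mul (by simp [hd0]) hσ1) hX.nonneg hY0
  refine (tsum_sq_mul_re_conj_mul_transport_le (hασ.trans hσ1) hdecay
    (hb.of_le (fun k => norm_nonneg _) fun k => le_mul_of_one_le_left (norm_nonneg _) (hw1 k))
    hd (hconv.mul_left 2) fun k l => ?_).trans ?_
  · have hzero : d k = 0 ∨ d (k - l) = 0 ∨ l = 0 ∨ (k ≠ 0 ∧ l ≠ 0 ∧ k - l ≠ 0) := by
      by_contra! h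
      exact h.2.1 (h.2.2.2 (fun hk => h.1 (hk ▸ hd0)) h.2.2.1 ▸ hd0)
    rcases hzero with h | h | rfl | ⟨hk, hl, hj⟩
    · simp [h]
    · simp [h]
    · simp [transportSymbol]
    have hweight : 0 ≤ expWeight δ σ (freqNorm k) * ‖d (k - l)‖ * ‖b l‖ * ‖d k‖ := by
      have := expWeight_pos δ σ (freqNorm k)
      positivity
    refine (mul_le_mul_of_nonneg_right (abs_transportSymbol_mul_expWeight_le hασ hσ0 hσ1 hδ
      (sub_add_cancel k l).symm hj hk hl) hweight).trans_eq ?_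
    ring
  · rw [tsum_mul_left, mul_assoc]
    exact mul_le_mul_of_nonneg_left hconvle zero_le_two

end energy

/-! ### Galerkin truncations -/

lemma transportSymbol_neg_right (α : ℝ) (j l : Freq) :
    transportSymbol α j (-l) = -transportSymbol α j l := by
  simp only [transportSymbol, Pi.neg_apply]
  push_cast
  ring

lemma ConjSymm.transport {α : ℝ} {a b : Freq → ℂ} (ha : ConjSymm a) (hb : ConjSymm b) :
    ConjSymm (transport α a b) := by
  intro k
  rw [SIPM.transport, SIPM.transport, Complex.conj_tsum, ← (Equiv.neg Freq).tsum_eq]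
  refine tsum_congr fun l => ?_
  have hsub : -k - -l = -(k - l) := by abel
  simp only [transportTerm, Equiv.neg_apply, hsub, ha (k - l), hb l, transportSymbol_neg_left,
    transportSymbol_neg_right, map_mul, map_neg, Complex.conj_I, Complex.conj_ofReal]
  push_cast
  ring

lemma transport_eq_sum (α : ℝ) (a : Freq → ℂ) {b : Freq → ℂ} {S : Finset Freq}
    (hb : ∀ k ∉ S, b k = 0) (k : Freq) :
    transport α a b k = ∑ l ∈ S, transportTerm α a b k l :=
  tsum_eq_sum fun l hl => by rw [transportTerm, hb l hl, mul_zero]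

lemma exists_hasDerivWithinAt_of_lipschitzWith_of_bounded {E : Type*} [NormedAddCommGroup E]
    [NormedSpace ℝ E] [CompleteSpace E] {F : E → E} {K : NNReal} {L T : ℝ} (hF : LipschitzWith K F)
    (hL : ∀ x, ‖F x‖ ≤ L) (hT : 0 ≤ T) (x₀ : E) :
    ∃ γ : ℝ → E, γ 0 = x₀ ∧
      ∀ t ∈ Set.Icc 0 T, HasDerivWithinAt γ (F (γ t)) (Set.Icc 0 T) t := by
  have hpl : IsPicardLindelof (fun _ : ℝ => F) (tmin := 0) (tmax := T) ⟨0, le_rfl, hT⟩ x₀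
      (L.toNNReal * T.toNNReal) 0 L.toNNReal K :=
    { lipschitzOnWith := fun _ _ => hF.lipschitzOnWith
      continuousOn := fun _ _ => continuousOn_const
      norm_le := fun _ _ x _ => (hL x).trans (Real.le_coe_toNNReal L)
      mul_max_le := by simp [hT] }
  exact hpl.exists_eq_forall_mem_Icc_hasDerivWithinAt₀

section galerkin

variable {α : ℝ} {S : Finset Freq}

/-- Extension of a finite family of coefficients by zero. -/
def extend (x : S → ℂ) (k : Freq) : ℂ := if h : k ∈ S then x ⟨k, h⟩ else 0

lemma extend_of_notMem (x : S → ℂ) {k : Freq} (h : k ∉ S) : extend x k = 0 := dif_neg h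

lemma extend_of_mem (x : S → ℂ) {k : Freq} (h : k ∈ S) : extend x k = x ⟨k, h⟩ := dif_pos h

lemma extend_restrict {a : Freq → ℂ} (ha : ∀ k ∉ S, a k = 0) : extend (fun k : S => a k) = a := by
  ext k
  by_cases h : k ∈ S
  · rw [extend_of_mem _ h]
  · rw [extend_of_notMem _ h, ha k h]

lemma contDiff_extend (k : Freq) : ContDiff ℝ 1 fun x : S → ℂ => extend x k := by
  by_cases h : k ∈ S
  · simp only [extend_of_mem _ h]
    fun_prop
  · simp only [extend_of_notMem _ h]
    fun_prop

lemma conjSymm_extend_iff (hS : ∀ k ∈ S, -k ∈ S) (x : S → ℂ) :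
    ConjSymm (extend x) ↔ ∀ k : S, x ⟨-k.1, hS _ k.2⟩ = conj (x k) := by
  refine ⟨fun h k => ?_, fun h k => ?_⟩
  · simpa only [extend_of_mem _ k.2, extend_of_mem _ (hS _ k.2)] using h k.1
  by_cases hk : k ∈ S
  · rw [extend_of_mem _ hk, extend_of_mem _ (hS k hk), h ⟨k, hk⟩]
  · have hk' : -k ∉ S := fun hk' => hk (by simpa using hS _ hk')
    rw [extend_of_notMem _ hk, extend_of_notMem _ hk', map_zero]

/-- The projection of a finite family of coefficients to the conjugation-symmetric ones. -/
def symmetrize (hS : ∀ k ∈ S, -k ∈ S) : (S → ℂ) →L[ℝ] (S → ℂ) :=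
  LinearMap.toContinuousLinearMap
    { toFun := fun x k => (1 / 2 : ℝ) • (x k + conj (x ⟨-k.1, hS _ k.2⟩))
      map_add' := fun x y => by
        ext k
        simp only [Pi.add_apply, map_add, smul_add]
        abel
      map_smul' := fun c x => by
        ext k
        simp only [Pi.smul_apply, Complex.real_smul, map_mul, Complex.conj_ofReal, RingHom.id_apply]
        ring }

lemma symmetrize_apply (hS : ∀ k ∈ S, -k ∈ S) (x : S → ℂ) (k : S) :
    symmetrize hS x k = (1 / 2 : ℝ) • (x k + conj (x ⟨-k.1, hS _ k.2⟩)) := rfl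

lemma conjSymm_extend_symmetrize (hS : ∀ k ∈ S, -k ∈ S) (x : S → ℂ) :
    ConjSymm (extend (symmetrize hS x)) := by
  refine (conjSymm_extend_iff hS _).2 fun k => ?_
  simp only [symmetrize_apply, Complex.real_smul, map_mul, map_add, Complex.conj_conj,
    Complex.conj_ofReal, neg_neg]
  ring

lemma symmetrize_eq_self (hS : ∀ k ∈ S, -k ∈ S) {x : S → ℂ} (hx : ConjSymm (extend x)) :
    symmetrize hS x = x := by
  ext k
  rw [symmetrize_apply, (conjSymm_extend_iff hS x).1 hx k, Complex.conj_conj, Complex.real_smul]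
  push_cast
  ring

variable (α S) in
/-- The vector field on the coefficients in `S` of the Galerkin truncation. -/
def galerkinField (x : S → ℂ) (k : S) : ℂ := transport α (extend x) (extend x) k

lemma contDiff_galerkinField : ContDiff ℝ 1 (galerkinField α S) := by
  refine contDiff_pi.2 fun k => ?_
  simp only [galerkinField, transport_eq_sum α _ fun _ hk => extend_of_notMem _ hk]
  exact ContDiff.sum fun l _ => (contDiff_const.mul (contDiff_extend _)).mul (contDiff_extend _)

lemma conjSymm_extend_smul_galerkinField (hS : ∀ k ∈ S, -k ∈ S) (c : ℝ) {x : S → ℂ}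
    (hx : ConjSymm (extend x)) : ConjSymm (extend (c • galerkinField α S x)) := by
  refine (conjSymm_extend_iff hS _).2 fun k => ?_
  simp only [Pi.smul_apply, galerkinField, hx.transport hx k.1, Complex.real_smul, map_mul,
    Complex.conj_ofReal]

/-- `a` solves, on `[0, T]`, the truncation to the frequencies in `S` of the equation for the
Fourier coefficients, its right-hand side being multiplied by `χ`. A cutoff `χ` makes the system
globally solvable; `χ = 1` gives the truncation itself. -/
structure IsGalerkinSolution (α T : ℝ) (S : Finset Freq) (χ : ℝ → ℝ) (a₀ : Freq → ℂ)
    (a : ℝ → Freq → ℂ) : Prop where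
  initial : a 0 = a₀
  symm : ∀ t, ConjSymm (a t)
  eq_zero : ∀ t, ∀ k ∉ S, a t k = 0
  equation : ∀ t ∈ Set.Icc 0 T, ∀ k ∈ S, HasDerivWithinAt (fun t => a t k)
    ((χ t : ℂ) * transport α (a t) (a t) k) (Set.Icc 0 T) t

-- The field is evaluated at the symmetrization of the unknown, which makes the solution symmetric.
lemma exists_isGalerkinSolution (α : ℝ) (hS : ∀ k ∈ S, -k ∈ S) {a₀ : Freq → ℂ} (ha₀ : ConjSymm a₀)
    (hsupp : ∀ k ∉ S, a₀ k = 0) {R T : ℝ} (hR : 0 < R) (hT : 0 ≤ T) :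
    ∃ χ a, IsGalerkinSolution α T S χ a₀ a ∧ (∀ t, χ t ∈ Set.Icc 0 1) ∧
      ∀ t, (∀ k, ‖a t k‖ ≤ R) → χ t = 1 := by
  let f : ContDiffBump (0 : S → ℂ) := ⟨R, R + 1, hR, by linarith⟩
  let Φ : (S → ℂ) → (S → ℂ) := fun y => f y • galerkinField α S y
  have hΦ : ContDiff ℝ 1 Φ := f.contDiff.smul contDiff_galerkinField
  have hΦc : HasCompactSupport Φ := f.hasCompactSupport.smul_right
  obtain ⟨K, hK⟩ := hΦ.lipschitzWith_of_hasCompactSupport hΦc one_ne_zero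
  obtain ⟨L, hL⟩ := hΦc.exists_bound_of_continuous hΦ.continuous
  obtain ⟨γ, hγ0, hγ⟩ := exists_hasDerivWithinAt_of_lipschitzWith_of_bounded
    (hK.comp (symmetrize hS).lipschitz) (fun x => hL (symmetrize hS x)) hT fun k => a₀ k
  refine ⟨fun t => f (symmetrize hS (γ t)), fun t => extend (symmetrize hS (γ t)),
    ⟨?_, fun t => conjSymm_extend_symmetrize hS _, fun t k hk => extend_of_notMem _ hk,
      fun t ht k hk => ?_⟩, fun t => ⟨f.nonneg, f.le_one⟩, fun t ht => ?_⟩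
  · have hext := extend_restrict hsupp
    rw [hγ0, symmetrize_eq_self hS (by rwa [hext]), hext]
  · have hderiv := (symmetrize hS).hasFDerivAt.comp_hasDerivWithinAt t (hγ t ht)
    have hfixed : symmetrize hS (Φ (symmetrize hS (γ t))) = Φ (symmetrize hS (γ t)) :=
      symmetrize_eq_self hS
        (conjSymm_extend_smul_galerkinField hS _ (conjSymm_extend_symmetrize hS _))
    simp only [Function.comp_def, hfixed] at hderiv
    simp only [extend_of_mem _ hk]
    exact hasDerivWithinAt_pi.1 hderiv ⟨k, hk⟩
  · apply f.one_of_mem_closedBall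
    rw [mem_closedBall_zero_iff, pi_norm_le_iff_of_nonneg hR.le]
    intro k
    simpa only [extend_of_mem _ k.2] using ht k.1

end galerkin

/-! ### A uniform bound for the Galerkin truncations -/

lemma hasDerivWithinAt_norm_sq {f : ℝ → ℂ} {f' : ℂ} {s : Set ℝ} {t : ℝ}
    (h : HasDerivWithinAt f f' s t) :
    HasDerivWithinAt (fun t => ‖f t‖ ^ 2) (2 * (conj (f t) * f').re) s t := by
  simpa only [Complex.inner, mul_comm f'] using h.norm_sq

lemma sq_freqNorm_rpow_half (k : Freq) (σ : ℝ) : (freqNorm k ^ (σ / 2)) ^ 2 = freqNorm k ^ σ := by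
  rw [← Real.rpow_mul_natCast (freqNorm_nonneg k)]
  push_cast
  rw [div_mul_cancel₀ σ two_ne_zero]

lemma le_of_hasDerivWithinAt_nonpos_of_le {f f' : ℝ → ℝ} {m M T : ℝ} (hmM : m < M) (h0 : f 0 ≤ m)
    (hf : ∀ t ∈ Set.Icc 0 T, HasDerivWithinAt f (f' t) (Set.Icc 0 T) t)
    (hf' : ∀ t ∈ Set.Icc 0 T, f t ≤ M → f' t ≤ 0) : ∀ t ∈ Set.Icc 0 T, f t ≤ M := by
  set B : ℝ → ℝ := fun t => m + (M - m) / T * t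
  have hB : ∀ t, HasDerivAt B ((M - m) / T) t := fun t =>
    (((hasDerivAt_id t).const_mul ((M - m) / T)).const_add m).congr_deriv (mul_one _)
  have hBM : ∀ t ∈ Set.Icc 0 T, B t ≤ M := fun t ht => by
    have hfrac : t / T ≤ 1 := div_le_one_of_le₀ ht.2 (ht.1.trans ht.2)
    calc B t = m + (M - m) * (t / T) := by simp only [B]; ring
      _ ≤ M := by nlinarith
  refine fun t ht => (image_le_of_deriv_right_lt_deriv_boundary (B := B)
    (B' := fun _ => (M - m) / T) (fun t ht => (hf t ht).continuousWithinAt)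
    (fun t ht => (hf t ⟨ht.1, ht.2.le⟩).mono_of_mem_nhdsWithin (Icc_mem_nhdsGE_of_mem ht))
    (by simpa [B] using h0) hB (fun t ht hfB => ?_) ht).trans (hBM t ht)
  have ht' : t ∈ Set.Icc 0 T := ⟨ht.1, ht.2.le⟩
  exact (hf' t ht' (hfB.le.trans (hBM t ht'))).trans_lt
    (div_pos (sub_pos.2 hmM) (ht.1.trans_lt ht.2))

section galerkinBound

variable {α r σ τ ν K T : ℝ} {S : Finset Freq} {χ : ℝ → ℝ} {a₀ : Freq → ℂ} {a : ℝ → Freq → ℂ}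

lemma gevrey_energy_sum_le (hr : 3 < r) (hασ : α ≤ σ) (hσ0 : 0 ≤ σ) (hσ1 : σ ≤ 1) (hτ : 0 ≤ τ)
    {a : Freq → ℂ} (hsymm : ConjSymm a) (hS0 : 0 ∉ S) (hsupp : ∀ k ∉ S, a k = 0) (hK : 0 ≤ K)
    (hE : ∑ k ∈ S, (gevreyWeight r τ σ (freqNorm k) * ‖a k‖) ^ 2 ≤ K ^ 2) :
    ∑ k ∈ S, gevreyWeight r τ σ (freqNorm k) ^ 2 * (conj (a k) * transport α a a k).re ≤
      energyConst r τ * K *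
        ∑ k ∈ S, (freqNorm k ^ (σ / 2) * (gevreyWeight r τ σ (freqNorm k) * ‖a k‖)) ^ 2 := by
  have henergy := gevrey_energy_le hr hασ hσ0 hσ1 hτ hsymm (hsupp 0 hS0)
    (.of_finite_support (fun k => by positivity) (S.finite_toSet.subset fun k hk =>
      by_contra fun h => hk (by simp [hsupp k h])))
  rw [tsum_eq_sum (s := S) fun k hk => by simp [hsupp k hk],
    tsum_eq_sum (s := S) fun k hk => by simp [hsupp k hk],
    tsum_eq_sum (s := S) fun k hk => by simp [hsupp k hk]] at henergy
  refine henergy.trans ?_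
  have hsqrt := Real.sqrt_le_iff.2 ⟨hK, hE⟩
  have hconst : 0 ≤ energyConst r τ := by
    unfold energyConst
    positivity
  gcongr

namespace IsGalerkinSolution

lemma hasDerivWithinAt_energy (h : IsGalerkinSolution α T S χ a₀ a) {t : ℝ}
    (ht : t ∈ Set.Icc 0 T) :
    HasDerivWithinAt
      (fun t => ∑ k ∈ S, (gevreyWeight r (τ - ν * t) σ (freqNorm k) * ‖a t k‖) ^ 2)
      (2 * (χ t * ∑ k ∈ S, gevreyWeight r (τ - ν * t) σ (freqNorm k) ^ 2 *
          (conj (a t k) * transport α (a t) (a t) k).re -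
        ν * ∑ k ∈ S, (freqNorm k ^ (σ / 2) *
          (gevreyWeight r (τ - ν * t) σ (freqNorm k) * ‖a t k‖)) ^ 2)) (Set.Icc 0 T) t := by
  simp only [mul_pow (gevreyWeight _ _ _ _)]
  refine (HasDerivWithinAt.fun_sum fun k hk =>
    (hasDerivAt_gevreyWeight_sq r τ ν σ (freqNorm k) t).hasDerivWithinAt.mul
      (hasDerivWithinAt_norm_sq (h.equation t ht k hk))).congr_deriv ?_
  simp only [Finset.mul_sum, ← Finset.sum_sub_distrib]
  refine Finset.sum_congr rfl fun k _ => ?_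
  rw [mul_left_comm (conj _), Complex.re_ofReal_mul, mul_pow, mul_pow, sq_freqNorm_rpow_half]
  ring

-- The decay of the radius compensates the growth `energyConst r τ * 2K` as long as the norm stays
-- below `2K`, so that the norm never reaches this value.
lemma energy_le (h : IsGalerkinSolution α T S χ a₀ a) (hχ : ∀ t, χ t ∈ Set.Icc 0 1) (hr : 3 < r)
    (hασ : α ≤ σ) (hσ0 : 0 ≤ σ) (hσ1 : σ ≤ 1) (hK : 0 < K) (hτ : 0 ≤ τ)
    (hν : energyConst r τ * (2 * K) ≤ ν) (hνT : ν * T ≤ τ) (hS0 : 0 ∉ S)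
    (hE0 : ∑ k ∈ S, (gevreyWeight r τ σ (freqNorm k) * ‖a₀ k‖) ^ 2 ≤ K ^ 2) :
    ∀ t ∈ Set.Icc 0 T,
      ∑ k ∈ S, (gevreyWeight r (τ - ν * t) σ (freqNorm k) * ‖a t k‖) ^ 2 ≤ (2 * K) ^ 2 := by
  have hconst : 0 ≤ energyConst r τ := by
    unfold energyConst
    positivity
  have hν0 : 0 ≤ ν := le_trans (by positivity) hν
  refine le_of_hasDerivWithinAt_nonpos_of_le (m := K ^ 2) (by nlinarith) ?_
    (fun t ht => h.hasDerivWithinAt_energy ht) fun t ht hEt => ?_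
  · simpa only [mul_zero, sub_zero, h.initial] using hE0
  have hνt : ν * t ≤ τ := (mul_le_mul_of_nonneg_left ht.2 hν0).trans hνT
  have henergy := gevrey_energy_sum_le hr hασ hσ0 hσ1 (sub_nonneg.2 hνt) (h.symm t) hS0
    (h.eq_zero t) (by positivity) hEt
  set Z := ∑ k ∈ S, (freqNorm k ^ (σ / 2) *
    (gevreyWeight r (τ - ν * t) σ (freqNorm k) * ‖a t k‖)) ^ 2
  have hZ0 : 0 ≤ Z := Finset.sum_nonneg fun k _ => sq_nonneg _
  have hle : energyConst r (τ - ν * t) * (2 * K) * Z ≤ ν * Z := by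
    refine mul_le_mul_of_nonneg_right (le_trans ?_ hν) hZ0
    exact mul_le_mul_of_nonneg_right
      (energyConst_mono (sub_le_self _ (mul_nonneg hν0 ht.1))) (by positivity)
  have hνZ : 0 ≤ ν * Z := mul_nonneg hν0 hZ0
  nlinarith [(hχ t).1, (hχ t).2, mul_le_mul_of_nonneg_left (henergy.trans hle) (hχ t).1]

end IsGalerkinSolution

lemma norm_sq_le_sum_gevreyWeight (hr : 0 ≤ r) (hτ : 0 ≤ τ) (hS0 : 0 ∉ S) (a : Freq → ℂ)
    {k : Freq} (hk : k ∈ S) :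
    ‖a k‖ ^ 2 ≤ ∑ k ∈ S, (gevreyWeight r τ σ (freqNorm k) * ‖a k‖) ^ 2 := by
  have hk1 : 1 ≤ freqNorm k := one_le_freqNorm fun h => hS0 (h ▸ hk)
  have hw : 1 ≤ gevreyWeight r τ σ (freqNorm k) :=
    (one_le_expWeight hτ (freqNorm_nonneg k)).trans (expWeight_le_gevreyWeight hr hk1)
  refine (pow_le_pow_left₀ (norm_nonneg _) (le_mul_of_one_le_left (norm_nonneg _) hw) 2).trans ?_
  exact Finset.single_le_sum (f := fun k => (gevreyWeight r τ σ (freqNorm k) * ‖a k‖) ^ 2)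
    (fun k _ => sq_nonneg _) hk

lemma exists_isGalerkinSolution_one_le (hr : 3 < r) (hασ : α ≤ σ) (hσ0 : 0 ≤ σ) (hσ1 : σ ≤ 1)
    (hK : 0 < K) (hτ : 0 ≤ τ) (hν : energyConst r τ * (2 * K) ≤ ν) (hT : 0 ≤ T)
    (hνT : ν * T ≤ τ) (hS : ∀ k ∈ S, -k ∈ S) (hS0 : 0 ∉ S) (ha₀ : ConjSymm a₀)
    (hsupp : ∀ k ∉ S, a₀ k = 0)
    (hE0 : ∑ k ∈ S, (gevreyWeight r τ σ (freqNorm k) * ‖a₀ k‖) ^ 2 ≤ K ^ 2) :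
    ∃ a, IsGalerkinSolution α T S (fun _ => 1) a₀ a ∧ ∀ t ∈ Set.Icc 0 T,
      ∑ k ∈ S, (gevreyWeight r (τ - ν * T) σ (freqNorm k) * ‖a t k‖) ^ 2 ≤ (2 * K) ^ 2 := by
  obtain ⟨χ, a, ha, hχ, hχ1⟩ := exists_isGalerkinSolution α hS ha₀ hsupp (R := 2 * K)
    (by positivity) hT
  have hE : ∀ t ∈ Set.Icc 0 T,
      ∑ k ∈ S, (gevreyWeight r (τ - ν * T) σ (freqNorm k) * ‖a t k‖) ^ 2 ≤ (2 * K) ^ 2 := by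
    intro t ht
    refine (Finset.sum_le_sum fun k _ => ?_).trans
      (ha.energy_le hχ hr hασ hσ0 hσ1 hK hτ hν hνT hS0 hE0 t ht)
    have hradius : τ - ν * T ≤ τ - ν * t := by
      have hν0 : 0 ≤ ν := hν.trans' (mul_nonneg (by unfold energyConst; positivity) (by positivity))
      linarith [mul_le_mul_of_nonneg_left ht.2 hν0]
    have hmono := gevreyWeight_mono_radius (r := r) (σ := σ) hradius (freqNorm_nonneg k)
    have hnonneg := gevreyWeight_nonneg r (τ - ν * T) σ (freqNorm_nonneg k)
    gcongr
  have hinactive : ∀ t ∈ Set.Icc 0 T, χ t = 1 := fun t ht => hχ1 t fun k => by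
    by_cases hk : k ∈ S
    · exact le_of_sq_le_sq ((norm_sq_le_sum_gevreyWeight (by linarith) (sub_nonneg.2 hνT) hS0 _
        hk).trans (hE t ht)) (by positivity)
    · rw [ha.eq_zero t k hk, norm_zero]
      positivity
  refine ⟨a, ⟨ha.initial, ha.symm, ha.eq_zero, fun t ht k hk => ?_⟩, hE⟩
  rw [← hinactive t ht]
  exact ha.equation t ht k hk

end galerkinBound

/-! ### The limit of the Galerkin truncations -/

/-- A bound for the Fourier coefficients of the transport term of two functions whose Fourier
coefficients are bounded by `β` and `γ`. -/
def transportMajorant (β γ : Freq → ℝ) (k : Freq) : ℝ :=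
  ∑' l, (freqNorm (k - l) * β (k - l)) * (freqNorm l * γ l)

/-- A bound for the second time derivative of Fourier coefficients that solve the equation and are
bounded by `β`. -/
def secondDerivMajorant (β : Freq → ℝ) (k : Freq) : ℝ :=
  transportMajorant β (transportMajorant β β) k + transportMajorant (transportMajorant β β) β k

section bounds

variable {α : ℝ} {a b : Freq → ℂ} {β γ : Freq → ℝ}

lemma RapidDecay.transportMajorant (hβ : RapidDecay β) (hγ : RapidDecay γ) :
    RapidDecay (transportMajorant β γ) :=
  hβ.freqNorm_mul.convolution hγ.freqNorm_mul

lemma RapidDecay.secondDerivMajorant (hβ : RapidDecay β) : RapidDecay (secondDerivMajorant β) :=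
  (hβ.transportMajorant (hβ.transportMajorant hβ)).add
    ((hβ.transportMajorant hβ).transportMajorant hβ)

lemma RapidDecay.summable_transportMajorant (hβ : RapidDecay β) (hγ : RapidDecay γ) (k : Freq) :
    Summable fun l => (freqNorm (k - l) * β (k - l)) * (freqNorm l * γ l) :=
  (summable_shear hβ.freqNorm_mul.summable hγ.freqNorm_mul.summable hβ.freqNorm_mul.nonneg
    hγ.freqNorm_mul.nonneg).prod_factor k

lemma transport_apply_zero (α : ℝ) (a b : Freq → ℂ) : transport α a b 0 = 0 := by
  refine (tsum_congr fun l => ?_).trans tsum_zero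
  rw [transportTerm, ← transportSymbol_sub_swap]
  simp [transportSymbol]

lemma norm_transportTerm_le_of_norm_le (hα : α ≤ 1) (ha : ∀ k, ‖a k‖ ≤ β k)
    (hb : ∀ k, ‖b k‖ ≤ γ k) (k l : Freq) :
    ‖transportTerm α a b k l‖ ≤ (freqNorm (k - l) * β (k - l)) * (freqNorm l * γ l) := by
  have hkl := freqNorm_nonneg (k - l)
  have hl := freqNorm_nonneg l
  have hβ := (norm_nonneg _).trans (ha (k - l))
  refine (norm_transportTerm_le hα k l).trans ?_
  gcongr
  exacts [ha _, hb _]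

lemma summable_transportTerm (hα : α ≤ 1) (hβ : RapidDecay β) (hγ : RapidDecay γ)
    (ha : ∀ k, ‖a k‖ ≤ β k) (hb : ∀ k, ‖b k‖ ≤ γ k) (k : Freq) :
    Summable (transportTerm α a b k) :=
  .of_norm_bounded (hβ.summable_transportMajorant hγ k)
    (norm_transportTerm_le_of_norm_le hα ha hb k)

lemma norm_transport_le (hα : α ≤ 1) (hβ : RapidDecay β) (hγ : RapidDecay γ)
    (ha : ∀ k, ‖a k‖ ≤ β k) (hb : ∀ k, ‖b k‖ ≤ γ k) (k : Freq) :
    ‖transport α a b k‖ ≤ transportMajorant β γ k :=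
  tsum_of_norm_bounded (hβ.summable_transportMajorant hγ k).hasSum
    (norm_transportTerm_le_of_norm_le hα ha hb k)

lemma transport_sub_transport (hα : α ≤ 1) (hβ : RapidDecay β) (ha : ∀ k, ‖a k‖ ≤ β k)
    (hb : ∀ k, ‖b k‖ ≤ β k) (k : Freq) :
    transport α a a k - transport α b b k =
      transport α b (fun k => a k - b k) k + transport α (fun k => a k - b k) a k := by
  have hab : ∀ k, ‖a k - b k‖ ≤ 2 * β k := fun k =>
    (norm_sub_le _ _).trans (by linarith [ha k, hb k])
  have hβ2 := hβ.const_mul zero_le_two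
  rw [transport, transport, transport, transport,
    ← (summable_transportTerm hα hβ hβ ha ha k).tsum_sub (summable_transportTerm hα hβ hβ hb hb k),
    ← (summable_transportTerm hα hβ hβ2 hb hab k).tsum_add
      (summable_transportTerm hα hβ2 hβ hab ha k)]
  refine tsum_congr fun l => ?_
  simp only [transportTerm]
  ring

lemma norm_transport_sub_le {h : ℝ} (hα : α ≤ 1) (hβ : RapidDecay β) (hγ : RapidDecay γ)
    (hh : 0 ≤ h) (ha : ∀ k, ‖a k‖ ≤ β k) (hb : ∀ k, ‖b k‖ ≤ β k)
    (hab : ∀ k, ‖a k - b k‖ ≤ h * γ k) (k : Freq) :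
    ‖transport α a a k - transport α b b k‖ ≤
      h * (transportMajorant β γ k + transportMajorant γ β k) := by
  have hhγ := hγ.const_mul hh
  rw [transport_sub_transport hα hβ ha hb]
  calc _ ≤ transportMajorant β (fun k => h * γ k) k + transportMajorant (fun k => h * γ k) β k :=
        norm_add_le_of_le (norm_transport_le hα hβ hhγ hb hab k)
          (norm_transport_le hα hhγ hβ hab ha k)
    _ = _ := by
      simp only [transportMajorant, mul_add, ← tsum_mul_left]
      congr 1 <;> exact tsum_congr fun l => by ring

lemma tendsto_transport {ι : Type*} {u : Filter ι} (hα : α ≤ 1) (hβ : RapidDecay β)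
    {f : ι → Freq → ℂ} (hf : ∀ n k, ‖f n k‖ ≤ β k)
    (h : ∀ k, Tendsto (fun n => f n k) u (𝓝 (a k))) (k : Freq) :
    Tendsto (fun n => transport α (f n) (f n) k) u (𝓝 (transport α a a k)) :=
  tendsto_tsum_of_dominated_convergence (hβ.summable_transportMajorant hβ k)
    (fun _ => (tendsto_const_nhds.mul (h _)).mul (h _))
    (.of_forall fun n => norm_transportTerm_le_of_norm_le hα (hf n) (hf n) k)

end bounds

namespace IsGalerkinSolution

variable {α T : ℝ} {β : Freq → ℝ} {S : Finset Freq} {a₀ : Freq → ℂ} {a : ℝ → Freq → ℂ}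

lemma norm_sub_le (h : IsGalerkinSolution α T S (fun _ => 1) a₀ a) (hα : α ≤ 1)
    (hβ : RapidDecay β) (hb : ∀ t ∈ Set.Icc 0 T, ∀ k, ‖a t k‖ ≤ β k) {s t : ℝ}
    (hs : s ∈ Set.Icc 0 T) (ht : t ∈ Set.Icc 0 T) (k : Freq) :
    ‖a s k - a t k‖ ≤ |s - t| * transportMajorant β β k := by
  by_cases hk : k ∈ S
  · rw [mul_comm]
    refine (convex_Icc 0 T).norm_image_sub_le_of_norm_hasDerivWithin_le
      (fun v hv => h.equation v hv k hk) (fun v hv => ?_) ht hs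
    simpa using norm_transport_le hα hβ hβ (hb v hv) (hb v hv) k
  · rw [h.eq_zero s k hk, h.eq_zero t k hk, sub_zero, norm_zero]
    exact mul_nonneg (abs_nonneg _) ((hβ.transportMajorant hβ).nonneg k)

lemma norm_taylor_le (h : IsGalerkinSolution α T S (fun _ => 1) a₀ a) (hα : α ≤ 1)
    (hβ : RapidDecay β) (hb : ∀ t ∈ Set.Icc 0 T, ∀ k, ‖a t k‖ ≤ β k) {s t : ℝ}
    (hs : s ∈ Set.Icc 0 T) (ht : t ∈ Set.Icc 0 T) {k : Freq} (hk : k ∈ S) :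
    ‖a s k - a t k - ((s - t : ℝ) : ℂ) * transport α (a t) (a t) k‖ ≤
      secondDerivMajorant β k * (s - t) ^ 2 := by
  have hsub : Set.uIcc t s ⊆ Set.Icc 0 T := Set.uIcc_subset_Icc ht hs
  have hderiv : ∀ u ∈ Set.uIcc t s, HasDerivWithinAt
      (fun u => a u k - ((u - t : ℝ) : ℂ) * transport α (a t) (a t) k)
      (transport α (a u) (a u) k - transport α (a t) (a t) k) (Set.uIcc t s) u := by
    intro u hu
    have hlin : HasDerivWithinAt (fun u : ℝ => ((u - t : ℝ) : ℂ)) 1 (Set.uIcc t s) u := by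
      simpa using (((hasDerivAt_id u).sub_const t).ofReal_comp).hasDerivWithinAt
    simpa using ((h.equation u (hsub hu) k hk).mono hsub).fun_sub
      (hlin.mul_const (transport α (a t) (a t) k))
  have hbound : ∀ u ∈ Set.uIcc t s, ‖transport α (a u) (a u) k - transport α (a t) (a t) k‖ ≤
      |s - t| * secondDerivMajorant β k := fun u hu =>
    (norm_transport_sub_le hα hβ (hβ.transportMajorant hβ) (abs_nonneg _) (hb u (hsub hu))
      (hb t ht) (h.norm_sub_le hα hβ hb (hsub hu) ht) k).trans
      (mul_le_mul_of_nonneg_right (Set.abs_sub_left_of_mem_uIcc hu)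
        (hβ.secondDerivMajorant.nonneg k))
  have hmain := (convex_uIcc t s).norm_image_sub_le_of_norm_hasDerivWithin_le hderiv hbound
    Set.left_mem_uIcc Set.right_mem_uIcc
  calc _ ≤ |s - t| * secondDerivMajorant β k * ‖s - t‖ := by
        simpa [sub_right_comm] using hmain
    _ = _ := by
      rw [Real.norm_eq_abs, ← sq_abs (s - t)]
      ring

end IsGalerkinSolution

/-- The nonzero frequencies in `[-n, n]²`, to which the `n`-th Galerkin truncation is restricted. -/
def box (n : ℕ) : Finset Freq := (Finset.Icc (fun _ => -(n : ℤ)) (fun _ => (n : ℤ))).erase 0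

lemma mem_box {n : ℕ} {k : Freq} : k ∈ box n ↔ k ≠ 0 ∧ ∀ j, |k j| ≤ n := by
  simp only [box, Finset.mem_erase, Finset.mem_Icc, Pi.le_def, abs_le, forall_and]

lemma neg_mem_box {n : ℕ} {k : Freq} : -k ∈ box n ↔ k ∈ box n := by simp [mem_box]

lemma zero_notMem_box (n : ℕ) : 0 ∉ box n := fun h => (mem_box.1 h).1 rfl

lemma eventually_mem_box {k : Freq} (hk : k ≠ 0) : ∀ᶠ n in atTop, k ∈ box n := by
  filter_upwards [eventually_ge_atTop (max (k 0).natAbs (k 1).natAbs)] with n hn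
  refine mem_box.2 ⟨hk, fun j => ?_⟩
  have hj : (k j).natAbs ≤ n := by
    fin_cases j
    exacts [(le_max_left _ _).trans hn, (le_max_right _ _).trans hn]
  rw [Int.abs_eq_natAbs]
  exact_mod_cast hj

lemma norm_le_of_gevreyWeight_mul_norm_le {r τ σ M : ℝ} (hr : 0 ≤ r) {z : ℂ} {k : Freq}
    (hk : k ≠ 0) (h : gevreyWeight r τ σ (freqNorm k) * ‖z‖ ≤ M) :
    ‖z‖ ≤ M * Real.exp (-τ * freqNorm k ^ σ) := by
  rw [neg_mul, Real.exp_neg, ← div_eq_mul_inv, le_div_iff₀ (Real.exp_pos _), mul_comm]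
  exact (mul_le_mul_of_nonneg_right (expWeight_le_gevreyWeight hr (one_le_freqNorm hk))
    (norm_nonneg z)).trans h

lemma norm_le_of_sum_gevreyWeight_le {r τ σ M : ℝ} (hr : 0 ≤ r) (hM : 0 ≤ M) {a : Freq → ℂ}
    (h0 : a 0 = 0) {S : Finset Freq} {k : Freq} (hsupp : k ∉ S → a k = 0)
    (h : ∑ k ∈ S, (gevreyWeight r τ σ (freqNorm k) * ‖a k‖) ^ 2 ≤ M ^ 2) :
    ‖a k‖ ≤ M * Real.exp (-τ * freqNorm k ^ σ) := by
  by_cases hk : k ∈ S ∧ k ≠ 0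
  · refine norm_le_of_gevreyWeight_mul_norm_le hr hk.2 (le_of_sq_le_sq ?_ hM)
    exact (Finset.single_le_sum (f := fun k => (gevreyWeight r τ σ (freqNorm k) * ‖a k‖) ^ 2)
      (fun _ _ => sq_nonneg _) hk.1).trans h
  · have hak : a k = 0 := by
      rcases not_and_or.1 hk with hkS | hk0
      · exact hsupp hkS
      · rwa [not_not.1 hk0]
    rw [hak, norm_zero]
    positivity

/-- The Fourier coefficients `a t k` solve the equation on `[0, T]`. The second-order form of the
equation bounds its difference quotients uniformly in `t`, by a function of `k` that is summable in
the applications, so that the Fourier series can be differentiated in time. -/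
structure IsTaylorSolution (α T : ℝ) (b : Freq → ℝ) (a₀ : Freq → ℂ) (a : ℝ → Freq → ℂ) :
    Prop where
  initial : a 0 = a₀
  symm : ∀ t ∈ Set.Icc 0 T, ConjSymm (a t)
  apply_zero : ∀ t ∈ Set.Icc 0 T, a t 0 = 0
  taylor : ∀ t ∈ Set.Icc 0 T, ∀ s ∈ Set.Icc 0 T, ∀ k,
    ‖a s k - a t k - ((s - t : ℝ) : ℂ) * transport α (a t) (a t) k‖ ≤ b k * (s - t) ^ 2

section limit

variable {ι : Type*} {α r σ τ M K T : ℝ} {β : Freq → ℝ} {a₀ : Freq → ℂ} {a : ℝ → Freq → ℂ}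

lemma exists_tendsto_ultrafilter (u : Ultrafilter ι) {A : ι → ℝ → Freq → ℂ}
    (hA : ∀ n, ∀ t ∈ Set.Icc 0 T, ∀ k, ‖A n t k‖ ≤ β k) :
    ∃ a : ℝ → Freq → ℂ, ∀ t ∈ Set.Icc 0 T, ∀ k, Tendsto (fun n => A n t k) u (𝓝 (a t k)) := by
  have hlim : ∀ t k, ∃ z : ℂ, t ∈ Set.Icc 0 T → Tendsto (fun n => A n t k) u (𝓝 z) := by
    intro t k
    by_cases ht : t ∈ Set.Icc 0 T
    · obtain ⟨z, -, hz⟩ := (isCompact_closedBall (0 : ℂ) (β k)).ultrafilter_le_nhds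
        (u.map fun n => A n t k) (by
          rw [Ultrafilter.coe_map, le_principal_iff, mem_map]
          exact univ_mem' fun n => mem_closedBall_zero_iff.2 (hA n t ht k))
      exact ⟨z, fun _ => hz⟩
    · exact ⟨0, fun h => absurd h ht⟩
  choose a ha using hlim
  exact ⟨a, fun t ht k => ha t k ht⟩

lemma isTaylorSolution_of_tendsto {u : Filter ι} [u.NeBot] {S : ι → Finset Freq}
    {A : ι → ℝ → Freq → ℂ} (hT : 0 ≤ T) (hα : α ≤ 1) (hβ : RapidDecay β) (ha₀ : a₀ 0 = 0)
    (hS0 : ∀ n, 0 ∉ S n) (hS : ∀ k ≠ 0, ∀ᶠ n in u, k ∈ S n)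
    (hA : ∀ n, IsGalerkinSolution α T (S n) (fun _ => 1) (fun k => if k ∈ S n then a₀ k else 0)
      (A n))
    (hb : ∀ n, ∀ t ∈ Set.Icc 0 T, ∀ k, ‖A n t k‖ ≤ β k)
    (ha : ∀ t ∈ Set.Icc 0 T, ∀ k, Tendsto (fun n => A n t k) u (𝓝 (a t k))) :
    IsTaylorSolution α T (secondDerivMajorant β) a₀ a := by
  have ha0 : ∀ t ∈ Set.Icc 0 T, a t 0 = 0 := fun t ht =>
    tendsto_nhds_unique (ha t ht 0)
      (tendsto_const_nhds.congr fun n => ((hA n).eq_zero t 0 (hS0 n)).symm)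
  have h0T : (0 : ℝ) ∈ Set.Icc 0 T := Set.left_mem_Icc.2 hT
  refine ⟨?_, fun t ht k => ?_, ha0, fun t ht s hs k => ?_⟩
  · ext k
    rcases eq_or_ne k 0 with rfl | hk
    · rw [ha0 0 h0T, ha₀]
    · refine tendsto_nhds_unique (ha 0 h0T k) (tendsto_const_nhds.congr' ?_)
      filter_upwards [hS k hk] with n hn
      simp only [(hA n).initial, if_pos hn]
  · refine tendsto_nhds_unique (ha t ht (-k)) ?_
    simp only [(hA _).symm t k]
    exact (Complex.continuous_conj.tendsto _).comp (ha t ht k)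
  · rcases eq_or_ne k 0 with rfl | hk
    · rw [ha0 s hs, ha0 t ht, transport_apply_zero, sub_zero, mul_zero, sub_zero, norm_zero]
      exact mul_nonneg (hβ.secondDerivMajorant.nonneg 0) (sq_nonneg _)
    · have htransport := tendsto_transport hα hβ (fun n => hb n t ht) (ha t ht) k
      refine le_of_tendsto
        (((ha s hs k).sub (ha t ht k)).sub (tendsto_const_nhds.mul htransport)).norm ?_
      filter_upwards [hS k hk] with n hn
      exact (hA n).norm_taylor_le hα hβ (hb n) hs ht hn

lemma sum_gevreyWeight_le_of_tendsto {u : Filter ι} [u.NeBot] {S : ι → Finset Freq}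
    {A : ι → Freq → ℂ} {a : Freq → ℂ} (hsupp : ∀ n, ∀ k ∉ S n, A n k = 0)
    (hA : ∀ n, ∑ k ∈ S n, (gevreyWeight r τ σ (freqNorm k) * ‖A n k‖) ^ 2 ≤ M)
    (ha : ∀ k, Tendsto (fun n => A n k) u (𝓝 (a k))) (Q : Finset Freq) :
    ∑ k ∈ Q, (gevreyWeight r τ σ (freqNorm k) * ‖a k‖) ^ 2 ≤ M := by
  refine le_of_tendsto (tendsto_finsetSum Q fun k _ =>
    (tendsto_const_nhds.mul (ha k).norm).pow 2) (.of_forall fun n => (?_ : _ ≤ _).trans (hA n))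
  rw [← Finset.sum_inter_add_sum_sdiff Q (S n),
    Finset.sum_eq_zero (s := Q \ S n) fun k hk => by
      simp [hsupp n k (Finset.mem_sdiff.1 hk).2], add_zero]
  exact Finset.sum_le_sum_of_subset_of_nonneg Finset.inter_subset_right fun _ _ _ => sq_nonneg _

-- The radius shrinks at the speed `ν` that the energy estimate requires, and `T` is the time at
-- which half of it is left.
lemma exists_isTaylorSolution (hr : 3 < r) (hασ : α ≤ σ) (hσ0 : 0 < σ) (hσ1 : σ ≤ 1)
    (hK : 0 < K) (hτ : 0 < τ) :
    ∃ T > 0, ∃ b, RapidDecay b ∧ ∀ a₀ : Freq → ℂ, ConjSymm a₀ → a₀ 0 = 0 →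
      (∀ S : Finset Freq, ∑ k ∈ S, (gevreyWeight r τ σ (freqNorm k) * ‖a₀ k‖) ^ 2 ≤ K ^ 2) →
      ∃ a, IsTaylorSolution α T b a₀ a ∧ ∀ t ∈ Set.Icc 0 T, ∀ S : Finset Freq,
        ∑ k ∈ S, (gevreyWeight r (τ / 2) σ (freqNorm k) * ‖a t k‖) ^ 2 ≤ (2 * K) ^ 2 := by
  set ν := energyConst r τ * (2 * K) + 1
  have hν : 0 < ν := by
    simp only [ν, energyConst]
    positivity
  have hνT : ν * (τ / (2 * ν)) = τ / 2 := by field_simp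
  have hT : 0 < τ / (2 * ν) := by positivity
  set β : Freq → ℝ := fun k => 2 * K * Real.exp (-(τ / 2) * freqNorm k ^ σ)
  have hβ : RapidDecay β := (rapidDecay_exp_neg (half_pos hτ) hσ0).const_mul (by positivity)
  refine ⟨τ / (2 * ν), hT, secondDerivMajorant β, hβ.secondDerivMajorant,
    fun a₀ hsymm ha₀ hE₀ => ?_⟩
  have hgalerkin := fun n : ℕ => exists_isGalerkinSolution_one_le
    (a₀ := fun k => if k ∈ box n then a₀ k else 0) hr hασ hσ0.le hσ1 hK hτ.le
    (ν := ν) (by linarith) hT.le (by linarith) (fun k => neg_mem_box.2) (zero_notMem_box n)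
    (fun k => by simp only [neg_mem_box, hsymm k, apply_ite conj, map_zero])
    (fun k hk => if_neg hk)
    ((Finset.sum_congr rfl fun k hk => by rw [if_pos hk]).le.trans (hE₀ (box n)))
  choose A hA hE using hgalerkin
  simp only [hνT, sub_half] at hE
  have hb : ∀ n, ∀ t ∈ Set.Icc 0 (τ / (2 * ν)), ∀ k, ‖A n t k‖ ≤ β k := fun n t ht k =>
    norm_le_of_sum_gevreyWeight_le (by linarith) (by positivity)
      ((hA n).eq_zero t 0 (zero_notMem_box n)) ((hA n).eq_zero t k) (hE n t ht)
  obtain ⟨a, ha⟩ := exists_tendsto_ultrafilter (hyperfilter ℕ) hb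
  exact ⟨a, isTaylorSolution_of_tendsto hT.le (hασ.trans hσ1) hβ ha₀ zero_notMem_box
    (fun k hk => Nat.hyperfilter_le_atTop (eventually_mem_box hk)) hA hb ha,
    fun t ht => sum_gevreyWeight_le_of_tendsto (fun n => (hA n).eq_zero t) (fun n => hE n t ht)
      (ha t ht)⟩

end limit

/-! ### Fourier series -/

section character

variable (k l : Freq) (j : Fin 2) (x : Plane)

lemma norm_character : ‖character k x‖ = 1 := by
  rw [character, mul_comm, Complex.norm_exp_ofReal_mul_I]

lemma character_add : character (k + l) x = character k x * character l x := by
  rw [character, character, character, ← Complex.exp_add]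
  congr 1
  simp only [Pi.add_apply]
  push_cast
  ring

lemma character_neg : character (-k) x = conj (character k x) := by
  rw [character, character, ← Complex.exp_conj]
  congr 1
  simp only [map_mul, Complex.conj_I, Complex.conj_ofReal, Pi.neg_apply]
  push_cast
  ring

lemma continuous_character : Continuous (character k) := by
  unfold character
  fun_prop

lemma character_add_single : character k (x + Pi.single j (2 * Real.pi)) = character k x := by
  rw [character, character, Complex.exp_eq_exp_iff_exists_int]
  refine ⟨k j, ?_⟩
  fin_cases j <;> simp <;> ring

lemma character_eq_prod :
    character k x = ∏ j, Complex.exp (Complex.I * (((k j : ℝ) * x j : ℝ) : ℂ)) := by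
  rw [Fin.prod_univ_two, ← Complex.exp_add, character]
  congr 1
  push_cast
  ring

end character

/-- The closed square `[0, 2π]²`, over which Fourier coefficients are integrated. -/
abbrev cell : Set Plane := Set.Icc (0 : Plane) (fun _ => 2 * Real.pi)

lemma integral_exp_I_mul_int_mul (n : ℤ) :
    ∫ y in Set.Icc 0 (2 * Real.pi), Complex.exp (Complex.I * ((n * y : ℝ) : ℂ)) =
      if n = 0 then ((2 * Real.pi : ℝ) : ℂ) else 0 := by
  rw [integral_Icc_eq_integral_Ioc, ← intervalIntegral.integral_of_le Real.two_pi_pos.le]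
  split_ifs with hn
  · simp [hn]
  · have hIn : Complex.I * (n : ℂ) ≠ 0 := mul_ne_zero Complex.I_ne_zero (by exact_mod_cast hn)
    have hperiod : Complex.exp (Complex.I * n * ((2 * Real.pi : ℝ) : ℂ)) = 1 := by
      rw [← Complex.exp_int_mul_two_pi_mul_I n]
      congr 1
      push_cast
      ring
    simp only [Complex.ofReal_mul, Complex.ofReal_intCast, ← mul_assoc]
    rw [integral_exp_mul_complex hIn, hperiod]
    simp

lemma volume_restrict_cell : (volume : Measure Plane).restrict cell =
    Measure.pi fun _ : Fin 2 => (volume : Measure ℝ).restrict (Set.Icc 0 (2 * Real.pi)) := by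
  rw [← Measure.restrict_pi_pi, ← volume_pi]
  congr 1
  exact (Set.pi_univ_Icc _ _).symm

lemma integral_character (k : Freq) :
    ∫ x in cell, character k x = if k = 0 then (((2 * Real.pi) ^ 2 : ℝ) : ℂ) else 0 := by
  rw [volume_restrict_cell]
  simp only [character_eq_prod]
  rw [integral_fintype_prod_eq_prod (𝕜 := ℂ) (fun (j : Fin 2) (y : ℝ) =>
    Complex.exp (Complex.I * (((k j : ℝ) * y : ℝ) : ℂ)))]
  simp only [integral_exp_I_mul_int_mul]
  split_ifs with hk
  · simp [hk]
  · obtain ⟨j, hj⟩ := Function.ne_iff.1 hk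
    exact Finset.prod_eq_zero (Finset.mem_univ j) (if_neg hj)

/-- The Fourier series with coefficients `c`. -/
def series (c : Freq → ℂ) (x : Plane) : ℂ := ∑' k, c k * character k x

section series

variable {c : Freq → ℂ}

lemma norm_mul_character (z : ℂ) (k : Freq) (x : Plane) : ‖z * character k x‖ = ‖z‖ := by
  rw [norm_mul, norm_character, mul_one]

lemma summable_series (hc : Summable fun k => ‖c k‖) (x : Plane) :
    Summable fun k => c k * character k x :=
  .of_norm_bounded hc fun _ => (norm_mul_character _ _ _).le

lemma continuous_series (hc : Summable fun k => ‖c k‖) : Continuous (series c) :=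
  continuous_tsum (fun k => continuous_const.mul (continuous_character k)) hc fun _ _ =>
    (norm_mul_character _ _ _).le

lemma series_add_single (c : Freq → ℂ) (j : Fin 2) (x : Plane) :
    series c (x + Pi.single j (2 * Real.pi)) = series c x := by
  simp only [series, character_add_single]

lemma integral_series_mul_character (hc : Summable fun k => ‖c k‖) (m : Freq) :
    ((((2 * Real.pi) ^ 2)⁻¹ : ℝ) : ℂ) * ∫ x in cell, series c x * character (-m) x = c m := by
  have hexpand : ∀ x, series c x * character (-m) x = ∑' k, c k * character (k - m) x := by
    intro x
    rw [series, ← tsum_mul_right]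
    refine tsum_congr fun k => ?_
    rw [sub_eq_add_neg, character_add, mul_assoc]
  have hint : ∀ k, IntegrableOn (fun x => c k * character (k - m) x) cell := fun k =>
    (continuous_const.mul (continuous_character _)).continuousOn.integrableOn_compact isCompact_Icc
  have hsum : HasSum (fun k => ∫ x in cell, c k * character (k - m) x)
      (∫ x in cell, ∑' k, c k * character (k - m) x) := by
    refine hasSum_integral_of_summable_integral_norm hint ?_
    simp only [norm_mul_character, integral_const]
    exact hc.mul_left _
  have horth : ∀ k, ∫ x in cell, c k * character (k - m) x =
      if k = m then c m * (((2 * Real.pi) ^ 2 : ℝ) : ℂ) else 0 := by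
    intro k
    rw [integral_const_mul, integral_character]
    by_cases hk : k = m
    · simp [hk]
    · rw [if_neg (sub_ne_zero.2 hk), if_neg hk, mul_zero]
  simp only [horth] at hsum
  simp only [hexpand]
  rw [hsum.unique (hasSum_ite_eq m _), mul_comm (c m), ← mul_assoc, ← Complex.ofReal_mul,
    inv_mul_cancel₀ (by positivity), Complex.ofReal_one, one_mul]

end series

lemma conjSymm_fourierCoef (f : Plane → ℝ) : ConjSymm (fourierCoef f) := by
  intro k
  rw [fourierCoef, fourierCoef, map_mul, Complex.conj_ofReal, ← integral_conj]
  simp only [map_mul, Complex.conj_ofReal, ← character_neg, neg_neg]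

/-! ### Fourier inversion -/

lemma IsPeriodic.add_int {f : Plane → ℝ} (hf : IsPeriodic f) (n : Freq) (x : Plane) :
    f (x + fun j => 2 * Real.pi * n j) = f x := by
  have hsplit : (fun j => 2 * Real.pi * (n j : ℝ)) =
      n 0 • (Pi.single 0 (2 * Real.pi) : Plane) + n 1 • (Pi.single 1 (2 * Real.pi) : Plane) := by
    ext j
    fin_cases j <;> simp [mul_comm]
  rw [hsplit, ← add_assoc, (Function.Periodic.zsmul (hf 1) (n 1)) _,
    (Function.Periodic.zsmul (hf 0) (n 0)) _]

/-- The projection of the plane to the torus `ℝ²/ℤ²` of Mathlib. Functions with period `2π` descend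
to this torus after scaling by `2π`. -/
def toUnitTorus : C(Plane, UnitAddTorus (Fin 2)) where
  toFun x j := (x j : UnitAddCircle)
  continuous_toFun :=
    continuous_pi fun j => (AddCircle.continuous_mk' 1).comp (continuous_apply j)

lemma isQuotientMap_toUnitTorus : Topology.IsQuotientMap toUnitTorus :=
  (IsOpenQuotientMap.piMap (f := fun (_ : Fin 2) (y : ℝ) => (y : UnitAddCircle)) fun _ =>
    QuotientAddGroup.isOpenQuotientMap_mk).isQuotientMap

lemma mFourier_toUnitTorus (k : Freq) (x : Plane) :
    UnitAddTorus.mFourier k (toUnitTorus x) = character k ((2 * Real.pi) • x) := by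
  change ∏ j, fourier (k j) (x j : UnitAddCircle) = _
  rw [character_eq_prod]
  refine Finset.prod_congr rfl fun j _ => ?_
  rw [fourier_coe_apply]
  congr 1
  simp
  ring

lemma exists_comp_toUnitTorus {f : Plane → ℝ} (hf : Continuous f) (hp : IsPeriodic f) :
    ∃ F : C(UnitAddTorus (Fin 2), ℂ), ∀ x, F (toUnitTorus x) = f ((2 * Real.pi) • x) := by
  let g : C(Plane, ℂ) := ⟨fun x => (f ((2 * Real.pi) • x) : ℂ), by fun_prop⟩
  have hg : ∀ x y, toUnitTorus x = toUnitTorus y → g x = g y := by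
    intro x y h
    have hdiff : ∀ j, ∃ n : ℤ, x j = y j + n := fun j => by
      obtain ⟨n, hn⟩ := AddSubgroup.mem_zmultiples_iff.1
        (QuotientAddGroup.eq_iff_sub_mem.1 (congrFun h j))
      exact ⟨n, by rw [zsmul_eq_mul, mul_one] at hn; linarith⟩
    choose n hn using hdiff
    have hshift : (2 * Real.pi) • x = (2 * Real.pi) • y + fun j => 2 * Real.pi * (n j : ℝ) := by
      ext j
      simp only [Pi.smul_apply, Pi.add_apply, smul_eq_mul, hn j]
      ring
    change (f ((2 * Real.pi) • x) : ℂ) = f ((2 * Real.pi) • y)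
    rw [hshift, hp.add_int n]
  exact ⟨isQuotientMap_toUnitTorus.lift g hg, fun x =>
    DFunLike.congr_fun (isQuotientMap_toUnitTorus.lift_comp g hg) x⟩

open scoped Pointwise in
lemma two_pi_smul_Icc : (2 * Real.pi) • Set.Icc (0 : Plane) 1 = cell := by
  have himage := (OrderIso.smulRight (β := Plane) Real.two_pi_pos).image_Icc 0 1
  simp only [OrderIso.smulRight_apply, smul_zero] at himage
  refine himage.trans (congrArg _ ?_)
  ext j
  simp

open scoped Pointwise in
lemma mFourierCoeff_eq_fourierCoef {f : Plane → ℝ} {F : C(UnitAddTorus (Fin 2), ℂ)}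
    (hF : ∀ x, F (toUnitTorus x) = f ((2 * Real.pi) • x)) (k : Freq) :
    UnitAddTorus.mFourierCoeff F k = fourierCoef f k := by
  have hIoc : {x : Plane | ∀ i, x i ∈ Set.Ioc ((0 : Plane) i) ((0 : Plane) i + 1)} =
      Set.univ.pi fun i => Set.Ioc ((0 : Plane) i) ((1 : Plane) i) := by
    ext x
    simp [Set.mem_pi]
  have hintegrand : ∀ x : Plane, UnitAddTorus.mFourier (-k) (fun i => (x i : UnitAddCircle)) •
      F (fun i => (x i : UnitAddCircle)) =
      (fun y : Plane => (f y : ℂ) * character (-k) y) ((2 * Real.pi) • x) := fun x =>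
    (congrArg₂ (· • ·) (mFourier_toUnitTorus (-k) x) (hF x)).trans (mul_comm _ _)
  rw [UnitAddTorus.mFourierCoeff_eq_integral F k 0, hIoc, volume_pi,
    setIntegral_congr_set Measure.univ_pi_Ioc_ae_eq_Icc, ← volume_pi]
  simp only [hintegrand]
  refine (Measure.setIntegral_comp_smul_of_pos volume
    (fun x : Plane => (f x : ℂ) * character (-k) x) _ Real.two_pi_pos).trans ?_
  change _ • ∫ x in (2 * Real.pi) • Set.Icc (0 : Plane) 1, _ = _
  rw [two_pi_smul_Icc, fourierCoef]
  simp

lemma series_fourierCoef {f : Plane → ℝ} (hf : Continuous f) (hp : IsPeriodic f)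
    (hs : Summable fun k => ‖fourierCoef f k‖) (x : Plane) : series (fourierCoef f) x = f x := by
  obtain ⟨F, hF⟩ := exists_comp_toUnitTorus hf hp
  have hcoef := mFourierCoeff_eq_fourierCoef hF
  have hsum : Summable (UnitAddTorus.mFourierCoeff F) := by
    rw [funext hcoef]
    exact hs.of_norm
  have hinv := UnitAddTorus.hasSum_mFourier_series_apply_of_summable hsum
    (toUnitTorus ((2 * Real.pi)⁻¹ • x))
  simp only [hF, hcoef, mFourier_toUnitTorus, smul_inv_smul₀ Real.two_pi_pos.ne', smul_eq_mul]
    at hinv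
  exact hinv.tsum_eq

/-! ### Differentiation and multiplication of Fourier series -/

/-- The Fourier coefficients of the `j`-th partial derivative. -/
def derivCoef (j : Fin 2) (c : Freq → ℂ) (k : Freq) : ℂ := ((k j : ℝ) : ℂ) * Complex.I * c k

/-- The derivative of the character of frequency `k`. -/
def characterDeriv (k : Freq) (x : Plane) : Plane →L[ℝ] ℂ :=
  ∑ j, (ContinuousLinearMap.proj j : Plane →L[ℝ] ℝ).smulRight
    (((k j : ℝ) : ℂ) * Complex.I * character k x)

/-- The derivative of the Fourier series with coefficients `c`. -/
def seriesDeriv (c : Freq → ℂ) (x : Plane) : Plane →L[ℝ] ℂ :=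
  ∑ j, (ContinuousLinearMap.proj j : Plane →L[ℝ] ℝ).smulRight (series (derivCoef j c) x)

section derivative

variable {c : Freq → ℂ}

lemma norm_derivCoef_le (j : Fin 2) (c : Freq → ℂ) (k : Freq) :
    ‖derivCoef j c k‖ ≤ freqNorm k * ‖c k‖ := by
  rw [derivCoef, norm_mul, norm_mul, Complex.norm_I, mul_one, Complex.norm_real, Real.norm_eq_abs]
  exact mul_le_mul_of_nonneg_right (abs_coord_le_freqNorm k j) (norm_nonneg _)

lemma RapidDecay.derivCoef (hc : RapidDecay fun k => ‖c k‖) (j : Fin 2) :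
    RapidDecay fun k => ‖derivCoef j c k‖ :=
  hc.freqNorm_mul.of_le (fun _ => norm_nonneg _) (norm_derivCoef_le j c)

lemma ConjSymm.derivCoef (hc : ConjSymm c) (j : Fin 2) : ConjSymm (derivCoef j c) := by
  intro k
  simp only [SIPM.derivCoef, hc k, map_mul, Complex.conj_I, Complex.conj_ofReal, Pi.neg_apply]
  push_cast
  ring

lemma hasFDerivAt_character (k : Freq) (x : Plane) :
    HasFDerivAt (character k) (characterDeriv k x) x := by
  have hproj : ∀ j : Fin 2, HasFDerivAt (fun y : Plane => y j)
      (ContinuousLinearMap.proj j : Plane →L[ℝ] ℝ) x := fun j =>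
    (ContinuousLinearMap.proj j : Plane →L[ℝ] ℝ).hasFDerivAt
  have hphase := ((hproj 0).const_mul (k 0 : ℝ)).add ((hproj 1).const_mul (k 1 : ℝ))
  refine ((Complex.ofRealCLM.hasFDerivAt.comp x hphase).const_mul Complex.I).cexp.congr_fderiv ?_
  ext v
  simp [characterDeriv, Fin.sum_univ_two, character]
  ring

lemma norm_characterDeriv_le (k : Freq) (x : Plane) : ‖characterDeriv k x‖ ≤ 2 * freqNorm k := by
  have hterm : ∀ j, ‖(ContinuousLinearMap.proj j : Plane →L[ℝ] ℝ).smulRight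
      (((k j : ℝ) : ℂ) * Complex.I * character k x)‖ ≤ freqNorm k := by
    intro j
    have hproj : ‖(ContinuousLinearMap.proj j : Plane →L[ℝ] ℝ)‖ ≤ 1 :=
      ContinuousLinearMap.opNorm_le_bound _ zero_le_one fun v => by
        simpa using norm_le_pi_norm v j
    rw [ContinuousLinearMap.norm_smulRight_apply, norm_mul_character, norm_mul, Complex.norm_I,
      mul_one, Complex.norm_real, Real.norm_eq_abs, ← one_mul (freqNorm k)]
    exact mul_le_mul hproj (abs_coord_le_freqNorm k j) (abs_nonneg _) zero_le_one
  refine (norm_sum_le_of_le _ fun j _ => hterm j).trans ?_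
  simp

lemma hasSum_smul_characterDeriv (hc : RapidDecay fun k => ‖c k‖) (x : Plane) :
    HasSum (fun k => c k • characterDeriv k x) (seriesDeriv c x) := by
  have hterm := hasSum_sum fun (j : Fin 2) (_ : j ∈ Finset.univ) =>
    (ContinuousLinearMap.smulRightL ℝ Plane ℂ (ContinuousLinearMap.proj j)).hasSum
      (summable_series (hc.derivCoef j).summable x).hasSum
  refine hterm.congr_fun fun k => ?_
  ext v
  simp [characterDeriv, derivCoef, Fin.sum_univ_two]
  ring

lemma hasFDerivAt_series (hc : RapidDecay fun k => ‖c k‖) (x : Plane) :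
    HasFDerivAt (series c) (seriesDeriv c x) x := by
  rw [← (hasSum_smul_characterDeriv hc x).tsum_eq]
  refine hasFDerivAt_tsum (hc.freqNorm_mul.summable.mul_left 2)
    (fun k y => (hasFDerivAt_character k y).const_mul (c k)) (fun k y => ?_)
    (summable_series hc.summable 0) x
  rw [norm_smul]
  calc ‖c k‖ * ‖characterDeriv k y‖ ≤ ‖c k‖ * (2 * freqNorm k) :=
        mul_le_mul_of_nonneg_left (norm_characterDeriv_le k y) (norm_nonneg _)
    _ = _ := by ring

lemma contDiff_series (hc : RapidDecay fun k => ‖c k‖) : ContDiff ℝ ∞ (series c) := by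
  refine contDiff_infty.2 fun n => ?_
  induction n generalizing c with
  | zero => exact contDiff_zero.2 (continuous_series hc.summable)
  | succ n ih =>
    have hfderiv : fderiv ℝ (series c) = seriesDeriv c :=
      funext fun x => (hasFDerivAt_series hc x).fderiv
    rw [Nat.cast_add, Nat.cast_one, contDiff_succ_iff_fderiv, hfderiv]
    exact ⟨fun x => (hasFDerivAt_series hc x).differentiableAt, by simp,
      ContDiff.sum fun j _ => contDiff_const.smulRight (ih (hc.derivCoef j))⟩

lemma ofReal_re_series (hc : ConjSymm c) (x : Plane) : ((series c x).re : ℂ) = series c x := by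
  refine Complex.conj_eq_iff_re.1 ?_
  rw [series, Complex.conj_tsum, ← (Equiv.neg Freq).tsum_eq]
  refine tsum_congr fun k => ?_
  rw [map_mul, Equiv.neg_apply, hc k, Complex.conj_conj, character_neg, Complex.conj_conj]

lemma partialDeriv_eq_series {f : Plane → ℝ} (hf : ∀ x, (f x : ℂ) = series c x)
    (hc : RapidDecay fun k => ‖c k‖) (hsymm : ConjSymm c) (j : Fin 2) (x : Plane) :
    (partialDeriv j f x : ℂ) = series (derivCoef j c) x := by
  have hre : f = Complex.reCLM ∘ series c := funext fun x => by simp [← hf x]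
  have hpartial : partialDeriv j f x = (series (derivCoef j c) x).re := by
    rw [partialDeriv, hre, (Complex.reCLM.hasFDerivAt.comp x (hasFDerivAt_series hc x)).fderiv]
    fin_cases j <;> simp [seriesDeriv, Fin.sum_univ_two]
  rw [hpartial, ofReal_re_series (hsymm.derivCoef j)]

lemma fourierCoef_eq {f : Plane → ℝ} (hf : ∀ x, (f x : ℂ) = series c x)
    (hc : Summable fun k => ‖c k‖) : fourierCoef f = c := by
  ext k
  simp only [fourierCoef, hf]
  exact integral_series_mul_character hc k

end derivative

section nonlinearity

variable {a b c : Freq → ℂ}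

lemma summable_convolution (ha : Summable fun k => ‖a k‖) (hb : Summable fun k => ‖b k‖) :
    Summable fun p : Freq × Freq => ‖a (p.1 - p.2) * b p.2‖ := by
  simpa only [norm_mul] using
    summable_shear ha hb (fun _ => norm_nonneg _) fun _ => norm_nonneg _

lemma summable_norm_tsum_convolution (ha : Summable fun k => ‖a k‖)
    (hb : Summable fun k => ‖b k‖) : Summable fun k => ‖∑' l, a (k - l) * b l‖ :=
  (summable_convolution ha hb).prod.of_nonneg_of_le (fun _ => norm_nonneg _) fun k =>
    norm_tsum_le_tsum_norm ((summable_convolution ha hb).prod_factor k)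

lemma series_mul (ha : Summable fun k => ‖a k‖) (hb : Summable fun k => ‖b k‖) (x : Plane) :
    series a x * series b x = series (fun k => ∑' l, a (k - l) * b l) x := by
  have ha' : Summable fun k => ‖a k * character k x‖ := by simpa only [norm_mul_character] using ha
  have hb' : Summable fun k => ‖b k * character k x‖ := by simpa only [norm_mul_character] using hb
  have hsum := summable_convolution ha' hb'
  calc series a x * series b x
      = ∑' p : Freq × Freq, a p.1 * character p.1 x * (b p.2 * character p.2 x) :=
        tsum_mul_tsum_of_summable_norm ha' hb'
    _ = ∑' k, ∑' l, a (k - l) * character (k - l) x * (b l * character l x) := by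
        rw [← hsum.of_norm.tsum_prod]
        exact (shear.tsum_eq _).symm
    _ = series (fun k => ∑' l, a (k - l) * b l) x := by
        refine tsum_congr fun k => ?_
        rw [← tsum_mul_right]
        refine tsum_congr fun l => ?_
        rw [← congrArg (character · x) (sub_add_cancel k l), character_add]
        ring

lemma abs_ipmSymbol_le_one (j : Fin 2) (k : Freq) : |ipmSymbol j k| ≤ 1 := by
  have hcoord : ∀ i, |(k 0 : ℝ)| * |(k i : ℝ)| ≤ freqNorm k ^ 2 := fun i => by
    rw [sq]
    exact mul_le_mul (abs_coord_le_freqNorm k 0) (abs_coord_le_freqNorm k i) (abs_nonneg _)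
      (freqNorm_nonneg k)
  rw [ipmSymbol, ← freqNorm_sq]
  split_ifs
  · simp
  · rw [abs_div, abs_of_nonneg (sq_nonneg (freqNorm k))]
    refine div_le_one_of_le₀ ?_ (sq_nonneg _)
    fin_cases j
    · simpa [abs_mul] using hcoord 1
    · simpa [sq] using hcoord 0

lemma abs_freqNorm_rpow_mul_ipmSymbol_le {α : ℝ} (hα : α ≤ 1) (j : Fin 2) (k : Freq) :
    |freqNorm k ^ α * ipmSymbol j k| ≤ freqNorm k := by
  obtain rfl | hk := eq_or_ne k 0
  · simp [ipmSymbol]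
  rw [abs_mul, abs_of_nonneg (Real.rpow_nonneg (freqNorm_nonneg k) α)]
  calc _ ≤ freqNorm k * 1 := mul_le_mul (freqNorm_rpow_le_self hα hk) (abs_ipmSymbol_le_one j k)
        (abs_nonneg _) (freqNorm_nonneg k)
    _ = _ := mul_one _

lemma neg_sum_velocity_mul_partialDeriv_eq_series {α : ℝ} (hα : α ≤ 1) {f : Plane → ℝ}
    (hf : ∀ x, (f x : ℂ) = series c x) (hc : RapidDecay fun k => ‖c k‖) (hsymm : ConjSymm c)
    (x : Plane) :
    -∑ j : Fin 2, velocity α f j x * (partialDeriv j f x : ℂ) = series (transport α c c) x := by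
  set u : Fin 2 → Freq → ℂ := fun j k => ((freqNorm k ^ α * ipmSymbol j k : ℝ) : ℂ) * c k
  have hvelocity : ∀ j, velocity α f j x = series (u j) x := fun j => by
    rw [velocity, fourierMultiplier, fourierCoef_eq hf hc.summable, series]
  have hu : ∀ j, Summable fun k => ‖u j k‖ := fun j =>
    hc.freqNorm_mul.summable.of_nonneg_of_le (fun k => norm_nonneg _) fun k => by
      rw [norm_mul, Complex.norm_real, Real.norm_eq_abs]
      exact mul_le_mul_of_nonneg_right (abs_freqNorm_rpow_mul_ipmSymbol_le hα j k)
        (norm_nonneg _)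
  have hd : ∀ j, Summable fun k => ‖derivCoef j c k‖ := fun j => (hc.derivCoef j).summable
  have hfiber : ∀ j k, Summable fun l => u j (k - l) * derivCoef j c l := fun j k =>
    (summable_convolution (hu j) (hd j)).of_norm.prod_factor k
  have hconv := fun j => summable_series (summable_norm_tsum_convolution (hu j) (hd j)) x
  simp only [hvelocity, partialDeriv_eq_series hf hc hsymm, series_mul (hu _) (hd _)]
  simp only [Fin.sum_univ_two, series]
  rw [← (hconv 0).tsum_add (hconv 1), ← tsum_neg]
  refine tsum_congr fun k => ?_
  rw [← add_mul, ← neg_mul, ← (hfiber 0 k).tsum_add (hfiber 1 k), ← tsum_neg, transport]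
  congr 1
  refine tsum_congr fun l => ?_
  simp only [u, derivCoef, transportTerm, transportSymbol]
  push_cast
  ring

end nonlinearity

/-! ### Gevrey norms -/

section gevrey

variable {r s τ M : ℝ} {f : Plane → ℝ}

lemma freqNorm_rpow_mul_exp_mul_sq (r s τ : ℝ) (z : ℂ) (k : Freq) :
    freqNorm k ^ (2 * r) * Real.exp (2 * τ * freqNorm k ^ (1 / s)) * ‖z‖ ^ 2 =
      (gevreyWeight r τ (1 / s) (freqNorm k) * ‖z‖) ^ 2 := by
  rw [gevreyWeight, expWeight, mul_pow, mul_pow, ← Real.rpow_natCast (freqNorm k ^ r),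
    ← Real.rpow_mul (freqNorm_nonneg k), ← Real.exp_nat_mul]
  congr 3
  · push_cast; ring
  · push_cast; ring

lemma gevreyNorm_eq_tsum (hr : 0 < r) (f : Plane → ℝ) :
    gevreyNorm r s τ f = (∑' k, ENNReal.ofReal
      ((gevreyWeight r τ (1 / s) (freqNorm k) * ‖fourierCoef f k‖) ^ 2)) ^ (1 / 2 : ℝ) := by
  rw [gevreyNorm]
  congr 1
  simp only [freqNorm_rpow_mul_exp_mul_sq]
  refine tsum_subtype_eq_of_support_subset (s := {k : Freq | k ≠ 0}) (f := fun k =>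
    ENNReal.ofReal ((gevreyWeight r τ (1 / s) (freqNorm k) * ‖fourierCoef f k‖) ^ 2)) ?_
  rintro k hk rfl
  simp [gevreyWeight, Real.zero_rpow hr.ne'] at hk

lemma gevreyNorm_le_iff (hr : 0 < r) (hM : 0 ≤ M) (f : Plane → ℝ) :
    gevreyNorm r s τ f ≤ ENNReal.ofReal M ↔ ∀ S : Finset Freq,
      ∑ k ∈ S, (gevreyWeight r τ (1 / s) (freqNorm k) * ‖fourierCoef f k‖) ^ 2 ≤ M ^ 2 := by
  rw [gevreyNorm_eq_tsum hr, one_div (2 : ℝ), ENNReal.rpow_inv_le_iff two_pos,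
    ENNReal.ofReal_rpow_of_nonneg hM zero_le_two, Real.rpow_two]
  have hofReal : ∀ S : Finset Freq, ∑ k ∈ S, ENNReal.ofReal
      ((gevreyWeight r τ (1 / s) (freqNorm k) * ‖fourierCoef f k‖) ^ 2) ≤ ENNReal.ofReal (M ^ 2) ↔
      ∑ k ∈ S, (gevreyWeight r τ (1 / s) (freqNorm k) * ‖fourierCoef f k‖) ^ 2 ≤ M ^ 2 := by
    intro S
    rw [← ENNReal.ofReal_sum_of_nonneg fun k _ => sq_nonneg _,
      ENNReal.ofReal_le_ofReal_iff (sq_nonneg _)]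
  simp only [← hofReal]
  exact ⟨fun h S => (ENNReal.sum_le_tsum S).trans h, fun h => ENNReal.summable.tsum_le_of_sum_le h⟩

lemma fourierCoef_zero_eq_zero_iff : fourierCoef f 0 = 0 ↔ ∫ x in cell, f x = 0 := by
  have hchar : ∀ x, character 0 x = 1 := fun x => by simp [character]
  have hpi : ((2 * Real.pi) ^ 2)⁻¹ ≠ 0 := by positivity
  simp only [fourierCoef, neg_zero, hchar, mul_one]
  rw [integral_complex_ofReal, mul_eq_zero, Complex.ofReal_eq_zero, Complex.ofReal_eq_zero]
  exact or_iff_right hpi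

lemma MemGevrey.fourierCoef_zero (hf : MemGevrey r s τ f) : fourierCoef f 0 = 0 :=
  fourierCoef_zero_eq_zero_iff.2 hf.mean_zero

lemma MemGevrey.norm_fourierCoef_le (hr : 0 < r) (hM : 0 ≤ M) (hf : MemGevrey r s τ f)
    (h : gevreyNorm r s τ f ≤ ENNReal.ofReal M) (k : Freq) :
    ‖fourierCoef f k‖ ≤ M * Real.exp (-τ * freqNorm k ^ (1 / s)) :=
  norm_le_of_sum_gevreyWeight_le hr.le hM hf.fourierCoef_zero (S := {k}) (by simp)
    ((gevreyNorm_le_iff hr hM f).1 h {k})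

lemma MemGevrey.eq_series (hf : MemGevrey r s τ f) (hs : Summable fun k => ‖fourierCoef f k‖)
    (x : Plane) : (f x : ℂ) = series (fourierCoef f) x :=
  (series_fourierCoef hf.smooth.continuous hf.periodic hs x).symm

lemma memGevrey_of_eq_series (hr : 0 < r) (hM : 0 ≤ M) {c : Freq → ℂ}
    (hf : ∀ x, (f x : ℂ) = series c x) (hc : RapidDecay fun k => ‖c k‖) (h0 : c 0 = 0)
    (hb : ∀ S : Finset Freq,
      ∑ k ∈ S, (gevreyWeight r τ (1 / s) (freqNorm k) * ‖c k‖) ^ 2 ≤ M ^ 2) :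
    MemGevrey r s τ f ∧ gevreyNorm r s τ f ≤ ENNReal.ofReal M := by
  have hcoef := fourierCoef_eq hf hc.summable
  have hnorm : gevreyNorm r s τ f ≤ ENNReal.ofReal M := by
    rwa [gevreyNorm_le_iff hr hM, hcoef]
  have hre : f = fun x => (series c x).re := funext fun x => by simp [← hf x]
  refine ⟨⟨?_, fun j x => ?_, ?_, hnorm.trans_lt ENNReal.ofReal_lt_top⟩, hnorm⟩
  · rw [hre]
    exact Complex.reCLM.contDiff.comp (contDiff_series hc)
  · simp only [hre, series_add_single]
  · rw [← fourierCoef_zero_eq_zero_iff, hcoef, h0]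

end gevrey

/-! ### Uniqueness for the system of Fourier coefficients -/

lemma freqNorm_rpow_le_self_of_pos {σ : ℝ} (hσ0 : 0 < σ) (hσ1 : σ ≤ 1) (k : Freq) :
    freqNorm k ^ σ ≤ freqNorm k := by
  obtain rfl | hk := eq_or_ne k 0
  · rw [freqNorm_zero, Real.zero_rpow hσ0.ne']
  · exact freqNorm_rpow_le_self hσ1 hk

/-- A speed of decrease of the radius of analyticity for which the weighted energy of the difference
of two solutions bounded by `β` does not grow, as long as the radius is at most `δ`. -/
def differenceRate (δ σ : ℝ) (β : Freq → ℝ) : ℝ :=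
  (δ + 2) * ∑' k, freqNorm k ^ 2 * (expWeight δ σ (freqNorm k) ^ 2 * β k)

section difference

variable {α σ δ δ' ν : ℝ} {β γ : Freq → ℝ} {a b : Freq → ℂ}

lemma differenceRate_nonneg (hδ : 0 ≤ δ)
    (hβ : RapidDecay fun k => expWeight δ σ (freqNorm k) ^ 2 * β k) : 0 ≤ differenceRate δ σ β :=
  mul_nonneg (by linarith) (tsum_nonneg (hβ.pow_mul 2).nonneg)

lemma expWeight_sq_mul_norm_le (hδ : δ' ≤ δ) (ha : ∀ k, ‖a k‖ ≤ β k) (k : Freq) :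
    expWeight δ' σ (freqNorm k) ^ 2 * ‖a k‖ ≤ expWeight δ σ (freqNorm k) ^ 2 * β k := by
  gcongr
  exacts [(expWeight_pos δ' σ _).le, expWeight_mono_radius hδ (freqNorm_nonneg k), ha k]

lemma RapidDecay.expWeight_sq_mul_norm
    (hβ : RapidDecay fun k => expWeight δ σ (freqNorm k) ^ 2 * β k) (hδ : δ' ≤ δ)
    (ha : ∀ k, ‖a k‖ ≤ β k) : RapidDecay fun k => expWeight δ' σ (freqNorm k) ^ 2 * ‖a k‖ :=
  hβ.of_le (fun _ => by positivity) (expWeight_sq_mul_norm_le hδ ha)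

lemma RapidDecay.of_expWeight_sq_mul (hδ : 0 ≤ δ)
    (hβ : RapidDecay fun k => expWeight δ σ (freqNorm k) ^ 2 * β k) : RapidDecay β :=
  (hβ.of_weight_sq (fun k => nonneg_of_mul_nonneg_right (hβ.nonneg k)
    (pow_pos (expWeight_pos δ σ _) 2)) fun k _ => one_le_expWeight hδ (freqNorm_nonneg k)).1

lemma RapidDecay.expWeight_mul_norm
    (hβ : RapidDecay fun k => expWeight δ σ (freqNorm k) ^ 2 * β k) (hδ' : 0 ≤ δ') (hδ : δ' ≤ δ)
    (ha : ∀ k, ‖a k‖ ≤ β k) : RapidDecay fun k => expWeight δ' σ (freqNorm k) * ‖a k‖ :=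
  ((hβ.expWeight_sq_mul_norm hδ ha).of_weight_sq (fun _ => norm_nonneg _)
    fun k _ => one_le_expWeight hδ' (freqNorm_nonneg k)).2

lemma tsum_sq_freqNorm_mul_expWeight_mul_norm_le
    (hβ : RapidDecay fun k => expWeight δ σ (freqNorm k) ^ 2 * β k) (hδ' : 0 ≤ δ') (hδ : δ' ≤ δ)
    (ha : ∀ k, ‖a k‖ ≤ β k) :
    ∑' k, freqNorm k ^ 2 * (expWeight δ' σ (freqNorm k) * ‖a k‖) ≤
      ∑' k, freqNorm k ^ 2 * (expWeight δ σ (freqNorm k) ^ 2 * β k) := by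
  refine ((hβ.expWeight_mul_norm hδ' hδ ha).pow_mul 2).summable.tsum_le_tsum (fun k => ?_)
    (hβ.pow_mul 2).summable
  refine mul_le_mul_of_nonneg_left (le_trans ?_ (expWeight_sq_mul_norm_le hδ ha k)) (sq_nonneg _)
  gcongr
  exact le_self_pow₀ (one_le_expWeight hδ' (freqNorm_nonneg k)) two_ne_zero

lemma norm_expWeight_sq_mul_re_le {d c : Freq → ℂ} (hc : ∀ k, ‖c k‖ ≤ γ k) (k : Freq) :
    ‖expWeight δ σ (freqNorm k) ^ 2 * (conj (d k) * c k).re‖ ≤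
      expWeight δ σ (freqNorm k) ^ 2 * ‖d k‖ * γ k := by
  rw [norm_mul, Real.norm_of_nonneg (sq_nonneg _), mul_assoc]
  refine mul_le_mul_of_nonneg_left ((Complex.abs_re_le_norm _).trans ?_) (sq_nonneg _)
  rw [norm_mul, RCLike.norm_conj]
  exact mul_le_mul_of_nonneg_left (hc k) (norm_nonneg _)

lemma summable_expWeight_sq_mul_re {d c : Freq → ℂ}
    (hd : RapidDecay fun k => expWeight δ σ (freqNorm k) ^ 2 * ‖d k‖) (hγ : RapidDecay γ)
    (hc : ∀ k, ‖c k‖ ≤ γ k) :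
    Summable fun k => expWeight δ σ (freqNorm k) ^ 2 * (conj (d k) * c k).re :=
  .of_norm_bounded (hd.mul hγ).summable (norm_expWeight_sq_mul_re_le hc)

lemma difference_energy_le (hασ : α ≤ σ) (hσ0 : 0 ≤ σ) (hσ1 : σ ≤ 1) (hδ' : 0 ≤ δ') (hδ : δ' ≤ δ)
    (hβ : RapidDecay fun k => expWeight δ σ (freqNorm k) ^ 2 * β k) (ha : ∀ k, ‖a k‖ ≤ β k)
    (hb : ∀ k, ‖b k‖ ≤ β k) (hsymm : ConjSymm b) (h0 : a 0 = b 0) :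
    ∑' k, expWeight δ' σ (freqNorm k) ^ 2 *
        (conj (a k - b k) * (transport α a a k - transport α b b k)).re ≤
      differenceRate δ σ β *
        ∑' k, (freqNorm k ^ (σ / 2) * (expWeight δ' σ (freqNorm k) * ‖a k - b k‖)) ^ 2 := by
  have hα := hασ.trans hσ1
  have hβ' := hβ.of_expWeight_sq_mul (hδ'.trans hδ)
  have hd0 : a 0 - b 0 = 0 := sub_eq_zero.2 h0
  have hab : ∀ k, ‖a k - b k‖ ≤ β k + β k := fun k =>
    (norm_sub_le _ _).trans (add_le_add (ha k) (hb k))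
  have hd : RapidDecay fun k => expWeight δ' σ (freqNorm k) ^ 2 * ‖a k - b k‖ := by
    refine RapidDecay.expWeight_sq_mul_norm (β := fun k => β k + β k) ?_ hδ hab
    simpa only [mul_add] using hβ.add hβ
  have htransported := transported_energy_le hα hσ0 hσ1 hδ' hsymm hd0
    (hβ.expWeight_mul_norm hδ' hδ hb) hd
  have htransporting := transporting_energy_le hασ hσ0 hσ1 hδ' hd0
    (hβ.expWeight_mul_norm hδ' hδ ha) hd
  have hdissipation : 0 ≤ ∑' k,
      (freqNorm k ^ (σ / 2) * (expWeight δ' σ (freqNorm k) * ‖a k - b k‖)) ^ 2 :=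
    tsum_nonneg fun k => sq_nonneg _
  simp only [transport_sub_transport hα hβ' ha hb, mul_add, Complex.add_re]
  rw [(summable_expWeight_sq_mul_re hd (hβ'.transportMajorant (hβ'.add hβ'))
      (norm_transport_le hα hβ' (hβ'.add hβ') hb hab)).tsum_add
    (summable_expWeight_sq_mul_re hd ((hβ'.add hβ').transportMajorant hβ')
      (norm_transport_le hα (hβ'.add hβ') hβ' hab ha)), differenceRate, add_mul, add_mul]
  refine add_le_add (htransported.trans ?_) (htransporting.trans ?_)
  · refine mul_le_mul_of_nonneg_right (mul_le_mul hδ ?_ ?_ (hδ'.trans hδ)) hdissipation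
    · exact tsum_sq_freqNorm_mul_expWeight_mul_norm_le hβ hδ' hδ hb
    · exact tsum_nonneg ((hβ.expWeight_mul_norm hδ' hδ hb).pow_mul 2).nonneg
  · exact mul_le_mul_of_nonneg_right (mul_le_mul_of_nonneg_left
      (tsum_sq_freqNorm_mul_expWeight_mul_norm_le hβ hδ' hδ ha) zero_le_two) hdissipation

end difference

section energy

variable {σ ν δ τ t₀ t₁ : ℝ} {β γ : Freq → ℝ} {d d' : ℝ → Freq → ℂ}

lemma expWeight_sq_mul_norm_sq_le {a : Freq → ℂ} (hτ : τ ≤ δ) (ha : ∀ k, ‖a k‖ ≤ β k)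
    (k : Freq) :
    ‖expWeight τ σ (freqNorm k) ^ 2 * ‖a k‖ ^ 2‖ ≤ expWeight δ σ (freqNorm k) ^ 2 * β k * β k := by
  rw [Real.norm_of_nonneg (by positivity), sq ‖a k‖, ← mul_assoc]
  exact mul_le_mul (expWeight_sq_mul_norm_le hτ ha k) (ha k) (norm_nonneg _)
    ((by positivity : (0 : ℝ) ≤ _).trans (expWeight_sq_mul_norm_le hτ ha k))

lemma summable_expWeight_sq_mul_norm_sq {a : Freq → ℂ} (hδ : 0 ≤ δ)
    (hβ : RapidDecay fun k => expWeight δ σ (freqNorm k) ^ 2 * β k) (hτ : τ ≤ δ)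
    (ha : ∀ k, ‖a k‖ ≤ β k) :
    Summable fun k => expWeight τ σ (freqNorm k) ^ 2 * ‖a k‖ ^ 2 :=
  .of_norm_bounded (hβ.mul (hβ.of_expWeight_sq_mul hδ)).summable
    (expWeight_sq_mul_norm_sq_le hτ ha)

lemma continuousOn_tsum_expWeight_sq_mul_norm_sq (hδ : 0 ≤ δ)
    (hβ : RapidDecay fun k => expWeight δ σ (freqNorm k) ^ 2 * β k)
    (hτ : ∀ t ∈ Set.Icc t₀ t₁, τ - ν * t ≤ δ) (hd : ∀ t ∈ Set.Icc t₀ t₁, ∀ k, ‖d t k‖ ≤ β k)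
    (hcont : ∀ k, ContinuousOn (fun t => d t k) (Set.Icc t₀ t₁)) :
    ContinuousOn (fun t => ∑' k, expWeight (τ - ν * t) σ (freqNorm k) ^ 2 * ‖d t k‖ ^ 2)
      (Set.Icc t₀ t₁) := by
  refine continuousOn_tsum (fun k => ?_) (hβ.mul (hβ.of_expWeight_sq_mul hδ)).summable
    fun k t ht => expWeight_sq_mul_norm_sq_le (hτ t ht) (hd t ht) k
  exact ContinuousOn.mul (fun t _ => (hasDerivAt_expWeight_sq τ ν σ (freqNorm k)
    t).continuousAt.continuousWithinAt) ((hcont k).norm.pow 2)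

lemma dissipation_le (hσ0 : 0 < σ) (hσ1 : σ ≤ 1) {a : Freq → ℂ} (hτ : τ ≤ δ)
    (ha : ∀ k, ‖a k‖ ≤ β k) (k : Freq) :
    (freqNorm k ^ (σ / 2) * (expWeight τ σ (freqNorm k) * ‖a k‖)) ^ 2 ≤
      freqNorm k * (expWeight δ σ (freqNorm k) ^ 2 * β k * β k) := by
  rw [mul_pow, sq_freqNorm_rpow_half, mul_pow]
  exact mul_le_mul (freqNorm_rpow_le_self_of_pos hσ0 hσ1 k)
    ((Real.le_norm_self _).trans (expWeight_sq_mul_norm_sq_le hτ ha k))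
    (by positivity) (freqNorm_nonneg k)

lemma hasDerivAt_expWeight_sq_mul_norm_sq (τ ν σ : ℝ) {f : ℝ → ℂ} {f' : ℂ} {t : ℝ} (k : Freq)
    (hf : HasDerivAt f f' t) :
    HasDerivAt (fun t => expWeight (τ - ν * t) σ (freqNorm k) ^ 2 * ‖f t‖ ^ 2)
      (2 * (expWeight (τ - ν * t) σ (freqNorm k) ^ 2 * (conj (f t) * f').re -
        ν * (freqNorm k ^ (σ / 2) * (expWeight (τ - ν * t) σ (freqNorm k) * ‖f t‖)) ^ 2)) t := by
  refine ((hasDerivAt_expWeight_sq τ ν σ (freqNorm k) t).mul (hasDerivWithinAt_univ.1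
    (hasDerivWithinAt_norm_sq hf.hasDerivWithinAt))).congr_deriv ?_
  rw [mul_pow, sq_freqNorm_rpow_half]
  ring

lemma hasDerivAt_tsum_expWeight_sq_mul_norm_sq (hσ0 : 0 < σ) (hσ1 : σ ≤ 1) (hδ : 0 ≤ δ)
    (hν : 0 ≤ ν) (hβ : RapidDecay fun k => expWeight δ σ (freqNorm k) ^ 2 * β k)
    (hγ : RapidDecay γ) (hτ : ∀ t ∈ Set.Ioo t₀ t₁, τ - ν * t ≤ δ)
    (hd : ∀ t ∈ Set.Ioo t₀ t₁, ∀ k, ‖d t k‖ ≤ β k)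
    (hd' : ∀ t ∈ Set.Ioo t₀ t₁, ∀ k, ‖d' t k‖ ≤ γ k)
    (hderiv : ∀ t ∈ Set.Ioo t₀ t₁, ∀ k, HasDerivAt (fun t => d t k) (d' t k) t) {t : ℝ}
    (ht : t ∈ Set.Ioo t₀ t₁) :
    HasDerivAt (fun t => ∑' k, expWeight (τ - ν * t) σ (freqNorm k) ^ 2 * ‖d t k‖ ^ 2)
      (2 * (∑' k, expWeight (τ - ν * t) σ (freqNorm k) ^ 2 * (conj (d t k) * d' t k).re -
        ν * ∑' k, (freqNorm k ^ (σ / 2) *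
          (expWeight (τ - ν * t) σ (freqNorm k) * ‖d t k‖)) ^ 2)) t := by
  have hβ' := hβ.of_expWeight_sq_mul hδ
  have hββ := hβ.mul hβ'
  set growth : Freq → ℝ → ℝ := fun k t =>
    expWeight (τ - ν * t) σ (freqNorm k) ^ 2 * (conj (d t k) * d' t k).re
  set dissipation : Freq → ℝ → ℝ := fun k t =>
    (freqNorm k ^ (σ / 2) * (expWeight (τ - ν * t) σ (freqNorm k) * ‖d t k‖)) ^ 2
  have hgrowth : ∀ k, ∀ u ∈ Set.Ioo t₀ t₁,
      ‖growth k u‖ ≤ expWeight δ σ (freqNorm k) ^ 2 * β k * γ k := fun k u hu =>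
    (norm_expWeight_sq_mul_re_le (hd' u hu) k).trans (mul_le_mul_of_nonneg_right
      (expWeight_sq_mul_norm_le (hτ u hu) (hd u hu) k) (hγ.nonneg k))
  have hdissipation : ∀ k, ∀ u ∈ Set.Ioo t₀ t₁,
      ‖dissipation k u‖ ≤ freqNorm k * (expWeight δ σ (freqNorm k) ^ 2 * β k * β k) :=
    fun k u hu => (Real.norm_of_nonneg (sq_nonneg _)).trans_le
      (dissipation_le hσ0 hσ1 (hτ u hu) (hd u hu) k)
  have hbound : ∀ k, ∀ u ∈ Set.Ioo t₀ t₁, ‖2 * (growth k u - ν * dissipation k u)‖ ≤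
      2 * (expWeight δ σ (freqNorm k) ^ 2 * β k * γ k +
        ν * (freqNorm k * (expWeight δ σ (freqNorm k) ^ 2 * β k * β k))) := fun k u hu => by
    rw [norm_mul, Real.norm_of_nonneg zero_le_two]
    refine mul_le_mul_of_nonneg_left ((norm_sub_le _ _).trans
      (add_le_add (hgrowth k u hu) ?_)) zero_le_two
    rw [norm_mul, Real.norm_of_nonneg hν]
    exact mul_le_mul_of_nonneg_left (hdissipation k u hu) hν
  have hgrowth_summable : Summable fun k => growth k t :=
    .of_norm_bounded (hβ.mul hγ).summable fun k => hgrowth k t ht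
  have hdissipation_summable : Summable fun k => dissipation k t :=
    .of_norm_bounded hββ.freqNorm_mul.summable fun k => hdissipation k t ht
  rw [← tsum_mul_left (a := ν), ← hgrowth_summable.tsum_sub (hdissipation_summable.mul_left ν),
    ← tsum_mul_left]
  exact hasDerivAt_tsum_of_isPreconnected (((hβ.mul hγ).summable.add
    (hββ.freqNorm_mul.summable.mul_left ν)).mul_left 2) isOpen_Ioo isPreconnected_Ioo
    (fun k u hu => hasDerivAt_expWeight_sq_mul_norm_sq τ ν σ k (hderiv u hu k)) hbound ht
    (summable_expWeight_sq_mul_norm_sq hδ hβ (hτ t ht) (hd t ht)) ht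

end energy

/-- `a` solves the system for the Fourier coefficients of a real mean-free function on `[t₀, t₁]`
and is bounded there by `β`, uniformly in time. -/
structure IsCoeffSolution (α : ℝ) (β : Freq → ℝ) (t₀ t₁ : ℝ) (a : ℝ → Freq → ℂ) : Prop where
  symm : ∀ t ∈ Set.Icc t₀ t₁, ConjSymm (a t)
  apply_zero : ∀ t ∈ Set.Icc t₀ t₁, a t 0 = 0
  norm_le : ∀ t ∈ Set.Icc t₀ t₁, ∀ k, ‖a t k‖ ≤ β k
  continuousOn : ∀ k, ContinuousOn (fun t => a t k) (Set.Icc t₀ t₁)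
  equation : ∀ t ∈ Set.Ioo t₀ t₁, ∀ k, HasDerivAt (fun t => a t k) (transport α (a t) (a t) k) t

namespace IsCoeffSolution

variable {α σ δ ν t₀ t₁ T : ℝ} {β γ : Freq → ℝ} {a b : ℝ → Freq → ℂ}

lemma mono_bound (h : IsCoeffSolution α β t₀ t₁ a) (hβγ : ∀ k, β k ≤ γ k) :
    IsCoeffSolution α γ t₀ t₁ a :=
  { h with norm_le t ht k := (h.norm_le t ht k).trans (hβγ k) }

lemma mono_interval {s₀ s₁ : ℝ} (h : IsCoeffSolution α β t₀ t₁ a) (h₀ : t₀ ≤ s₀) (h₁ : s₁ ≤ t₁) :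
    IsCoeffSolution α β s₀ s₁ a where
  symm t ht := h.symm t (Set.Icc_subset_Icc h₀ h₁ ht)
  apply_zero t ht := h.apply_zero t (Set.Icc_subset_Icc h₀ h₁ ht)
  norm_le t ht := h.norm_le t (Set.Icc_subset_Icc h₀ h₁ ht)
  continuousOn k := (h.continuousOn k).mono (Set.Icc_subset_Icc h₀ h₁)
  equation t ht := h.equation t (Set.Ioo_subset_Ioo h₀ h₁ ht)

lemma antitoneOn_energy (ha : IsCoeffSolution α β t₀ t₁ a) (hb : IsCoeffSolution α β t₀ t₁ b)
    (hασ : α ≤ σ) (hσ0 : 0 < σ) (hσ1 : σ ≤ 1) (hδ : 0 ≤ δ)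
    (hβ : RapidDecay fun k => expWeight δ σ (freqNorm k) ^ 2 * β k)
    (hν : differenceRate δ σ β ≤ ν) (ht : ν * (t₁ - t₀) ≤ δ) :
    AntitoneOn (fun t => ∑' k,
      expWeight (δ + ν * t₀ - ν * t) σ (freqNorm k) ^ 2 * ‖a t k - b t k‖ ^ 2) (Set.Icc t₀ t₁) := by
  have hα := hασ.trans hσ1
  have hν0 := (differenceRate_nonneg hδ hβ).trans hν
  have hradius : ∀ t ∈ Set.Icc t₀ t₁, δ + ν * t₀ - ν * t ∈ Set.Icc 0 δ := fun t ht =>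
    ⟨by nlinarith [ht.2], by nlinarith [ht.1]⟩
  have hβ2 : RapidDecay fun k => expWeight δ σ (freqNorm k) ^ 2 * (β k + β k) := by
    simpa only [mul_add] using hβ.add hβ
  have hd : ∀ t ∈ Set.Icc t₀ t₁, ∀ k, ‖a t k - b t k‖ ≤ β k + β k := fun t ht k =>
    (norm_sub_le _ _).trans (add_le_add (ha.norm_le t ht k) (hb.norm_le t ht k))
  have hβ' := hβ.of_expWeight_sq_mul hδ
  have hIoo := @Set.Ioo_subset_Icc_self ℝ _ t₀ t₁
  have hderiv := fun t => hasDerivAt_tsum_expWeight_sq_mul_norm_sq (t := t) hσ0 hσ1 hδ hν0 hβ2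
    ((hβ'.transportMajorant hβ').add (hβ'.transportMajorant hβ'))
    (fun t ht => (hradius t (hIoo ht)).2) (fun t ht => hd t (hIoo ht))
    (fun t ht k => (norm_sub_le _ _).trans (add_le_add
      (norm_transport_le hα hβ' hβ' (ha.norm_le t (hIoo ht)) (ha.norm_le t (hIoo ht)) k)
      (norm_transport_le hα hβ' hβ' (hb.norm_le t (hIoo ht)) (hb.norm_le t (hIoo ht)) k)))
    fun t ht k => (ha.equation t ht k).sub (hb.equation t ht k)
  refine antitoneOn_of_deriv_nonpos (convex_Icc _ _) (continuousOn_tsum_expWeight_sq_mul_norm_sq hδ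
    hβ2 (fun t ht => (hradius t ht).2) hd fun k => (ha.continuousOn k).sub (hb.continuousOn k))
    ?_ ?_ <;> rw [interior_Icc] <;> intro t ht
  · exact (hderiv t ht).differentiableAt.differentiableWithinAt
  · rw [(hderiv t ht).deriv]
    have htIcc := hIoo ht
    have henergy := difference_energy_le hασ hσ0.le hσ1 (hradius t htIcc).1 (hradius t htIcc).2 hβ
      (ha.norm_le t htIcc) (hb.norm_le t htIcc) (hb.symm t htIcc)
      ((ha.apply_zero t htIcc).trans (hb.apply_zero t htIcc).symm)
    have hrate := mul_le_mul_of_nonneg_right hν (tsum_nonneg (L := .unconditional _) fun k =>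
      sq_nonneg (freqNorm k ^ (σ / 2) *
        (expWeight (δ + ν * t₀ - ν * t) σ (freqNorm k) * ‖a t k - b t k‖)))
    linarith

lemma eq_of_mul_sub_le (ha : IsCoeffSolution α β t₀ t₁ a) (hb : IsCoeffSolution α β t₀ t₁ b)
    (hασ : α ≤ σ) (hσ0 : 0 < σ) (hσ1 : σ ≤ 1) (hδ : 0 ≤ δ)
    (hβ : RapidDecay fun k => expWeight δ σ (freqNorm k) ^ 2 * β k)
    (hν : differenceRate δ σ β ≤ ν) (h01 : t₀ ≤ t₁) (ht : ν * (t₁ - t₀) ≤ δ)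
    (hab : a t₀ = b t₀) : a t₁ = b t₁ := by
  have henergy := ha.antitoneOn_energy hb hασ hσ0 hσ1 hδ hβ hν ht (Set.left_mem_Icc.2 h01)
    (Set.right_mem_Icc.2 h01) h01
  simp only [hab, sub_self, norm_zero, zero_pow two_ne_zero, mul_zero, tsum_zero] at henergy
  have hν0 := (differenceRate_nonneg hδ hβ).trans hν
  have hradius : δ + ν * t₀ - ν * t₁ ≤ δ := by nlinarith
  have hsummable := summable_expWeight_sq_mul_norm_sq (a := fun k => a t₁ k - b t₁ k)
    (β := fun k => β k + β k) hδ (by simpa only [mul_add] using hβ.add hβ) hradius fun k =>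
      (norm_sub_le _ _).trans (add_le_add (ha.norm_le t₁ (Set.right_mem_Icc.2 h01) k)
        (hb.norm_le t₁ (Set.right_mem_Icc.2 h01) k))
  ext k
  have hk := (hsummable.le_tsum k fun l _ => by positivity).trans henergy
  have hpos := pow_pos (expWeight_pos (δ + ν * t₀ - ν * t₁) σ (freqNorm k)) 2
  rw [← sub_eq_zero, ← norm_eq_zero, ← sq_eq_zero_iff]
  exact le_antisymm (nonpos_of_mul_nonpos_right hk hpos) (sq_nonneg _)

lemma eq (ha : IsCoeffSolution α β 0 T a) (hb : IsCoeffSolution α β 0 T b)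
    (hασ : α ≤ σ) (hσ0 : 0 < σ) (hσ1 : σ ≤ 1) (hδ : 0 < δ)
    (hβ : RapidDecay fun k => expWeight δ σ (freqNorm k) ^ 2 * β k) (hab : a 0 = b 0) {t : ℝ}
    (ht : t ∈ Set.Icc 0 T) : a t = b t := by
  set ν := differenceRate δ σ β + 1
  have hν : 0 < ν := by linarith [differenceRate_nonneg hδ.le hβ]
  have hstep : 0 < δ / ν := by positivity
  have hsteps : ∀ n : ℕ, ∀ t ∈ Set.Icc 0 T, t ≤ n * (δ / ν) → a t = b t := by
    intro n
    induction n with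
    | zero =>
      intro t ht htn
      rwa [le_antisymm (by simpa using htn) ht.1]
    | succ n ih =>
      intro t ht htn
      obtain hle | hle := le_total t (n * (δ / ν))
      · exact ih t ht hle
      · have h0 : 0 ≤ n * (δ / ν) := by positivity
        refine (ha.mono_interval h0 ht.2).eq_of_mul_sub_le (hb.mono_interval h0 ht.2) hασ hσ0 hσ1
          hδ.le hβ (lt_add_one _).le hle ?_ (ih _ ⟨h0, hle.trans ht.2⟩ le_rfl)
        rw [mul_comm, ← le_div_iff₀ hν]
        push_cast at htn
        linarith
  obtain ⟨n, hn⟩ := exists_nat_ge (t / (δ / ν))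
  exact hsteps n t ht ((div_le_iff₀ hstep).1 hn)

end IsCoeffSolution

lemma rapidDecay_expWeight_sq_mul_exp_neg {δ σ τ : ℝ} (hδ : 2 * δ < τ) (hσ : 0 < σ) {M : ℝ}
    (hM : 0 ≤ M) : RapidDecay fun k =>
      expWeight δ σ (freqNorm k) ^ 2 * (M * Real.exp (-τ * freqNorm k ^ σ)) := by
  convert (rapidDecay_exp_neg (sub_pos.2 hδ) hσ).const_mul hM using 2 with k
  rw [expWeight, ← Real.exp_nat_mul, mul_left_comm, ← Real.exp_add]
  congr 2
  push_cast
  ring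

/-! ### Time-dependent Fourier series -/

section timeDependent

variable {c d : ℝ → Freq → ℂ} {β γ : Freq → ℝ} {I : Set ℝ} {t : ℝ}

lemma continuous_series_mul_character {c : Freq → ℂ} (hc : Summable fun k => ‖c k‖) (m : Freq) :
    Continuous fun x => series c x * character m x :=
  (continuous_series hc).mul (continuous_character m)

lemma norm_series_mul_character_le {c : Freq → ℂ} (hβ : Summable β) (hc : ∀ k, ‖c k‖ ≤ β k)
    (m : Freq) (x : Plane) : ‖series c x * character m x‖ ≤ ∑' k, β k := by
  rw [norm_mul_character]
  exact tsum_of_norm_bounded hβ.hasSum fun k => (norm_mul_character _ _ _).trans_le (hc k)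

lemma continuousOn_coeff_of_series (hβ : Summable β) (hc : ∀ u ∈ I, ∀ k, ‖c u k‖ ≤ β k)
    (h : ∀ x, ContinuousOn (fun u => series (c u) x) I) (m : Freq) :
    ContinuousOn (fun u => c u m) I := by
  have hsum : ∀ u ∈ I, Summable fun k => ‖c u k‖ := fun u hu =>
    hβ.of_nonneg_of_le (fun _ => norm_nonneg _) (hc u hu)
  have hint : ContinuousOn (fun u => ∫ x in cell, series (c u) x * character (-m) x) I :=
    continuousOn_of_dominated (bound := fun _ => ∑' k, β k)
      (fun u hu => (continuous_series_mul_character (hsum u hu) _).aestronglyMeasurable)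
      (fun u hu => .of_forall fun x => norm_series_mul_character_le hβ (hc u hu) _ x)
      (integrableOn_const isCompact_Icc.measure_lt_top.ne)
      (.of_forall fun x => (h x).mul continuousOn_const)
  exact (continuousOn_const.mul hint).congr fun u hu =>
    (integral_series_mul_character (hsum u hu) m).symm

lemma hasDerivAt_coeff_of_series (hβ : Summable β) (hγ : Summable γ) (hI : I ∈ 𝓝 t)
    (hc : ∀ u ∈ I, ∀ k, ‖c u k‖ ≤ β k) (hd : ∀ u ∈ I, ∀ k, ‖d u k‖ ≤ γ k)
    (h : ∀ u ∈ I, ∀ x, HasDerivAt (fun v => series (c v) x) (series (d u) x) u) (m : Freq) :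
    HasDerivAt (fun u => c u m) (d t m) t := by
  have hcsum : ∀ u ∈ I, Summable fun k => ‖c u k‖ := fun u hu =>
    hβ.of_nonneg_of_le (fun _ => norm_nonneg _) (hc u hu)
  have hdsum : Summable fun k => ‖d t k‖ :=
    hγ.of_nonneg_of_le (fun _ => norm_nonneg _) (hd t (mem_of_mem_nhds hI))
  have hint : HasDerivAt (fun u => ∫ x in cell, series (c u) x * character (-m) x)
      (∫ x in cell, series (d t) x * character (-m) x) t :=
    (hasDerivAt_integral_of_dominated_loc_of_deriv_le (bound := fun _ => ∑' k, γ k)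
      (F' := fun u x => series (d u) x * character (-m) x) hI
      (by
        filter_upwards [hI] with u hu
        exact (continuous_series_mul_character (hcsum u hu) _).aestronglyMeasurable)
      ((continuous_series_mul_character
        (hcsum t (mem_of_mem_nhds hI)) _).continuousOn.integrableOn_compact isCompact_Icc)
      (continuous_series_mul_character hdsum _).aestronglyMeasurable
      (.of_forall fun x u hu => norm_series_mul_character_le hγ (hd u hu) _ x)
      (integrableOn_const isCompact_Icc.measure_lt_top.ne)
      (.of_forall fun x u hu => (h u hu x).mul_const _)).2
  rw [← integral_series_mul_character hdsum m]
  refine (hint.const_mul _).congr_of_eventuallyEq ?_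
  filter_upwards [hI] with u hu
  exact (integral_series_mul_character (hcsum u hu) m).symm

lemma hasDerivWithinAt_series_of_taylor {d : Freq → ℂ} {b : Freq → ℝ} (hb : Summable b)
    (hc : ∀ u ∈ I, Summable fun k => ‖c u k‖) (hd : Summable fun k => ‖d k‖) (ht : t ∈ I)
    (h : ∀ u ∈ I, ∀ k, ‖c u k - c t k - ((u - t : ℝ) : ℂ) * d k‖ ≤ b k * (u - t) ^ 2)
    (x : Plane) : HasDerivWithinAt (fun u => series (c u) x) (series d x) I t := by
  have hremainder : ∀ u ∈ I, ‖series (c u) x - series (c t) x - (u - t) • series d x‖ ≤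
      (∑' k, b k) * ‖(u - t) ^ 2‖ := by
    intro u hu
    rw [Real.norm_of_nonneg (sq_nonneg _)]
    have hsum := (((summable_series (hc u hu) x).hasSum.sub
      (summable_series (hc t ht) x).hasSum).sub
      ((summable_series hd x).hasSum.mul_left ((u - t : ℝ) : ℂ)))
    rw [Complex.real_smul, series, series, series, ← hsum.tsum_eq]
    refine tsum_of_norm_bounded (hb.hasSum.mul_right _) fun k => ?_
    rw [← mul_assoc, ← sub_mul, ← sub_mul, norm_mul_character]
    exact h u hu k
  have hsq : (fun u => (u - t) ^ 2) =o[𝓝[I] t] fun u => u - t := by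
    simpa using (Asymptotics.isLittleO_pow_sub_sub t one_lt_two).mono
      (nhdsWithin_le_nhds (s := I))
  rw [hasDerivWithinAt_iff_isLittleO]
  refine Asymptotics.IsBigO.trans_isLittleO (.of_bound (∑' k, b k) ?_) hsq
  filter_upwards [self_mem_nhdsWithin] with u hu using hremainder u hu

end timeDependent

/-! ### Gevrey solutions -/

section solution

variable {r s α T T' τ M : ℝ} {θ₀ : Plane → ℝ} {θ η : ℝ → Plane → ℝ}

lemma RapidDecay.transport {β : Freq → ℝ} (hβ : RapidDecay β) (hα : α ≤ 1) {a : Freq → ℂ}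
    (ha : ∀ k, ‖a k‖ ≤ β k) : RapidDecay fun k => ‖transport α a a k‖ :=
  (hβ.transportMajorant hβ).of_le (fun _ => norm_nonneg _) (norm_transport_le hα hβ hβ ha ha)

lemma isCoeffSolution_of_eq_series {β : Freq → ℝ} {c : ℝ → Freq → ℂ} (hα : α ≤ 1)
    (hβ : RapidDecay β) (hT' : T' < T) (hsymm : ∀ t ∈ Set.Icc 0 T', ConjSymm (c t))
    (h0 : ∀ t ∈ Set.Icc 0 T', c t 0 = 0) (hc : ∀ t ∈ Set.Icc 0 T', ∀ k, ‖c t k‖ ≤ β k)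
    (hser : ∀ t ∈ Set.Icc 0 T', ∀ x, (θ t x : ℂ) = series (c t) x)
    (hθ : IsGevreySolution r s α T θ₀ θ) : IsCoeffSolution α β 0 T' c := by
  have hderiv : ∀ t ∈ Set.Icc 0 T', ∀ x, HasDerivWithinAt (fun u => series (c u) x)
      (series (transport α (c t) (c t)) x) (Set.Icc 0 T') t := by
    intro t ht x
    have hdecay : RapidDecay fun k => ‖c t k‖ := hβ.of_le (fun _ => norm_nonneg _) (hc t ht)
    rw [← neg_sum_velocity_mul_partialDeriv_eq_series hα (hser t ht) hdecay (hsymm t ht)]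
    exact ((hθ.equation t ⟨ht.1, ht.2.trans_lt hT'⟩ x).mono fun u hu =>
      ⟨hu.1, hu.2.trans_lt hT'⟩).congr_of_mem (fun u hu => (hser u hu x).symm) ht
  refine ⟨hsymm, h0, hc, fun k => ?_, fun t ht k => ?_⟩
  · exact continuousOn_coeff_of_series hβ.summable hc
      (fun x t ht => (hderiv t ht x).continuousWithinAt) k
  · have hIcc : Set.Ioo 0 T' ⊆ Set.Icc 0 T' := Set.Ioo_subset_Icc_self
    exact hasDerivAt_coeff_of_series (d := fun u => transport α (c u) (c u)) hβ.summable
      (hβ.transportMajorant hβ).summable (isOpen_Ioo.mem_nhds ht) (fun u hu => hc u (hIcc hu))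
      (fun u hu => norm_transport_le hα hβ hβ (hc u (hIcc hu)) (hc u (hIcc hu)))
      (fun u hu x => (hderiv u (hIcc hu) x).hasDerivAt (Icc_mem_nhds hu.1 hu.2)) k

lemma IsGevreySolution.exists_isCoeffSolution (hr : 0 < r) (hs : 0 < s) (hα : α ≤ 1)
    (hθ : IsGevreySolution r s α T θ₀ θ) (hT' : T' < T) :
    ∃ τ > 0, ∃ M ≥ 0, IsCoeffSolution α (fun k => M * Real.exp (-τ * freqNorm k ^ (1 / s))) 0 T'
        (fun t => fourierCoef (θ t)) ∧
      ∀ t ∈ Set.Icc 0 T', ∀ x, (θ t x : ℂ) = series (fourierCoef (θ t)) x := by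
  obtain ⟨τ, hτ, M, hM⟩ := hθ.gevrey T' hT'
  have hM0 : 0 ≤ max M 0 := le_max_right M 0
  have hβ : RapidDecay fun k => max M 0 * Real.exp (-τ * freqNorm k ^ (1 / s)) :=
    (rapidDecay_exp_neg hτ (one_div_pos.2 hs)).const_mul hM0
  have hbound : ∀ t ∈ Set.Icc 0 T', ∀ k,
      ‖fourierCoef (θ t) k‖ ≤ max M 0 * Real.exp (-τ * freqNorm k ^ (1 / s)) := fun t ht =>
    (hM t ht).1.norm_fourierCoef_le hr hM0
      ((hM t ht).2.trans (ENNReal.ofReal_le_ofReal (le_max_left M 0)))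
  have hser : ∀ t ∈ Set.Icc 0 T', ∀ x, (θ t x : ℂ) = series (fourierCoef (θ t)) x := fun t ht =>
    (hM t ht).1.eq_series (hβ.summable.of_nonneg_of_le (fun _ => norm_nonneg _) (hbound t ht))
  exact ⟨τ, hτ, max M 0, hM0, isCoeffSolution_of_eq_series hα hβ hT'
    (fun t _ => conjSymm_fourierCoef _) (fun t ht => (hM t ht).1.fourierCoef_zero) hbound hser hθ,
    hser⟩

lemma IsGevreySolution.eq (hr : 0 < r) (hs : 1 ≤ s) (hα : α ≤ 1 / s)
    (hθ : IsGevreySolution r s α T θ₀ θ) (hη : IsGevreySolution r s α T θ₀ η) {t : ℝ}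
    (ht : t ∈ Set.Ico 0 T) : θ t = η t := by
  have hs0 : 0 < s := zero_lt_one.trans_le hs
  have hσ0 : 0 < 1 / s := one_div_pos.2 hs0
  have hσ1 : 1 / s ≤ 1 := (div_le_one hs0).2 hs
  obtain ⟨τ₁, hτ₁, M₁, hM₁, hsol₁, hser₁⟩ :=
    hθ.exists_isCoeffSolution hr hs0 (hα.trans hσ1) ht.2
  obtain ⟨τ₂, hτ₂, M₂, hM₂, hsol₂, hser₂⟩ :=
    hη.exists_isCoeffSolution hr hs0 (hα.trans hσ1) ht.2
  set δ := min τ₁ τ₂ / 4 with hδ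
  have hδ0 : 0 < δ := div_pos (lt_min hτ₁ hτ₂) four_pos
  have hδ₁ : 2 * δ < τ₁ := by linarith [min_le_left τ₁ τ₂]
  have hδ₂ : 2 * δ < τ₂ := by linarith [min_le_right τ₁ τ₂]
  have hdecay := (rapidDecay_expWeight_sq_mul_exp_neg hδ₁ hσ0 hM₁).add
    (rapidDecay_expWeight_sq_mul_exp_neg hδ₂ hσ0 hM₂)
  simp only [← mul_add] at hdecay
  have htt : t ∈ Set.Icc 0 t := ⟨ht.1, le_rfl⟩
  have hcoef : fourierCoef (θ t) = fourierCoef (η t) :=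
    (hsol₁.mono_bound fun k => le_add_of_nonneg_right (by positivity)).eq
      (hsol₂.mono_bound fun k => le_add_of_nonneg_left (by positivity)) hα hσ0 hσ1 hδ0 hdecay
      (by simp only [hθ.initial, hη.initial]) htt
  ext x
  exact_mod_cast (hser₁ t htt x).trans (hcoef ▸ (hser₂ t htt x).symm)

lemma IsTaylorSolution.isGevreySolution {b : Freq → ℝ} {a₀ : Freq → ℂ} {a : ℝ → Freq → ℂ}
    (hr : 0 < r) (hs : 0 < s) (hα : α ≤ 1) (hτ : 0 < τ) (hM : 0 ≤ M) (hb : Summable b)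
    (ha : IsTaylorSolution α T b a₀ a)
    (hbound : ∀ t ∈ Set.Icc 0 T, ∀ S : Finset Freq,
      ∑ k ∈ S, (gevreyWeight r τ (1 / s) (freqNorm k) * ‖a t k‖) ^ 2 ≤ M ^ 2) :
    IsGevreySolution r s α T (fun x => (series a₀ x).re) fun t x => (series (a t) x).re := by
  have hβ : RapidDecay fun k => M * Real.exp (-τ * freqNorm k ^ (1 / s)) :=
    (rapidDecay_exp_neg hτ (one_div_pos.2 hs)).const_mul hM
  have hnorm : ∀ t ∈ Set.Icc 0 T, ∀ k, ‖a t k‖ ≤ M * Real.exp (-τ * freqNorm k ^ (1 / s)) :=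
    fun t ht k => norm_le_of_sum_gevreyWeight_le hr.le hM (ha.apply_zero t ht) (S := {k})
      (by simp) (hbound t ht {k})
  have hdecay : ∀ t ∈ Set.Icc 0 T, RapidDecay fun k => ‖a t k‖ := fun t ht =>
    hβ.of_le (fun _ => norm_nonneg _) (hnorm t ht)
  have hre : ∀ t ∈ Set.Icc 0 T, ∀ x, ((series (a t) x).re : ℂ) = series (a t) x := fun t ht =>
    ofReal_re_series (ha.symm t ht)
  refine ⟨fun T' hT' => ⟨τ, hτ, M, fun t ht => ?_⟩, fun t ht x => ?_, by rw [ha.initial]⟩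
  · have htT : t ∈ Set.Icc 0 T := ⟨ht.1, ht.2.trans hT'.le⟩
    exact memGevrey_of_eq_series hr hM (hre t htT) (hdecay t htT) (ha.apply_zero t htT)
      (hbound t htT)
  · have hsub : Set.Ico 0 T ⊆ Set.Icc 0 T := Set.Ico_subset_Icc_self
    have htT := hsub ht
    rw [neg_sum_velocity_mul_partialDeriv_eq_series hα (hre t htT) (hdecay t htT)
      (ha.symm t htT)]
    exact (hasDerivWithinAt_series_of_taylor hb (fun u hu => (hdecay u (hsub hu)).summable)
      (hβ.transport hα (hnorm t htT)).summable ht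
      (fun u hu => ha.taylor t htT u (hsub hu)) x).congr_of_mem
      (fun u hu => hre u (hsub hu) x) ht

lemma exists_isGevreySolution (hr : 3 < r) (hs : 1 ≤ s) (hα : α ≤ 1 / s) (hM : 0 < M)
    (hτ : 0 < τ) : ∃ T > 0, ∀ θ₀ : Plane → ℝ, MemGevrey r s τ θ₀ →
      gevreyNorm r s τ θ₀ ≤ ENNReal.ofReal M → ∃ θ, IsGevreySolution r s α T θ₀ θ := by
  have hr0 : 0 < r := three_pos.trans hr
  have hs0 : 0 < s := zero_lt_one.trans_le hs
  have hσ0 : 0 < 1 / s := one_div_pos.2 hs0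
  have hσ1 : 1 / s ≤ 1 := (div_le_one hs0).2 hs
  obtain ⟨T, hT, b, hb, hsol⟩ := exists_isTaylorSolution hr hα hσ0 hσ1 hM hτ
  refine ⟨T, hT, fun θ₀ hθ₀ hnorm => ?_⟩
  obtain ⟨a, ha, hbound⟩ := hsol _ (conjSymm_fourierCoef θ₀) hθ₀.fourierCoef_zero
    ((gevreyNorm_le_iff hr0 hM.le θ₀).1 hnorm)
  have hsummable : Summable fun k => ‖fourierCoef θ₀ k‖ :=
    ((rapidDecay_exp_neg hτ hσ0).const_mul hM.le).summable.of_nonneg_of_le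
      (fun _ => norm_nonneg _) (hθ₀.norm_fourierCoef_le hr0 hM.le hnorm)
  have hinitial : (fun x => (series (fourierCoef θ₀) x).re) = θ₀ := funext fun x => by
    rw [← hθ₀.eq_series hsummable, Complex.ofReal_re]
  exact ⟨_, hinitial ▸ ha.isGevreySolution hr0 hs0 (hα.trans hσ1) (half_pos hτ)
    (by positivity) hb.summable hbound⟩

end solution

end SIPM

end

theorem mainTheorem7_general (r α s : ℝ) (hr : 3 < r) (hs : 1 ≤ s) (hα : α ≤ 1 / s) :
    ∀ K₀ : ℝ, 0 < K₀ → ∀ τ₀ : ℝ, 0 < τ₀ → ∃ T : ℝ, 0 < T ∧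
      ∀ θ₀ : SIPM.Plane → ℝ, SIPM.MemGevrey r s τ₀ θ₀ →
        SIPM.gevreyNorm r s τ₀ θ₀ ≤ ENNReal.ofReal K₀ →
        ∃ θ : ℝ → SIPM.Plane → ℝ, SIPM.IsGevreySolution r s α T θ₀ θ ∧
          ∀ η : ℝ → SIPM.Plane → ℝ, SIPM.IsGevreySolution r s α T θ₀ η →
            ∀ t ∈ Set.Ico (0 : ℝ) T, η t = θ t := by
  intro K₀ hK₀ τ₀ hτ₀
  obtain ⟨T, hT, hexists⟩ := SIPM.exists_isGevreySolution hr hs hα hK₀ hτ₀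
  refine ⟨T, hT, fun θ₀ hθ₀ hnorm => ?_⟩
  obtain ⟨θ, hθ⟩ := hexists θ₀ hθ₀ hnorm
  exact ⟨θ, hθ, fun η hη t ht => hη.eq (three_pos.trans hr) hs hα hθ ht⟩

theorem mainTheorem7 (r α s : ℝ) (hr : 3 < r)
    (hαs : (0 < α ∧ α ≤ 1 ∧ 1 ≤ s ∧ s ≤ 1 / α) ∨ (α = 0 ∧ 1 ≤ s)) :
    ∀ K₀ : ℝ, 0 < K₀ → ∀ τ₀ : ℝ, 0 < τ₀ → ∃ T : ℝ, 0 < T ∧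
      ∀ θ₀ : SIPM.Plane → ℝ, SIPM.MemGevrey r s τ₀ θ₀ →
        SIPM.gevreyNorm r s τ₀ θ₀ ≤ ENNReal.ofReal K₀ →
        ∃ θ : ℝ → SIPM.Plane → ℝ, SIPM.IsGevreySolution r s α T θ₀ θ ∧
          ∀ η : ℝ → SIPM.Plane → ℝ, SIPM.IsGevreySolution r s α T θ₀ η →
            ∀ t ∈ Set.Ico (0 : ℝ) T, η t = θ t := by
  rcases hαs with ⟨hα0, -, hs, hsα⟩ | ⟨rfl, hs⟩
  · exact mainTheorem7_general r α s hr hs ((le_div_comm₀ (by linarith) hα0).1 hsα)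
  · exact mainTheorem7_general r 0 s hr hs (by positivity)
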